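/- Let $k$ be a field, $V$ a finite-dimensional $k$-vector space, $N\ge 2$ an integer, $R\subseteq V^{\otimes N}$ a subspace, and $A=\mathrm{Tens}(V)/(R)$ the corresponding $N$-homogeneous algebra, graded by the images $A_n$ of $V^{\otimes n}$; $k$ is a left $A$-module through the augmentation $A\to k$ that kills $V$. Put $n(2q)=qN$ and $n(2q+1)=qN+1$ for integers $q\ge 0$. Assume that $A$ is Koszul, i.e. for each $i\ge 3$ the graded vector space $\mathrm{Tor}_i^A(k,k)$ is concentrated in degree $n(i)$, that $A$ has finite global dimension $D$, and that $\mathrm{Ext}^D_A(k,A)\cong k$ (Ext is taken over left $A$-modules). Let $A^!=\mathrm{Tens}(V^*)/(R^\perp)$ be the dual $N$-homogeneous algebra, where $R^\perp\subseteq (V^*)^{\otimes N}=(V^{\otimes N})^*$ is the annihilator of $R$ for the pairing $\langle \alpha_1\otimes\cdots\otimes\alpha_N, v_1\otimes\cdots\otimes v_N\rangle=\prod_j\alpha_j(v_j)$. Let $u$ be a generator of the vector space $A^!_{n(D)}$, and let $u^*$ be the linear form on $A^!$ which is zero on $A^!_m$ for $m\ne n(D)$ and satisfies $u^*(u)=1$.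 For $0\le i\le D$ define the linear map $$\bar\Phi_{n(i)}: A^!_{n(D-i)}\to (A^!_{n(i)})^*,\qquad f\mapsto f\cdot u^*,\qquad \langle f\cdot u^*,h\rangle=\langle u^*,hf\rangle .$$ Then $A$ is AS-Gorenstein, i.e. $A$ has finite global dimension $D$, $\mathrm{Ext}^i_A(k,A)=0$ for all $i\ne D$ and $\mathrm{Ext}^D_A(k,A)\cong k$, if and only if the maps $\bar\Phi_{n(i)}$, $0\le i\le D$, are all bijective. -/

import Mathlib

open scoped TensorProduct DirectSum

universe u

noncomputable section

namespace NHomogeneous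

variable {k V : Type u} [Field k] [AddCommGroup V] [Module k V] {N : ℕ}

/-! ### `N`-homogeneous algebras -/

/-- The relations of the algebra: every element of `R ⊆ V^{⊗N}` is set equal to `0` in the
tensor algebra of `V`. -/
def Rel (R : Submodule k (⨂[k]^N V)) : TensorAlgebra k V → TensorAlgebra k V → Prop :=
  fun x y => (∃ r ∈ R, x = TensorPower.toTensorAlgebra r) ∧ y = 0

/-- The `N`-homogeneous algebra `Tens(V) / I(R)`, where `I(R)` is the two-sided ideal generated
by the space of relations `R ⊆ V^{⊗N}`. -/
def Alg (R : Submodule k (⨂[k]^N V)) : Type u := RingQuot (Rel R)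

instance (R : Submodule k (⨂[k]^N V)) : Ring (Alg R) := inferInstanceAs (Ring (RingQuot (Rel R)))

instance (R : Submodule k (⨂[k]^N V)) : Algebra k (Alg R) :=
  inferInstanceAs (Algebra k (RingQuot (Rel R)))

/-- The quotient map `Tens(V) → Tens(V) / I(R)`. -/
def Alg.mk (R : Submodule k (⨂[k]^N V)) : TensorAlgebra k V →ₐ[k] Alg R :=
  RingQuot.mkAlgHom k (Rel R)

/-- The inclusion of the generators `V → A`. -/
def Alg.ι (R : Submodule k (⨂[k]^N V)) : V →ₗ[k] Alg R :=
  (Alg.mk R).toLinearMap ∘ₗ TensorAlgebra.ι k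

/-- The homogeneous component `A_n`, i.e. the image of `V^{⊗n}` in `A`. -/
def Alg.grade (R : Submodule k (⨂[k]^N V)) (n : ℕ) : Submodule k (Alg R) :=
  LinearMap.range (Alg.ι R) ^ n

theorem Alg.mk_toTensorAlgebra {R : Submodule k (⨂[k]^N V)} {r : ⨂[k]^N V} (hr : r ∈ R) :
    Alg.mk R (TensorPower.toTensorAlgebra r) = 0 := by
  have h : Rel R (TensorPower.toTensorAlgebra r) 0 := ⟨⟨r, hr, rfl⟩, rfl⟩
  have := RingQuot.mkAlgHom_rel k h
  rw [map_zero] at this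
  exact this

/-- The universal property of `A`: algebra morphisms out of `Tens(V)` killing `R` descend. -/
def Alg.lift (R : Submodule k (⨂[k]^N V)) {B : Type u} [Semiring B] [Algebra k B]
    (f : TensorAlgebra k V →ₐ[k] B) (hf : ∀ r ∈ R, f (TensorPower.toTensorAlgebra r) = 0) :
    Alg R →ₐ[k] B :=
  RingQuot.liftAlgHom k ⟨f, by
    rintro x y ⟨⟨r, hr, rfl⟩, rfl⟩
    rw [hf r hr, map_zero]⟩

@[simp]
theorem Alg.lift_mk (R : Submodule k (⨂[k]^N V)) {B : Type u} [Semiring B] [Algebra k B]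
    (f : TensorAlgebra k V →ₐ[k] B) (hf : ∀ r ∈ R, f (TensorPower.toTensorAlgebra r) = 0)
    (x : TensorAlgebra k V) : Alg.lift R f hf (Alg.mk R x) = f x :=
  RingQuot.liftAlgHom_mkAlgHom_apply ..

theorem Alg.hom_ext {R : Submodule k (⨂[k]^N V)} {B : Type u} [Semiring B] [Algebra k B]
    {f g : Alg R →ₐ[k] B} (h : ∀ v, f (Alg.ι R v) = g (Alg.ι R v)) : f = g := by
  refine RingQuot.ringQuot_ext' k _ _ ?_
  ext v
  exact h v

theorem Alg.ι_mem_grade (R : Submodule k (⨂[k]^N V)) (v : V) : Alg.ι R v ∈ Alg.grade R 1 := by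
  simp only [Alg.grade, pow_one]
  exact LinearMap.mem_range_self _ v

instance (R : Submodule k (⨂[k]^N V)) : SetLike.GradedMonoid (Alg.grade R) :=
  inferInstanceAs (SetLike.GradedMonoid (LinearMap.range (Alg.ι R) ^ · : ℕ → Submodule k (Alg R)))

/-- The map from `V` to the degree `1` part of the external direct sum of the `A_n`. -/
def Alg.gradeι (R : Submodule k (⨂[k]^N V)) : V →ₗ[k] ⨁ n, Alg.grade R n :=
  DirectSum.lof k ℕ (fun n => Alg.grade R n) 1 ∘ₗ
    (Alg.ι R).codRestrict _ (Alg.ι_mem_grade R)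

theorem Alg.lift_gradeι_of_mem (R : Submodule k (⨂[k]^N V)) (n : ℕ) (x : TensorAlgebra k V)
    (hx : x ∈ LinearMap.range (TensorAlgebra.ι k : V →ₗ[k] TensorAlgebra k V) ^ n) :
    ∃ h : Alg.mk R x ∈ Alg.grade R n, TensorAlgebra.lift k (Alg.gradeι R) x =
      DirectSum.of (fun n => Alg.grade R n) n ⟨Alg.mk R x, h⟩ := by
  induction hx using Submodule.pow_induction_on_left' with
  | algebraMap r =>
    refine ⟨?_, ?_⟩
    · rw [AlgHom.commutes]
      simp only [Alg.grade, pow_zero]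
      exact Submodule.algebraMap_mem r
    · rw [AlgHom.commutes, DirectSum.algebraMap_apply]
      congr 1
      ext
      simp only [AlgHom.commutes]
      rfl
  | add x y i hx hy ihx ihy =>
    obtain ⟨h1, e1⟩ := ihx
    obtain ⟨h2, e2⟩ := ihy
    refine ⟨by rw [map_add]; exact add_mem h1 h2, ?_⟩
    rw [map_add, e1, e2, ← map_add]
    congr 1
    ext
    simp
  | mem_mul m hm i x hx ih =>
    obtain ⟨v, rfl⟩ := hm
    obtain ⟨h, e⟩ := ih
    have key : (GradedMonoid.mk (1 + i) ⟨Alg.ι R v * Alg.mk R x,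
        SetLike.mul_mem_graded (Alg.ι_mem_grade R v) h⟩ : GradedMonoid fun n => Alg.grade R n) =
        GradedMonoid.mk (i + 1) ⟨Alg.ι R v * Alg.mk R x, by
          rw [add_comm i 1]; exact SetLike.mul_mem_graded (Alg.ι_mem_grade R v) h⟩ :=
      Sigma.subtype_ext (add_comm _ _) rfl
    refine ⟨?_, ?_⟩
    · rw [map_mul, Nat.succ_eq_add_one, add_comm i 1]
      exact SetLike.mul_mem_graded (Alg.ι_mem_grade R v) h
    · rw [map_mul, e, TensorAlgebra.lift_ι_apply]
      refine (DirectSum.of_mul_of (A := fun n => Alg.grade R n) _ _).trans ?_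
      refine (DirectSum.of_eq_of_gradedMonoid_eq key).trans ?_
      congr 1
      ext
      simp [Alg.ι]

theorem toTensorAlgebra_mem (n : ℕ) (x : ⨂[k]^n V) : TensorPower.toTensorAlgebra x ∈
    LinearMap.range (TensorAlgebra.ι k : V →ₗ[k] TensorAlgebra k V) ^ n := by
  induction x using PiTensorProduct.induction_on with
  | smul_tprod r v =>
    rw [map_smul, TensorPower.toTensorAlgebra_tprod, TensorAlgebra.tprod_apply]
    refine Submodule.smul_mem _ _ ?_
    induction n with
    | zero => simp
    | succ n ih =>
      rw [List.ofFn_succ, List.prod_cons, pow_succ']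
      exact Submodule.mul_mem_mul ⟨_, rfl⟩ (ih _)
  | add x y hx hy => rw [map_add]; exact add_mem hx hy

/-- The map from `A` to the external direct sum of the `A_n`. -/
def Alg.decomposeAux (R : Submodule k (⨂[k]^N V)) : Alg R →ₐ[k] ⨁ n, Alg.grade R n :=
  Alg.lift R (TensorAlgebra.lift k (Alg.gradeι R)) (by
    intro r hr
    obtain ⟨h, e⟩ := Alg.lift_gradeι_of_mem R N _ (toTensorAlgebra_mem N r)
    rw [e]
    have : (⟨Alg.mk R (TensorPower.toTensorAlgebra r), h⟩ : Alg.grade R N) = 0 :=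
      Subtype.ext (Alg.mk_toTensorAlgebra hr)
    rw [this, map_zero])

theorem Alg.decomposeAux_mk (R : Submodule k (⨂[k]^N V)) (x : TensorAlgebra k V) :
    Alg.decomposeAux R (Alg.mk R x) = TensorAlgebra.lift k (Alg.gradeι R) x :=
  Alg.lift_mk ..

/-- `A = ⨁ A_n` is a graded algebra. -/
instance Alg.gradedAlgebra (R : Submodule k (⨂[k]^N V)) : GradedAlgebra (Alg.grade R) :=
  GradedAlgebra.ofAlgHom _ (Alg.decomposeAux R)
    (by
      refine Alg.hom_ext fun v => ?_
      have : Alg.ι R v = Alg.mk R (TensorAlgebra.ι k v) := rfl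
      rw [AlgHom.comp_apply, this, Alg.decomposeAux_mk, TensorAlgebra.lift_ι_apply]
      exact DirectSum.coeAlgHom_of (Alg.grade R) 1 ⟨Alg.ι R v, Alg.ι_mem_grade R v⟩)
    (by
      rintro i ⟨x, hx⟩
      have : ∃ y ∈ LinearMap.range (TensorAlgebra.ι k : V →ₗ[k] TensorAlgebra k V) ^ i,
          Alg.mk R y = x := by
        have h2 : Alg.grade R i = Submodule.map (Alg.mk R).toLinearMap
            (LinearMap.range (TensorAlgebra.ι k : V →ₗ[k] TensorAlgebra k V) ^ i) := by
          rw [Submodule.map_pow, ← LinearMap.range_comp]; rfl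
        rw [h2] at hx
        exact hx
      obtain ⟨y, hy, rfl⟩ := this
      obtain ⟨h, e⟩ := Alg.lift_gradeι_of_mem R i y hy
      rw [Alg.decomposeAux_mk, e])

/-- The augmentation `ε : A → k`, the algebra morphism which vanishes on `V`. -/
def Alg.aug (R : Submodule k (⨂[k]^N V)) [hN : Fact (2 ≤ N)] : Alg R →ₐ[k] k :=
  Alg.lift R TensorAlgebra.algebraMapInv (by
    intro r _
    have h0 : ∀ x ∈ LinearMap.range (TensorAlgebra.ι k : V →ₗ[k] TensorAlgebra k V) ^ N,
        (TensorAlgebra.algebraMapInv x : k) = 0 := by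
      obtain ⟨m, rfl⟩ : ∃ m, N = m + 1 := ⟨N - 1, by have := hN.out; omega⟩
      intro x hx
      rw [pow_succ'] at hx
      induction hx using Submodule.mul_induction_on' with
      | mem_mul_mem a ha b hb =>
        obtain ⟨v, rfl⟩ := ha
        simp [TensorAlgebra.algebraMapInv]
      | add x _ y _ hx hy => rw [map_add, hx, hy, add_zero]
    exact h0 _ (toTensorAlgebra_mem N r))

/-- The trivial left `A`-module `k`, on which `A` acts through the augmentation. -/
def TrivialModule (_ : Submodule k (⨂[k]^N V)) : Type u := k

instance (R : Submodule k (⨂[k]^N V)) : AddCommGroup (TrivialModule R) :=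
  inferInstanceAs (AddCommGroup k)

instance (R : Submodule k (⨂[k]^N V)) [Fact (2 ≤ N)] : Module (Alg R) (TrivialModule R) :=
  Module.compHom k (Alg.aug R).toRingHom

/-! ### Graded `Tor` and the Koszul property -/

/-- The jump map `n(2q) = qN`, `n(2q+1) = qN + 1`. -/
def jump (N i : ℕ) : ℕ := (i / 2) * N + i % 2

/-- The elements of degree `m` in the graded free left `A`-module with basis `ι`, the basis
element `b` being of degree `deg b`: the coefficient of each `c : ι` must be
in `A_{m - deg c}` (and `0` if `m < deg c`). -/
def IsHomogeneousOfDegree (R : Submodule k (⨂[k]^N V)) {ι : Type u} (deg : ι → ℕ) (m : ℕ)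
    (x : ι →₀ Alg R) : Prop :=
  ∀ c, (deg c ≤ m → x c ∈ Alg.grade R (m - deg c)) ∧ (m < deg c → x c = 0)

/-- A resolution `⋯ → P₂ → P₁ → P₀ → k → 0` of the trivial left `A`-module `k` by graded free
left `A`-modules, with differentials and augmentation of degree `0`. The module `P i` is free on
the homogeneous basis `ι i`, with degrees given by `deg i`, and `d i : P (i + 1) → P i`. -/
structure GradedFreeResolution (R : Submodule k (⨂[k]^N V)) [Fact (2 ≤ N)] where
  ι : ℕ → Type u
  deg : ∀ i, ι i → ℕ
  d : ∀ i, (ι (i + 1) →₀ Alg R) →ₗ[Alg R] (ι i →₀ Alg R)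
  augmentation : (ι 0 →₀ Alg R) →ₗ[Alg R] TrivialModule R
  d_homogeneous : ∀ i b,
    IsHomogeneousOfDegree R (deg i) (deg (i + 1) b) (d i (Finsupp.single b 1))
  augmentation_homogeneous : ∀ b, deg 0 b ≠ 0 → augmentation (Finsupp.single b 1) = 0
  augmentation_surjective : Function.Surjective augmentation
  exact_zero : Function.Exact (d 0) augmentation
  exact_succ : ∀ i, Function.Exact (d (i + 1)) (d i)

namespace GradedFreeResolution

variable {R : Submodule k (⨂[k]^N V)} [Fact (2 ≤ N)] (P : GradedFreeResolution R)

/-- The differential of the complex `k ⊗_A P`. Here `k ⊗_A P i` is the `k`-vector space with basis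
`ι i`, and the matrix of the differential is obtained from that of `P` by applying the
augmentation to its entries. -/
def torD (i : ℕ) : (P.ι (i + 1) →₀ k) →ₗ[k] (P.ι i →₀ k) :=
  Finsupp.linearCombination k fun b =>
    Finsupp.mapRange (Alg.aug R) (map_zero _) (P.d i (Finsupp.single b 1))

/-- The cycles of `k ⊗_A P` in homological degree `i`. -/
def cycles : (i : ℕ) → Submodule k (P.ι i →₀ k)
  | 0 => ⊤
  | i + 1 => LinearMap.ker (P.torD i)

/-- The homogeneous component of `k ⊗_A P i` of internal degree `m`. -/
def component (i m : ℕ) : Submodule k (P.ι i →₀ k) :=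
  Finsupp.supported k k {b | P.deg i b = m}

/-- The component of degree `m` of the graded vector space `Tor_i^A(k, k) = H_i(k ⊗_A P)`: the
image of the cycles of degree `m` in the quotient by the boundaries. -/
def tor (i m : ℕ) : Submodule k ((P.ι i →₀ k) ⧸ LinearMap.range (P.torD i)) :=
  (P.cycles i ⊓ P.component i m).map (LinearMap.range (P.torD i)).mkQ

end GradedFreeResolution

/-- The generalized Koszul property: for each `i ≥ 3`, the graded vector space `Tor_i^A(k, k)` is
concentrated in degree `n(i)`. -/
def IsKoszul (R : Submodule k (⨂[k]^N V)) [Fact (2 ≤ N)] : Prop :=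
  ∀ P : GradedFreeResolution R, ∀ i, 3 ≤ i → ∀ m, m ≠ jump N i → P.tor i m = ⊥

/-! ### Global dimension, `Ext` and the AS-Gorenstein property -/

/-- The (left) global dimension of a ring: the supremum of the projective dimensions of its
left modules. -/
def globalDimension (A : Type u) [Ring A] : WithBot ℕ∞ :=
  ⨆ M : ModuleCat.{u} A, CategoryTheory.projectiveDimension M

/-- `Ext_A^i(k, A)`, computed in the category of left `A`-modules. -/
abbrev ExtkA (R : Submodule k (⨂[k]^N V)) [Fact (2 ≤ N)] (i : ℕ) : Type u :=
  CategoryTheory.Abelian.Ext (ModuleCat.of (Alg R) (TrivialModule R))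
    (ModuleCat.of (Alg R) (Alg R)) i

/-- `A` is AS-Gorenstein: it has finite global dimension `D`, `Ext_A^i(k, A) = 0` for `i ≠ D`,
and `Ext_A^D(k, A) = k`. -/
def IsASGorenstein (R : Submodule k (⨂[k]^N V)) [Fact (2 ≤ N)] : Prop :=
  ∃ D : ℕ, globalDimension (Alg R) = D ∧ (∀ i, i ≠ D → Subsingleton (ExtkA R i)) ∧
    Nonempty (ExtkA R D ≃ₗ[k] k)

/-! ### The dual algebra and the maps `f ↦ f · u*` -/

/-- The space `R^⊥ ⊆ (V*)^{⊗N}` of the tensors which vanish on `R`, for the pairing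
`⟨α₁ ⊗ ⋯ ⊗ α_N, v₁ ⊗ ⋯ ⊗ v_N⟩ = α₁(v₁) ⋯ α_N(v_N)`. -/
def perp (R : Submodule k (⨂[k]^N V)) : Submodule k (⨂[k]^N (Module.Dual k V)) :=
  R.dualAnnihilator.comap (TensorPower.pairingDual k V N)

/-- The dual algebra `A^!`, the `N`-homogeneous algebra on `V*` with space of relations `R^⊥`. -/
abbrev DualAlg (R : Submodule k (⨂[k]^N V)) : Type u := Alg (perp R)

/-- The component `A^!_n`. -/
abbrev dualGrade (R : Submodule k (⨂[k]^N V)) (n : ℕ) : Submodule k (DualAlg R) :=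
  Alg.grade (perp R) n

/-- The linear form `u*` on `M` with `u*(u) = 1`, for a vector `u ≠ 0`. When `u` generates `M`,
it is the basis of the dual of `M` which is dual to `u`. -/
def dualVector {M : Type u} [AddCommGroup M] [Module k M] (u : M) : Module.Dual k M :=
  (LinearMap.toSpanSingleton k M u).leftInverse

theorem dualVector_self {M : Type u} [AddCommGroup M] [Module k M] {u : M} (hu : u ≠ 0) :
    dualVector (k := k) u u = 1 := by
  have h := LinearMap.leftInverse_apply_of_inj
    (f := LinearMap.toSpanSingleton k M u) (LinearMap.ker_toSpanSingleton (R := k) (M := M) hu) 1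
  simpa [dualVector] using h

/-- A linear form on `A^!_n`, seen as an element of the graded dual of `A^!`, i.e. extended by `0`
on the other homogeneous components. -/
def extendByZero (R : Submodule k (⨂[k]^N V)) (n : ℕ) (α : Module.Dual k (dualGrade R n)) :
    Module.Dual k (DualAlg R) :=
  α ∘ₗ (DirectSum.component k ℕ (fun m => dualGrade R m) n) ∘ₗ
    (DirectSum.decomposeLinearEquiv (dualGrade R)).toLinearMap

/-- For `f : A^!` and a linear form `α` on `A^!`, the linear form `f · α` defined by
`⟨f · α, h⟩ = ⟨α, h f⟩`, as a linear map in `f`. -/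
def leftAction (R : Submodule k (⨂[k]^N V)) (α : Module.Dual k (DualAlg R)) :
    DualAlg R →ₗ[k] Module.Dual k (DualAlg R) :=
  ((LinearMap.mul k (DualAlg R)).compr₂ α).flip

/-- The linear map `A^!_p → (A^!_q)*`, `f ↦ f · u*`, for `u` in `A^!_n`. -/
def Phi (R : Submodule k (⨂[k]^N V)) {n : ℕ} (u : dualGrade R n) (p q : ℕ) :
    dualGrade R p →ₗ[k] Module.Dual k (dualGrade R q) :=
  (LinearMap.lcomp k k (dualGrade R q).subtype) ∘ₗ
    leftAction R (extendByZero R n (dualVector u)) ∘ₗ (dualGrade R p).subtype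

end NHomogeneous

end

noncomputable section

namespace NHomogeneous

/-! ### Sums over words -/

/-! Fix a basis of `V`, and write `a_w`, `s_w` for the products of the generators of `A` and of
`A^!` along a word `w`. The Koszul complex has terms `K_i = A ⊗ (A^!_{n(i)})*`, realised as the
linear maps `A^! → A` supported in degree `n(i)`. Its differential sends `φ` to `f ↦ ∑ φ(s_w f)
a_w`, where `w` has length `n(i+1) - n(i)`. Two consecutive steps add up to `N`, and the composite
vanishes because `∑ s_w ⊗ a_w = 0` in degree `N` (`sum_bilin_eq_zero`).

Koszulity makes `K` a minimal free resolution of `k` (`IsKoszul.koszulExact`). By Nakayama, the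
`Tor` condition says that the cycles in `K_{i+1}` are generated in degree `n(i+2)`. In that degree a
cycle is a multilinear function which satisfies the relations of `A^!` in every position, so it is
the differential of a linear form on `A^!_{n(i+2)}` (`exists_scal_of_koszulD_eq_zero`). For the
intermediate positions this needs the extra condition on `R`, which itself follows from exactness at
`K_2` (`extraCondition_of_exact`). Hence `Ext_A(k, A)` is the cohomology of `Hom_A(K, A)`, and
finite global dimension forces `A^!_{n(D+1)} = 0`.

If the pairings `(f, h) ↦ u*(hf)` are perfect, they identify `Hom_A(K_i, A)` with the term of index
`D - i` of the right Koszul complex, whose differential is `x ↦ (f ↦ ∑ a_w x(f s_w))`. That complex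
is exact in positive homological degrees because the left one is (`exists_rightD_of_cycle`, a double
complex argument), so `Ext^i` vanishes for `i < D` (`isCoboundary_of_perfectAt`).

Conversely, perfectness is proved by induction on `i` (`perfectAt_of_isCoboundary`). If `f` pairs to
zero with everything, evaluation at `f` is a cocycle, hence a coboundary, hence zero modulo the
augmentation ideal by minimality; so `f = 0`. For surjectivity, a linear form on the next component
is turned into a cocycle, and the constant part of a cochain that it bounds is the required element.
In the top degree the one-dimensionality of `Ext^D` replaces vanishing. Both directions also need
`n(i) + n(D-i) = n(D)`, that is `D` odd or `N = 2` when `D > 0`; this is deduced from either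
hypothesis. -/

/-- The words of length `n` in the alphabet `X`. -/
def words (X : Type*) [Fintype X] (n : ℕ) : Finset (List X) :=
  (List.finite_length_eq X n).toFinset

section words

variable {X : Type*} [Fintype X] {M : Type*} [AddCommMonoid M]

@[simp]
theorem mem_words {n : ℕ} {w : List X} : w ∈ words X n ↔ w.length = n := by
  simp [words]

theorem sum_words_zero (F : List X → M) : ∑ w ∈ words X 0, F w = F [] := by
  have : words X 0 = {[]} := by ext w; simp
  rw [this, Finset.sum_singleton]

theorem sum_words_append (m n : ℕ) (F : List X → M) :
    ∑ w ∈ words X (m + n), F w = ∑ p ∈ words X m, ∑ q ∈ words X n, F (p ++ q) := by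
  rw [← Finset.sum_product']
  refine Finset.sum_bij' (fun w _ => (w.take m, w.drop m)) (fun p _ => p.1 ++ p.2) ?_ ?_ ?_ ?_ ?_
  · intro w hw
    simp only [mem_words] at hw
    simp [hw]
  · rintro ⟨p, q⟩ h
    simp only [Finset.mem_product, mem_words] at h
    simp [h.1, h.2]
  · intro w _; simp
  · rintro ⟨p, q⟩ h
    simp only [Finset.mem_product, mem_words] at h
    simp [← h.1]
  · intro w _; simp

theorem sum_words_one (F : List X → M) : ∑ w ∈ words X 1, F w = ∑ x, F [x] := by
  symm
  refine Finset.sum_bij (fun x _ => [x]) (by simp) (by simp) ?_ (by simp)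
  intro w hw
  obtain ⟨x, rfl⟩ := List.length_eq_one_iff.1 (mem_words.1 hw)
  exact ⟨x, by simp⟩

theorem sum_words_reverse (n : ℕ) (F : List X → M) :
    ∑ w ∈ words X n, F w.reverse = ∑ w ∈ words X n, F w :=
  Finset.sum_bij' (fun w _ => w.reverse) (fun w _ => w.reverse) (by simp) (by simp) (by simp)
    (by simp) (by simp)

end words

/-- The product of the letters of a word. -/
def wprod {X B : Type*} [Monoid B] (s : X → B) (w : List X) : B := (w.map s).prod

section wprod

variable {X B : Type*} [Monoid B] (s : X → B)

@[simp] theorem wprod_nil : wprod s [] = 1 := rfl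

@[simp] theorem wprod_cons (x : X) (w : List X) : wprod s (x :: w) = s x * wprod s w := by
  simp [wprod]

@[simp] theorem wprod_append (p q : List X) : wprod s (p ++ q) = wprod s p * wprod s q := by
  simp [wprod]

theorem map_wprod {C F : Type*} [Monoid C] [FunLike F B C] [MonoidHomClass F B C] (f : F)
    (w : List X) : f (wprod s w) = wprod (f ∘ s) w := by
  induction w with
  | nil => simp
  | cons x w ih => simp [ih]

theorem op_wprod (w : List X) :
    wprod (MulOpposite.op ∘ s) w = MulOpposite.op (wprod s w.reverse) := by
  induction w with
  | nil => simp
  | cons x w ih => simp [ih]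

end wprod

/-! ### Homogeneous presentations in coordinates -/

/-- The `k`-algebra `A` is presented by the generators `a x` and the relations
`∑ r w • a_w = 0`, for `r ∈ Rel`, where `w` runs through the words of length `N`. -/
structure Presents {k : Type u} [Field k] {X : Type} [Fintype X] (N : ℕ)
    (Rel : Set (List X → k)) {A : Type u} [Ring A] [Algebra k A] (a : X → A) : Prop where
  rel : ∀ r ∈ Rel, ∑ w ∈ words X N, r w • wprod a w = 0
  span : Submodule.span k (Set.range (wprod a)) = ⊤
  lift : ∀ {C : Type u} [Ring C] [Algebra k C] (y : X → C),
    (∀ r ∈ Rel, ∑ w ∈ words X N, r w • wprod y w = 0) → ∃ f : A →ₐ[k] C, ∀ x, f (a x) = y x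

/-- The relations of the dual algebra. -/
def annRel {k : Type u} [Field k] {X : Type} [Fintype X] (N : ℕ) (Rel : Set (List X → k)) :
    Set (List X → k) :=
  {q | ∀ r ∈ Rel, ∑ w ∈ words X N, r w * q w = 0}

/-- The relations of the opposite algebra. -/
def revRel {k : Type u} {X : Type} (Rel : Set (List X → k)) : Set (List X → k) :=
  {q | (fun w => q w.reverse) ∈ Rel}

/-- The span of the words of length `n`. -/
def gr (k : Type u) [Field k] {X : Type} {A : Type u} [Ring A] [Algebra k A] (a : X → A) (n : ℕ) :
    Submodule k A :=
  Submodule.span k (wprod a '' {w | w.length = n})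

section gr

variable {k : Type u} [Field k] {X : Type} {A : Type u} [Ring A] [Algebra k A] {a : X → A}

theorem wprod_mem_gr (w : List X) : wprod a w ∈ gr k a w.length :=
  Submodule.subset_span ⟨w, rfl, rfl⟩

theorem wprod_mem_gr' {w : List X} {n : ℕ} (h : w.length = n) : wprod a w ∈ gr k a n :=
  h ▸ wprod_mem_gr w

theorem mul_mem_gr {m n : ℕ} {y z : A} (hy : y ∈ gr k a m) (hz : z ∈ gr k a n) :
    y * z ∈ gr k a (m + n) := by
  have : gr k a m * gr k a n ≤ gr k a (m + n) := by
    rw [gr, gr, Submodule.span_mul_span, Submodule.span_le]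
    rintro _ ⟨_, ⟨p, hp, rfl⟩, _, ⟨q, hq, rfl⟩, rfl⟩
    simp only [Set.mem_ofPred_eq] at hp hq
    simp only [← wprod_append]
    exact wprod_mem_gr' (by simp [hp, hq])
  exact this (Submodule.mul_mem_mul hy hz)

theorem gr_finite [Finite X] (n : ℕ) : FiniteDimensional k (gr k a n) :=
  FiniteDimensional.span_of_finite k ((List.finite_length_eq X n).image _)

theorem exists_sum_of_mem_gr [Fintype X] {n : ℕ} {y : A} (hy : y ∈ gr k a n) :
    ∃ c : List X → k, y = ∑ w ∈ words X n, c w • wprod a w := by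
  classical
  induction hy using Submodule.span_induction with
  | mem y hy =>
    obtain ⟨w, hw, rfl⟩ := hy
    refine ⟨fun v => if v = w then 1 else 0, ?_⟩
    simp only [Set.mem_ofPred_eq] at hw
    simp [ite_smul, hw]
  | zero => exact ⟨0, by simp⟩
  | add y z _ _ hy hz =>
    obtain ⟨c, rfl⟩ := hy
    obtain ⟨c', rfl⟩ := hz
    exact ⟨c + c', by simp [add_smul, Finset.sum_add_distrib]⟩
  | smul t y _ hy =>
    obtain ⟨c, rfl⟩ := hy
    exact ⟨t • c, by simp [mul_smul, Finset.smul_sum]⟩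

end gr

/-! ### Opposite algebra, linear forms and grading of a presented algebra -/

namespace Presents

variable {k : Type u} [Field k] {X : Type} [Fintype X] {N : ℕ} {Rel : Set (List X → k)}
  {A : Type u} [Ring A] [Algebra k A] {a : X → A}

theorem ext (h : Presents N Rel a) {M : Type*} [AddCommGroup M] [Module k M] {φ ψ : A →ₗ[k] M}
    (e : ∀ w, φ (wprod a w) = ψ (wprod a w)) : φ = ψ := by
  refine LinearMap.ext_on_range h.span e

/-- The opposite algebra is presented by the reversed relations. -/
theorem op (h : Presents N Rel a) : Presents N (revRel Rel) (MulOpposite.op ∘ a) where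
  rel r hr := by
    have := congrArg MulOpposite.op (h.rel _ hr)
    rw [← sum_words_reverse]
    simpa [op_wprod, Finset.op_sum] using this
  span := by
    have h1 : Set.range (wprod (MulOpposite.op ∘ a)) =
        (MulOpposite.opLinearEquiv k : A ≃ₗ[k] Aᵐᵒᵖ) '' Set.range (wprod a) := by
      ext y
      constructor
      · rintro ⟨w, rfl⟩
        exact ⟨_, ⟨w.reverse, rfl⟩, by simp [op_wprod]⟩
      · rintro ⟨_, ⟨w, rfl⟩, rfl⟩
        exact ⟨w.reverse, by simp [op_wprod]⟩
    have h2 := Submodule.span_image (MulOpposite.opLinearEquiv k : A ≃ₗ[k] Aᵐᵒᵖ).toLinearMap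
      (s := Set.range (wprod a)) (R := k)
    rw [h1]
    refine h2.trans ?_
    rw [h.span, Submodule.map_top, LinearEquiv.range]
  lift {C} _ _ y hy := by
    obtain ⟨f, hf⟩ := h.lift (C := Cᵐᵒᵖ) (fun x => MulOpposite.op (y x)) (by
      intro r hr
      have := hy (fun w => r w.reverse) (by simpa [revRel] using hr)
      have := congrArg MulOpposite.op this
      rw [← sum_words_reverse]
      simp only [Finset.op_sum, MulOpposite.op_smul, MulOpposite.op_zero] at this
      rw [← this]
      refine Finset.sum_congr rfl fun w _ => ?_
      congr 1
      exact (op_wprod y w.reverse).trans (by simp))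
    exact ⟨AlgHom.opComm f, fun x => by simp [hf]⟩

/-- A function on words which satisfies the relations defines a linear form. -/
theorem exists_functional (h : Presents N Rel a) (g : List X → k)
    (hg : ∀ r ∈ Rel, ∀ u v, ∑ w ∈ words X N, r w * g (u ++ w ++ v) = 0) :
    ∃ ψ : A →ₗ[k] k, ∀ w, ψ (wprod a w) = g w := by
  -- The functions which satisfy the relations at every position form an `A`-module under the
  -- translations `g ↦ g(· x)`; evaluating the translates of `g` at the empty word gives the linear
  -- form.
  let F : Submodule k (List X → k) :=
    { carrier := {g | ∀ r ∈ Rel, ∀ u v, ∑ w ∈ words X N, r w * g (u ++ w ++ v) = 0}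
      zero_mem' := by simp
      add_mem' := by
        intro g g' hg hg' r hr u v
        simp only [Pi.add_apply, mul_add, Finset.sum_add_distrib]
        rw [hg r hr, hg' r hr, add_zero]
      smul_mem' := by
        intro c g hg r hr u v
        simp only [Pi.smul_apply, smul_eq_mul, mul_left_comm _ c, ← Finset.mul_sum]
        rw [hg r hr, mul_zero] }
  let y : X → Module.End k F := fun x =>
    { toFun := fun g => ⟨fun w => g.1 (w ++ [x]), fun r hr u v => by
        have := g.2 r hr u (v ++ [x])
        simpa only [List.append_assoc] using this⟩
      map_add' := fun _ _ => rfl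
      map_smul' := fun _ _ => rfl }
  have hy : ∀ w (g : F) p, (wprod y w g).1 p = g.1 (p ++ w) := by
    intro w
    induction w with
    | nil => simp
    | cons x w ih =>
      intro g p
      have : (wprod y (x :: w) g).1 p = (wprod y w g).1 (p ++ [x]) := by
        rw [wprod_cons]; rfl
      rw [this, ih, List.append_assoc]; rfl
  obtain ⟨f, hf⟩ := h.lift y (by
    intro r hr
    ext g p
    have := g.2 r hr p []
    simp only [List.append_nil] at this
    simp [LinearMap.sum_apply, hy, this])
  have hf' : ∀ w, f (wprod a w) = wprod y w := fun w => by
    rw [map_wprod]; congr 1; ext1 x; exact hf x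
  let ev : Module.End k F →ₗ[k] k :=
    { toFun := fun e => (e ⟨g, hg⟩).1 []
      map_add' := fun _ _ => rfl
      map_smul' := fun _ _ => rfl }
  refine ⟨ev ∘ₗ f.toLinearMap, fun w => ?_⟩
  change (f (wprod a w) ⟨g, hg⟩).1 [] = g w
  rw [hf', hy]; rfl

/-- The projections onto the homogeneous components. -/
theorem exists_proj (h : Presents N Rel a) :
    ∃ P : ℕ → A →ₗ[k] A, ∀ n w, P n (wprod a w) = if w.length = n then wprod a w else 0 := by
  -- The grading is read off from the algebra map `A → A[t]` which sends each generator `a` to `a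
  -- t`.
  let y : X → Polynomial A := fun x => Polynomial.monomial 1 (a x)
  have hy : ∀ w, wprod y w = Polynomial.monomial w.length (wprod a w) := by
    intro w
    induction w with
    | nil => simp [Polynomial.monomial_zero_left]
    | cons x w ih => simp [ih, y, Polynomial.monomial_mul_monomial, add_comm]
  obtain ⟨f, hf⟩ := h.lift y (by
    intro r hr
    have h1 : ∑ w ∈ words X N, r w • wprod y w =
        Polynomial.monomial N (∑ w ∈ words X N, r w • wprod a w) := by
      rw [map_sum]
      refine Finset.sum_congr rfl fun w hw => ?_
      rw [hy, mem_words.1 hw, Polynomial.smul_monomial]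
    rw [h1, h.rel r hr, map_zero])
  refine ⟨fun n => (Polynomial.lcoeff A n).restrictScalars k ∘ₗ f.toLinearMap, fun n w => ?_⟩
  have : f (wprod a w) = Polynomial.monomial w.length (wprod a w) := by
    rw [← hy, map_wprod]; congr 1; ext1 x; exact hf x
  simp [this, Polynomial.coeff_monomial]

end Presents

/-! ### Coefficients of short words, and duality between relations and linear forms -/

section functionals

variable {k : Type u} [Field k] {X : Type} [Fintype X] {N : ℕ} {Rel : Set (List X → k)}
  {A : Type u} [Ring A] [Algebra k A] {a : X → A}

open Classical in
/-- The words of length smaller than `N` are linearly independent. -/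
theorem Presents.exists_coord (h : Presents N Rel a) {p : List X} (hp : p.length < N) :
    ∃ ψ : A →ₗ[k] k, ∀ w, ψ (wprod a w) = if w = p then 1 else 0 := by
  refine h.exists_functional _ fun r _ u v => Finset.sum_eq_zero fun w hw => ?_
  rw [if_neg, mul_zero]
  rintro rfl
  simp [mem_words.1 hw] at hp
  omega

open Classical in
/-- The coefficient of a short word `p`. -/
def Presents.coord (h : Presents N Rel a) (p : List X) : A →ₗ[k] k :=
  if hp : p.length < N then (h.exists_coord hp).choose else 0

open Classical in
theorem Presents.coord_wprod (h : Presents N Rel a) {p : List X} (hp : p.length < N)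
    (w : List X) : h.coord p (wprod a w) = if w = p then 1 else 0 := by
  rw [Presents.coord, dif_pos hp]
  exact (h.exists_coord hp).choose_spec w

theorem Presents.sum_coord (h : Presents N Rel a) {e : ℕ} (he : e < N) {y : A}
    (hy : y ∈ gr k a e) : ∑ p ∈ words X e, h.coord p y • wprod a p = y := by
  obtain ⟨c, rfl⟩ := exists_sum_of_mem_gr hy
  refine Finset.sum_congr rfl fun p hp => ?_
  rw [map_sum, Finset.sum_eq_single p]
  · rw [map_smul, h.coord_wprod (by rw [mem_words.1 hp]; exact he)]; simp
  · intro q _ hq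
    rw [map_smul, h.coord_wprod (by rw [mem_words.1 hp]; exact he), if_neg hq, smul_zero]
  · exact fun h => absurd hp h

theorem Presents.coord_sum (h : Presents N Rel a) {e : ℕ} (he : e < N) (c : List X → k)
    {p : List X} (hp : p.length = e) :
    h.coord p (∑ w ∈ words X e, c w • wprod a w) = c p := by
  rw [map_sum, Finset.sum_eq_single p]
  · rw [map_smul, h.coord_wprod (by omega)]; simp
  · intro q _ hq
    rw [map_smul, h.coord_wprod (by omega), if_neg hq, smul_zero]
  · intro h; simp [hp] at h

/-- Linear forms in degree `N` are given by relations of the dual algebra. -/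
theorem Presents.exists_functional_of_annRel (h : Presents N Rel a) {q : List X → k}
    (hq : q ∈ annRel N Rel) :
    ∃ ψ : A →ₗ[k] k, ∀ w, ψ (wprod a w) = if w.length = N then q w else 0 := by
  refine h.exists_functional _ fun r hr u v => ?_
  by_cases huv : u = [] ∧ v = []
  · obtain ⟨rfl, rfl⟩ := huv
    rw [← hq r hr]
    refine Finset.sum_congr rfl fun w hw => ?_
    simp [mem_words.1 hw]
  · refine Finset.sum_eq_zero fun w hw => ?_
    rw [if_neg, mul_zero]
    simp only [List.length_append, mem_words.1 hw]
    intro h0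
    exact huv ⟨List.length_eq_zero_iff.1 (by omega), List.length_eq_zero_iff.1 (by omega)⟩

/-- Converse of `Presents.exists_functional_of_annRel`: together they identify the dual of `A_N`
with the relations of the dual algebra, without any choice of complement. -/
theorem Presents.functional_mem_annRel (h : Presents N Rel a) (ψ : A →ₗ[k] k) :
    (fun w => ψ (wprod a w)) ∈ annRel N Rel := by
  intro r hr
  have := congrArg ψ (h.rel r hr)
  simpa using this

theorem mem_annRel_annRel {r : List X → k} (hr : r ∈ Rel) : r ∈ annRel N (annRel N Rel) := by
  intro q hq
  rw [← hq r hr]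
  exact Finset.sum_congr rfl fun _ _ => mul_comm _ _

variable {B : Type u} [Ring B] [Algebra k B] {s : X → B}

/-- The canonical element `∑ s_w ⊗ a_w` of degree `N` vanishes. -/
theorem sum_bilin_eq_zero (hA : Presents N Rel a) (hB : Presents N (annRel N Rel) s)
    {M : Type*} [AddCommGroup M] [Module k M] (β : B →ₗ[k] A →ₗ[k] M) :
    ∑ w ∈ words X N, β (wprod s w) (wprod a w) = 0 := by
  classical
  -- Along a basis vector of `A` with coordinate form `λ`, the component is `∑ λ(a_w) s_w`, which is
  -- one of the defining relations of `B`.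
  have key : ∑ w ∈ words X N, wprod s w ⊗ₜ[k] wprod a w = 0 := by
    let e := Module.Basis.ofVectorSpace k A
    apply (TensorProduct.equivFinsuppOfBasisRight (M := B) e).injective
    ext i
    rw [map_zero, map_sum, Finsupp.finsetSum_apply]
    simp only [TensorProduct.equivFinsuppOfBasisRight_apply_tmul_apply]
    exact hB.rel _ (hA.functional_mem_annRel (e.coord i))
  have := congrArg (TensorProduct.lift β) key
  simpa using this

end functionals

/-! ### The differentials of the Koszul complexes -/

section differentials

variable {k : Type u} [Field k] {X : Type} [Fintype X] {N : ℕ} {Rel : Set (List X → k)}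
  {A : Type u} [Ring A] [Algebra k A] (a : X → A)
  {B : Type u} [Ring B] [Algebra k B] (s : X → B)

/-- The `n`-th power of the differential of the left Koszul `N`-complex. -/
def koszulD (n : ℕ) : (B →ₗ[k] A) →ₗ[A] (B →ₗ[k] A) where
  toFun φ := ∑ w ∈ words X n, LinearMap.mulRight k (wprod a w) ∘ₗ φ ∘ₗ
    LinearMap.mulLeft k (wprod s w)
  map_add' φ ψ := by
    ext f
    simp [LinearMap.sum_apply, add_mul, Finset.sum_add_distrib]
  map_smul' c φ := by
    ext f
    simp [LinearMap.sum_apply, mul_assoc, Finset.mul_sum]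

theorem koszulD_apply (n : ℕ) (φ : B →ₗ[k] A) (f : B) :
    koszulD a s n φ f = ∑ w ∈ words X n, φ (wprod s w * f) * wprod a w := by
  simp [koszulD, LinearMap.sum_apply]

/-- The `n`-th power of the differential of the right Koszul `N`-complex, with coefficients in a
left module. -/
def rightD {M : Type u} [AddCommGroup M] [Module k M] [Module A M] [IsScalarTower k A M] (n : ℕ) :
    (B →ₗ[k] M) →ₗ[k] (B →ₗ[k] M) where
  toFun x := ∑ w ∈ words X n, Algebra.lsmul k k M (wprod a w) ∘ₗ x ∘ₗ
    LinearMap.mulRight k (wprod s w)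
  map_add' x y := by
    ext f
    simp [LinearMap.sum_apply, Finset.sum_add_distrib]
  map_smul' c x := by
    ext f
    simp only [LinearMap.sum_apply, LinearMap.comp_apply, LinearMap.smul_apply, map_smul,
      Finset.smul_sum, RingHom.id_apply]

theorem rightD_apply {M : Type u} [AddCommGroup M] [Module k M] [Module A M]
    [IsScalarTower k A M] (n : ℕ) (x : B →ₗ[k] M) (f : B) :
    rightD a s n x f = ∑ w ∈ words X n, wprod a w • x (f * wprod s w) := by
  simp [rightD, LinearMap.sum_apply]

/-- The inner operator contributes the first letters: the terms are `φ(s_q s_p f) a_q a_p`, so the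
words concatenate in the same order in `B` and in `A`. -/
theorem koszulD_koszulD (m n : ℕ) (φ : B →ₗ[k] A) :
    koszulD a s m (koszulD a s n φ) = koszulD a s (n + m) φ := by
  ext f
  simp only [koszulD_apply]
  rw [sum_words_append, Finset.sum_comm]
  refine Finset.sum_congr rfl fun p _ => ?_
  rw [Finset.sum_mul]
  refine Finset.sum_congr rfl fun q _ => ?_
  simp [mul_assoc]

theorem rightD_rightD {M : Type u} [AddCommGroup M] [Module k M] [Module A M]
    [IsScalarTower k A M] (m n : ℕ) (x : B →ₗ[k] M) :
    rightD a s m (rightD a s n x) = rightD a s (m + n) x := by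
  ext f
  simp only [rightD_apply]
  rw [sum_words_append]
  refine Finset.sum_congr rfl fun p _ => ?_
  rw [Finset.smul_sum]
  refine Finset.sum_congr rfl fun q _ => ?_
  simp [mul_assoc, mul_smul]

variable {a s}

theorem koszulD_eq_zero (hA : Presents N Rel a) (hB : Presents N (annRel N Rel) s)
    (φ : B →ₗ[k] A) : koszulD a s N φ = 0 := by
  ext f
  rw [koszulD_apply]
  exact sum_bilin_eq_zero hA hB ((LinearMap.mul k A) ∘ₗ φ ∘ₗ LinearMap.mulRight k f)

theorem rightD_eq_zero (hA : Presents N Rel a) (hB : Presents N (annRel N Rel) s)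
    {M : Type u} [AddCommGroup M] [Module k M] [Module A M] [IsScalarTower k A M]
    (x : B →ₗ[k] M) : rightD a s N x = 0 := by
  ext f
  rw [rightD_apply]
  exact sum_bilin_eq_zero hA hB
    ((Algebra.lsmul k k M).toLinearMap.flip ∘ₗ x ∘ₗ LinearMap.mulLeft k f)

/-- A linear form, as a map with values in `A`. -/
def scal (A : Type u) [Ring A] [Algebra k A] (χ : B →ₗ[k] k) : B →ₗ[k] A :=
  Algebra.linearMap k A ∘ₗ χ

@[simp] theorem scal_apply (χ : B →ₗ[k] k) (f : B) : scal A χ f = algebraMap k A (χ f) := rfl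

theorem koszulD_scal_apply (n : ℕ) (χ : B →ₗ[k] k) (f : B) :
    koszulD a s n (scal A χ) f = ∑ w ∈ words X n, χ (wprod s w * f) • wprod a w := by
  simp [koszulD_apply, Algebra.smul_def]

/-- A linear form of positive degree is determined by its differential. -/
theorem eq_zero_of_koszulD_scal (hA : Presents N Rel a) (hB : Presents N (annRel N Rel) s)
    {c : ℕ} (hc : c < N) {χ : B →ₗ[k] k} (h0 : ∀ w : List X, w.length < c → χ (wprod s w) = 0)
    (hD : koszulD a s c (scal A χ) = 0) : χ = 0 := by
  refine hB.ext fun w => ?_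
  by_cases hw : w.length < c
  · exact h0 w hw
  -- Evaluated at the tail of `w`, the differential has the value of `χ` at `w` as the coefficient
  -- of the head of `w`; since `c < N`, that coefficient is well defined.
  have := LinearMap.congr_fun hD (wprod s (w.drop c))
  rw [koszulD_scal_apply] at this
  have h2 := congrArg (hA.coord (w.take c)) this
  rw [hA.coord_sum hc (fun p => χ (wprod s p * wprod s (w.drop c)))
    (by simp; omega), ← wprod_append, List.take_append_drop] at h2
  simpa using h2

/-- The elements of the Koszul complex supported in degree `n`. -/
def supp (k : Type u) [Field k] [Algebra k A] [Algebra k B] (s : X → B) (n : ℕ) :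
    Submodule A (B →ₗ[k] A) where
  carrier := {φ | ∀ w : List X, w.length ≠ n → φ (wprod s w) = 0}
  zero_mem' := by simp
  add_mem' := by
    intro φ ψ hφ hψ w hw
    simp [hφ w hw, hψ w hw]
  smul_mem' := by
    intro c φ hφ w hw
    simp [hφ w hw]

theorem koszulD_mem_supp {m n : ℕ} {φ : B →ₗ[k] A} (h : φ ∈ supp (A := A) k s (n + m)) :
    koszulD a s n φ ∈ supp (A := A) k s m := by
  intro w hw
  rw [koszulD_apply]
  refine Finset.sum_eq_zero fun p hp => ?_
  rw [← wprod_append, h _ (by simp [mem_words.1 hp, hw]), zero_mul]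

/-- Exactness of the Koszul complex in degree `0`. -/
theorem exists_koszulD_one (hN : 2 ≤ N) (hB : Presents N (annRel N Rel) s) {φ : B →ₗ[k] A}
    (hφ : φ ∈ supp (A := A) k s 0)
    (h1 : φ 1 ∈ Submodule.span k (wprod a '' {w : List X | w ≠ []})) :
    ∃ ψ ∈ supp (A := A) k s 1, koszulD a s 1 ψ = φ := by
  classical
  have key : ∀ y ∈ Submodule.span k (wprod a '' {w : List X | w ≠ []}),
      ∃ ψ ∈ supp (A := A) k s 1, koszulD a s 1 ψ 1 = y := by
    intro y hy
    induction hy using Submodule.span_induction with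
    | mem y hy =>
      obtain ⟨w, hw, rfl⟩ := hy
      -- The last letter is split off because the differential multiplies the values on the right:
      -- `a_p a_x` is the image of `a_p` times the coordinate form of `x`.
      obtain ⟨p, x, rfl⟩ := List.eq_nil_or_concat' w |>.resolve_left hw
      refine ⟨(hB.coord [x]).smulRight (wprod a p), ?_, ?_⟩
      · intro v hv
        rw [LinearMap.smulRight_apply, hB.coord_wprod (by simp; omega), if_neg, zero_smul]
        rintro rfl
        simp at hv
      · rw [koszulD_apply, Finset.sum_eq_single [x]]
        · rw [mul_one, LinearMap.smulRight_apply, hB.coord_wprod (by simp; omega)]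
          simp
        · intro v _ hv
          rw [mul_one, LinearMap.smulRight_apply, hB.coord_wprod (by simp; omega), if_neg hv]
          simp
        · intro h; simp at h
    | zero => exact ⟨0, zero_mem _, by simp⟩
    | add y z _ _ hy hz =>
      obtain ⟨ψ, h, rfl⟩ := hy
      obtain ⟨ψ', h', rfl⟩ := hz
      exact ⟨ψ + ψ', add_mem h h', by simp⟩
    | smul t y _ hy =>
      obtain ⟨ψ, h, rfl⟩ := hy
      refine ⟨algebraMap k A t • ψ, Submodule.smul_mem _ _ h, ?_⟩
      rw [map_smul, LinearMap.smul_apply, smul_eq_mul, Algebra.smul_def]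
  obtain ⟨ψ, h, e⟩ := key _ h1
  refine ⟨ψ, h, hB.ext fun w => ?_⟩
  by_cases hw : w.length = 0
  · rw [List.length_eq_zero_iff.1 hw]; exact e
  · rw [hφ w hw, koszulD_mem_supp (m := 0) h w hw]

/-- Exactness of the Koszul complex in degree `1`. -/
theorem exists_koszulD_pred (hN : 2 ≤ N) (hA : Presents N Rel a)
    (hB : Presents N (annRel N Rel) s) {φ : B →ₗ[k] A} (hφ : φ ∈ supp (A := A) k s 1)
    (hD : koszulD a s 1 φ = 0) : ∃ ψ ∈ supp (A := A) k s N, koszulD a s (N - 1) ψ = φ := by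
  classical
  let S : Submodule A (B →ₗ[k] A) := (supp (A := A) k s N).map (koszulD a s (N - 1))
  suffices φ ∈ S by simpa [S] using this
  let E : X → (B →ₗ[k] A) := fun x => scal A (hB.coord [x])
  -- A Fox derivative argument. The generators act on `C × k` by `(c, l) ↦ (a_x c + l [E x], 0)`.
  -- Once this is an action of `A`, applying `∑ φ(s_x) a_x = 0` to `(0, 1)` gives `∑ φ(s_x) [E x] =
  -- 0`, which says that `φ` lies in `S`.
  let C := (B →ₗ[k] A) ⧸ S
  let y : X → Module.End k (C × k) := fun x =>
    (Algebra.lsmul k k C (a x) ∘ₗ LinearMap.fst k C k +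
      (LinearMap.toSpanSingleton k C (S.mkQ (E x))) ∘ₗ LinearMap.snd k C k).prod 0
  have hy0 : ∀ x c l, y x (c, l) = (a x • c + l • S.mkQ (E x), 0) := fun x c l => by
    simp [y]
  have hy : ∀ w x c l, wprod y (w ++ [x]) (c, l) =
      (wprod a (w ++ [x]) • c + l • S.mkQ (wprod a w • E x), 0) := by
    intro w x c l
    induction w with
    | nil => simp [hy0]
    | cons z w ih =>
      rw [List.cons_append, wprod_cons, Module.End.mul_apply, ih, hy0, smul_add, ← mul_smul,
        zero_smul, add_zero, wprod_cons, wprod_cons, smul_comm,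
          mul_smul (a z) (wprod a w) (E x), map_smul S.mkQ (a z)]
  have hy1 : ∀ w c, wprod y w (c, 0) = (wprod a w • c, 0) := by
    intro w c
    rcases List.eq_nil_or_concat' w with rfl | ⟨p, x, rfl⟩
    · simp
    · rw [hy]; simp
  have hrel : ∀ r ∈ Rel, ∑ w ∈ words X N, r w • wprod y w = 0 := by
    intro r hr
    obtain ⟨M, rfl⟩ : ∃ M, N = M + 1 := ⟨N - 1, by omega⟩
    obtain ⟨χ, hχ⟩ := hB.exists_functional_of_annRel (mem_annRel_annRel (N := M + 1) hr)
    -- The derivative of a relation `r` is a boundary: `r` annihilates the dual relations, so it is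
    -- a linear form `χ` on the component of degree `N` of `B`, and its differential is this sum.
    have hmem : ∑ w ∈ words X M, ∑ x, r (w ++ [x]) • wprod a w • E x ∈ S := by
      refine ⟨scal A χ, ?_, ?_⟩
      · intro w hw
        simp [hχ, hw]
      · refine hB.ext fun w => ?_
        rw [koszulD_scal_apply, LinearMap.sum_apply]
        refine Finset.sum_congr rfl fun p hp => ?_
        rw [mem_words] at hp
        rw [← wprod_append, hχ]
        simp only [LinearMap.sum_apply, LinearMap.smul_apply, E, scal_apply]
        by_cases hw : w.length = 1
        · obtain ⟨z, rfl⟩ := List.length_eq_one_iff.1 hw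
          rw [Finset.sum_eq_single z]
          · rw [hB.coord_wprod (by simp; omega)]; simp [hp]
          · intro x _ hx
            rw [hB.coord_wprod (by simp; omega), if_neg (by simpa using hx.symm)]; simp
          · simp
        · rw [if_neg (by simp; omega), zero_smul]
          symm
          refine Finset.sum_eq_zero fun x _ => ?_
          rw [hB.coord_wprod (by simp; omega), if_neg]
          · simp
          · rintro rfl; simp at hw
    refine LinearMap.ext fun ⟨c, l⟩ => ?_
    rw [LinearMap.sum_apply, sum_words_append]
    simp only [sum_words_one, LinearMap.smul_apply, hy, smul_add, Prod.smul_mk, smul_zero,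
      LinearMap.zero_apply]
    have h1 := congrArg (· • c) (hA.rel r hr)
    simp only [sum_words_append, sum_words_one, Finset.sum_smul, smul_assoc, zero_smul] at h1
    have h2 := (Submodule.Quotient.mk_eq_zero S).2 hmem
    rw [← Submodule.mkQ_apply, map_sum] at h2
    simp only [map_sum] at h2
    ext
    · simp only [Prod.fst_sum, Finset.sum_add_distrib, h1, zero_add, Prod.fst_zero]
      rw [← smul_zero l, ← h2, Finset.smul_sum]
      refine Finset.sum_congr rfl fun w _ => ?_
      rw [Finset.smul_sum]
      refine Finset.sum_congr rfl fun x _ => ?_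
      rw [smul_comm]
      rfl
    · simp [Prod.snd_sum]
  obtain ⟨f, hf⟩ := hA.lift y hrel
  have hf1 : ∀ (t : A) (c : C), f t (c, 0) = (t • c, 0) := by
    intro t c
    have : (LinearMap.applyₗ (R := k) ((c, 0) : C × k)) ∘ₗ f.toLinearMap =
        LinearMap.inl k C k ∘ₗ (LinearMap.toSpanSingleton A C c).restrictScalars k := by
      refine hA.ext fun w => ?_
      simp only [LinearMap.comp_apply, AlgHom.toLinearMap_apply, LinearMap.applyₗ_apply_apply,
        LinearMap.coe_restrictScalars, LinearMap.toSpanSingleton_apply, LinearMap.inl_apply]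
      rw [map_wprod, ← hy1]
      congr 3
      ext1 x
      exact hf x
    exact LinearMap.congr_fun this t
  have h1 := LinearMap.congr_fun hD 1
  rw [koszulD_apply, sum_words_one] at h1
  simp only [wprod_cons, wprod_nil, mul_one, LinearMap.zero_apply] at h1
  have h2 := congrArg (fun t => (f t (0, 1)).1) h1
  simp only [map_sum, map_mul, Module.End.mul_apply, hf, hy0, LinearMap.sum_apply, smul_zero,
    zero_add, one_smul, hf1, Prod.fst_sum, map_zero, LinearMap.zero_apply, Prod.fst_zero] at h2
  have h3 : φ = ∑ x, φ (s x) • E x := by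
    refine hB.ext fun w => ?_
    simp only [LinearMap.sum_apply, LinearMap.smul_apply, E, scal_apply]
    by_cases hw : w.length = 1
    · obtain ⟨z, rfl⟩ := List.length_eq_one_iff.1 hw
      rw [Finset.sum_eq_single z]
      · rw [hB.coord_wprod (by simp; omega)]; simp
      · intro x _ hx
        rw [hB.coord_wprod (by simp; omega), if_neg (by simpa using hx.symm)]; simp
      · simp
    · rw [hφ w hw]
      symm
      refine Finset.sum_eq_zero fun x _ => ?_
      rw [hB.coord_wprod (by simp; omega), if_neg]
      · simp
      · rintro rfl; simp at hw
  rw [h3, ← Submodule.Quotient.mk_eq_zero S, ← Submodule.mkQ_apply, map_sum]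
  simpa using h2

end differentials

/-! ### The kernel of the Koszul differential in the lowest degree -/

/-- The extra condition: a multilinear function which satisfies the relations `Q` in the first and
in the last position also satisfies them in between, as long as these positions overlap. -/
def ExtraCondition {k : Type u} [Field k] {X : Type} [Fintype X] (N : ℕ) (Q : Set (List X → k)) :
    Prop :=
  ∀ m < N, ∀ g : List X → k,
    (∀ q ∈ Q, ∀ v : List X, v.length = m → ∑ w ∈ words X N, q w * g (w ++ v) = 0) →
    (∀ q ∈ Q, ∀ u : List X, u.length = m → ∑ w ∈ words X N, q w * g (u ++ w) = 0) →
    ∀ q ∈ Q, ∀ u v : List X, u.length + v.length = m →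
      ∑ w ∈ words X N, q w * g (u ++ w ++ v) = 0

section lowest

variable {k : Type u} [Field k] {X : Type} [Fintype X] {N : ℕ} {Rel : Set (List X → k)}
  {A : Type u} [Ring A] [Algebra k A] {a : X → A}
  {B : Type u} [Ring B] [Algebra k B] {s : X → B}

/-- Reversing words exchanges the first and the last position. This makes the condition available
for the opposite algebras, hence for the right Koszul complex. -/
theorem ExtraCondition.rev {Q : Set (List X → k)} (h : ExtraCondition N Q) :
    ExtraCondition N (revRel Q) := by
  intro m hm g h1 h2 q hq u v huv
  have := h m hm (fun w => g w.reverse) ?_ ?_ _ hq v.reverse u.reverse (by simp; omega)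
  · rw [← sum_words_reverse, ← this]
    refine Finset.sum_congr rfl fun w _ => ?_
    simp
  · intro r hr v hv
    rw [← h2 (fun w => r w.reverse) (by simpa [revRel] using hr) v.reverse (by simpa using hv),
      ← sum_words_reverse]
    refine Finset.sum_congr rfl fun w _ => ?_
    simp
  · intro r hr v hv
    rw [← h1 (fun w => r w.reverse) (by simpa [revRel] using hr) v.reverse (by simpa using hv),
      ← sum_words_reverse]
    refine Finset.sum_congr rfl fun w _ => ?_
    simp

theorem Presents.apply_mem (hB : Presents N Rel s) {M : Type*} [AddCommGroup M] [Module k M]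
    {φ : B →ₗ[k] M} {S : Submodule k M} (h : ∀ w, φ (wprod s w) ∈ S) (f : B) : φ f ∈ S := by
  have : Submodule.span k (Set.range (wprod s)) ≤ S.comap φ := by
    rw [Submodule.span_le]
    rintro _ ⟨w, rfl⟩
    exact h w
  rw [hB.span] at this
  exact this trivial

/-- A cycle with values in `A_e`, `e < N`, is an array of scalars indexed by words of length `e +
n`, and it comes from a linear form on `B` as soon as this array satisfies the relations of `B` in
every position. The alternatives in `hEC` are the cases in which the positions strictly between `0`
and `e` are absent or are covered by the extra condition. -/
theorem exists_scal_of_koszulD_eq_zero (hA : Presents N Rel a)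
    (hB : Presents N (annRel N Rel) s) {n c e : ℕ} (hce : c + e = N) (hc : 0 < c)
    (hEC : e = 1 ∨ n = c ∨ N ≤ n ∧ ExtraCondition N (annRel N Rel))
    {φ : B →ₗ[k] A} (hsupp : φ ∈ supp (A := A) k s n) (hval : ∀ w, φ (wprod s w) ∈ gr k a e)
    (hD : koszulD a s c φ = 0) :
    ∃ χ : B →ₗ[k] k, (∀ w : List X, w.length ≠ n + e → χ (wprod s w) = 0) ∧
      koszulD a s e (scal A χ) = φ := by
  classical
  have heN : e < N := by omega
  let g : List X → k := fun l =>
    if l.length = e + n then hA.coord (l.take e) (φ (wprod s (l.drop e))) else 0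
  have hg : ∀ p l : List X, p.length = e → g (p ++ l) = hA.coord p (φ (wprod s l)) := by
    intro p l hp
    simp only [g, List.take_left' hp, List.drop_left' hp]
    by_cases hl : l.length = n
    · rw [if_pos (by simp [hp, hl])]
    · rw [hsupp l hl, map_zero, ite_self]
  have hval' : ∀ f, φ f ∈ gr k a e := hB.apply_mem hval
  -- From position `e` on, the relations hold because `φ` is defined on the quotient `B`.
  have late : ∀ q ∈ annRel N Rel, ∀ u v : List X, e ≤ u.length →
      ∑ w ∈ words X N, q w * g (u ++ w ++ v) = 0 := by
    intro q hq u v hu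
    obtain ⟨p, u', rfl, hp⟩ : ∃ p u', u = p ++ u' ∧ p.length = e :=
      ⟨u.take e, u.drop e, by simp, by simp [hu]⟩
    have h1 := congrArg (fun t => hA.coord p (φ (wprod s u' * t * wprod s v))) (hB.rel q hq)
    simp only [mul_zero, zero_mul, map_zero, Finset.mul_sum, Finset.sum_mul, map_sum,
      mul_smul_comm, smul_mul_assoc, map_smul] at h1
    rw [← h1]
    refine Finset.sum_congr rfl fun w _ => ?_
    simp only [List.append_assoc]
    rw [hg _ _ hp]
    simp [mul_assoc]
  -- In position `0` the cycle condition is used: `c + e = N`, so the differential takes values in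
  -- `A_N`, where each `q` is a linear form.
  have early : ∀ q ∈ annRel N Rel, ∀ v : List X, ∑ w ∈ words X N, q w * g (w ++ v) = 0 := by
    intro q hq v
    obtain ⟨Λ, hΛ⟩ := hA.exists_functional_of_annRel hq
    have h1 := LinearMap.congr_fun hD (wprod s v)
    rw [koszulD_apply] at h1
    have h2 : ∀ w ∈ words X c, φ (wprod s w * wprod s v) * wprod a w =
        ∑ p ∈ words X e, hA.coord p (φ (wprod s (w ++ v))) • wprod a (p ++ w) := by
      intro w _
      conv_lhs => rw [← hA.sum_coord heN (hval' (wprod s w * wprod s v))]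
      rw [Finset.sum_mul]
      refine Finset.sum_congr rfl fun p _ => ?_
      simp
    rw [Finset.sum_congr rfl h2, Finset.sum_comm] at h1
    have h3 := congrArg Λ h1
    simp only [map_sum, map_smul, LinearMap.zero_apply, map_zero] at h3
    have hw : words X N = words X (e + c) := by congr 1; omega
    rw [← h3, hw, sum_words_append]
    refine Finset.sum_congr rfl fun p hp => Finset.sum_congr rfl fun w hw => ?_
    rw [mem_words] at hp hw
    rw [List.append_assoc, hg _ _ hp, hΛ, if_pos (by simp; omega), smul_eq_mul, mul_comm]
  obtain ⟨χ, hχ⟩ := hB.exists_functional g (by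
    intro q hq u v
    by_cases hu : e ≤ u.length
    · exact late q hq u v hu
    by_cases hu0 : u = []
    · subst hu0; simpa using early q hq v
    by_cases hl : u.length + N + v.length = e + n
    swap
    · refine Finset.sum_eq_zero fun w hw => ?_
      rw [mem_words] at hw
      have : (u ++ w ++ v).length ≠ e + n := by simp [hw]; omega
      simp only [g]
      rw [if_neg this, mul_zero]
    have hu1 : 0 < u.length := List.length_pos_iff.2 hu0
    obtain h | h | ⟨hNn, hec⟩ := hEC
    · omega
    · omega
    -- The extra condition is applied to the first `N + e` letters, the tail `v2` being frozen:
    -- there, position `0` is early and position `e` is late.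
    obtain ⟨v1, v2, rfl, hv⟩ : ∃ v1 v2, v = v1 ++ v2 ∧ u.length + v1.length = e :=
      ⟨v.take (e - u.length), v.drop (e - u.length), by simp, by simp; omega⟩
    have := hec e heN (fun l => g (l ++ v2))
      (fun q hq v _ => by simpa only [List.append_assoc] using early q hq (v ++ v2))
      (fun q hq u hu => late q hq u v2 hu.ge) q hq u v1 hv
    simpa only [List.append_assoc] using this)
  refine ⟨χ, fun w hw => ?_, hB.ext fun w => ?_⟩
  · rw [hχ]
    exact if_neg (by omega)
  · rw [koszulD_scal_apply]
    rw [← hA.sum_coord heN (hval w)]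
    refine Finset.sum_congr rfl fun p hp => ?_
    rw [← wprod_append, hχ, hg _ _ (mem_words.1 hp)]

end lowest

/-! ### Transfer to the opposite algebras -/

section op

variable {k : Type u} [Field k] {X : Type} [Fintype X] {N : ℕ} {Rel : Set (List X → k)}
  {A : Type u} [Ring A] [Algebra k A] {a : X → A}
  {B : Type u} [Ring B] [Algebra k B] {s : X → B}

theorem annRel_revRel : annRel N (revRel Rel) = revRel (annRel N Rel) := by
  ext q
  simp only [annRel, revRel, Set.mem_ofPred_eq]
  constructor
  · intro h r hr
    rw [← h (fun w => r w.reverse) (by simpa using hr), ← sum_words_reverse]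
    simp
  · intro h r hr
    rw [← h _ hr, ← sum_words_reverse]

/-- A linear map, seen as a linear map between the opposite algebras. -/
def opMap (x : B →ₗ[k] A) : Bᵐᵒᵖ →ₗ[k] Aᵐᵒᵖ :=
  (MulOpposite.opLinearEquiv k).toLinearMap ∘ₗ x ∘ₗ (MulOpposite.opLinearEquiv k).symm.toLinearMap

@[simp] theorem opMap_op (x : B →ₗ[k] A) (f : B) :
    opMap x (MulOpposite.op f) = MulOpposite.op (x f) := rfl

theorem koszulD_opMap (n : ℕ) (x : B →ₗ[k] A) :
    koszulD (MulOpposite.op ∘ a) (MulOpposite.op ∘ s) n (opMap x) = opMap (rightD a s n x) := by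
  refine LinearMap.ext fun f => ?_
  obtain ⟨f, rfl⟩ := MulOpposite.op_surjective f
  rw [koszulD_apply, opMap_op, rightD_apply, ← sum_words_reverse, Finset.op_sum]
  refine Finset.sum_congr rfl fun w _ => ?_
  rw [op_wprod, op_wprod, List.reverse_reverse, ← MulOpposite.op_mul, opMap_op, smul_eq_mul,
    MulOpposite.op_mul]

theorem opMap_injective : Function.Injective (opMap : (B →ₗ[k] A) → (Bᵐᵒᵖ →ₗ[k] Aᵐᵒᵖ)) := by
  intro x y h
  ext f
  have := LinearMap.congr_fun h (MulOpposite.op f)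
  simpa using this

theorem exists_opMap (y : Bᵐᵒᵖ →ₗ[k] Aᵐᵒᵖ) : ∃ x : B →ₗ[k] A, opMap x = y :=
  ⟨(MulOpposite.opLinearEquiv k).symm.toLinearMap ∘ₗ y ∘ₗ
    (MulOpposite.opLinearEquiv k).toLinearMap, by ext f; simp [opMap]⟩

theorem opMap_mem_supp {n : ℕ} {x : B →ₗ[k] A} :
    opMap x ∈ supp (A := Aᵐᵒᵖ) k (MulOpposite.op ∘ s) n ↔ x ∈ supp (A := A) k s n := by
  constructor
  · intro h w hw
    have := h w.reverse (by simpa using hw)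
    simpa [op_wprod] using this
  · intro h w hw
    rw [op_wprod, opMap_op, h _ (by simpa using hw), MulOpposite.op_zero]

theorem op_mem_gr {n : ℕ} {y : A} (h : y ∈ gr k a n) :
    MulOpposite.op y ∈ gr k (MulOpposite.op ∘ a) n := by
  obtain ⟨c, rfl⟩ := exists_sum_of_mem_gr h
  rw [Finset.op_sum]
  refine Submodule.sum_mem _ fun w hw => ?_
  rw [MulOpposite.op_smul]
  refine Submodule.smul_mem _ _ ?_
  have := wprod_mem_gr' (k := k) (a := MulOpposite.op ∘ a) (w := w.reverse) (n := n)
    (by simpa using hw)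
  simpa [op_wprod] using this

theorem opMap_scal (χ : B →ₗ[k] k) :
    opMap (scal A χ) = scal Aᵐᵒᵖ (χ ∘ₗ (MulOpposite.opLinearEquiv k).symm.toLinearMap) := by
  ext f
  simp [opMap]

theorem eq_zero_of_rightD_scal (hA : Presents N Rel a) (hB : Presents N (annRel N Rel) s)
    {c : ℕ} (hc : c < N) {χ : B →ₗ[k] k} (h0 : ∀ w : List X, w.length < c → χ (wprod s w) = 0)
    (hD : rightD a s c (scal A χ) = 0) : χ = 0 := by
  have hB' := hB.op
  rw [← annRel_revRel] at hB'
  have := eq_zero_of_koszulD_scal hA.op hB' hc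
    (χ := χ ∘ₗ (MulOpposite.opLinearEquiv k).symm.toLinearMap) ?_ ?_
  · ext f
    exact LinearMap.congr_fun this (MulOpposite.op f)
  · intro w hw
    simpa [op_wprod] using h0 w.reverse (by simpa using hw)
  · rw [← opMap_scal, koszulD_opMap, hD]
    ext; simp [opMap]

theorem exists_scal_of_rightD_eq_zero (hA : Presents N Rel a)
    (hB : Presents N (annRel N Rel) s) {n c e : ℕ} (hce : c + e = N) (hc : 0 < c)
    (hEC : e = 1 ∨ n = c ∨ N ≤ n ∧ ExtraCondition N (annRel N Rel))
    {x : B →ₗ[k] A} (hsupp : x ∈ supp (A := A) k s n) (hval : ∀ w, x (wprod s w) ∈ gr k a e)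
    (hD : rightD a s c x = 0) :
    ∃ χ : B →ₗ[k] k, (∀ w : List X, w.length ≠ n + e → χ (wprod s w) = 0) ∧
      rightD a s e (scal A χ) = x := by
  have hB' := hB.op
  rw [← annRel_revRel] at hB'
  obtain ⟨χ, h1, h2⟩ := exists_scal_of_koszulD_eq_zero hA.op hB' hce hc
    (hEC.imp_right (Or.imp_right fun h => ⟨h.1, by rw [annRel_revRel]; exact h.2.rev⟩))
    (opMap_mem_supp.2 hsupp)
    (fun w => by rw [op_wprod, opMap_op]; exact op_mem_gr (hval _))
    (by rw [koszulD_opMap, hD]; ext; simp [opMap])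
  refine ⟨χ ∘ₗ (MulOpposite.opLinearEquiv k).toLinearMap, ?_, ?_⟩
  · intro w hw
    have := h1 w.reverse (by simpa using hw)
    simpa [op_wprod] using this
  · apply opMap_injective
    rw [← koszulD_opMap, opMap_scal, ← h2]
    congr 2

theorem exists_rightD_one (hN : 2 ≤ N) (hB : Presents N (annRel N Rel) s) {x : B →ₗ[k] A}
    (hx : x ∈ supp (A := A) k s 0)
    (h1 : x 1 ∈ Submodule.span k (wprod a '' {w : List X | w ≠ []})) :
    ∃ y ∈ supp (A := A) k s 1, rightD a s 1 y = x := by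
  have hB' := hB.op
  rw [← annRel_revRel] at hB'
  obtain ⟨ψ, h2, h3⟩ := exists_koszulD_one (A := Aᵐᵒᵖ) (a := MulOpposite.op ∘ a) hN hB'
    (opMap_mem_supp.2 hx) (by
      rw [← MulOpposite.op_one, opMap_op]
      generalize x 1 = t at h1
      induction h1 using Submodule.span_induction with
      | mem y hy =>
        obtain ⟨w, hw, rfl⟩ := hy
        refine Submodule.subset_span ⟨w.reverse, by simpa using hw, ?_⟩
        simp [op_wprod]
      | zero => simp
      | add y z _ _ hy hz => rw [MulOpposite.op_add]; exact add_mem hy hz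
      | smul t y _ hy => rw [MulOpposite.op_smul]; exact Submodule.smul_mem _ _ hy)
  obtain ⟨y, rfl⟩ := exists_opMap ψ
  refine ⟨y, opMap_mem_supp.1 h2, opMap_injective ?_⟩
  rw [← koszulD_opMap, h3]

end op

/-! ### The jumps of the Koszul complex -/

/-- The difference `n(i + 1) - n(i)`. -/
def step (N i : ℕ) : ℕ := if i % 2 = 0 then 1 else N - 1

section step

variable {N : ℕ}

theorem jump_succ (hN : 2 ≤ N) (i : ℕ) : jump N (i + 1) = jump N i + step N i := by
  rcases Nat.even_or_odd' i with ⟨q, rfl | rfl⟩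
  · have h1 : (2 * q + 1) / 2 = q := by omega
    simp [jump, step, h1]
  · have h1 : (2 * q + 1) / 2 = q := by omega
    have h2 : (2 * q + 1 + 1) / 2 = q + 1 := by omega
    have h3 : (2 * q + 1 + 1) % 2 = 0 := by omega
    simp [jump, step, h1, h2, h3, Nat.add_mul]
    omega

theorem step_add_step (hN : 2 ≤ N) (i : ℕ) : step N i + step N (i + 1) = N := by
  unfold step
  split_ifs <;> omega

theorem step_pos (hN : 2 ≤ N) (i : ℕ) : 0 < step N i := by
  unfold step
  split_ifs <;> omega

theorem step_lt (hN : 2 ≤ N) (i : ℕ) : step N i < N := by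
  unfold step
  split_ifs <;> omega

@[simp] theorem jump_zero : jump N 0 = 0 := by simp [jump]
@[simp] theorem jump_one : jump N 1 = 1 := by simp [jump]
@[simp] theorem jump_two : jump N 2 = N := by simp [jump]

theorem jump_mono (hN : 2 ≤ N) : StrictMono (jump N) :=
  strictMono_nat_of_lt_succ fun i => by
    rw [jump_succ hN]
    have := step_pos hN i
    omega

/-- This matches the alternatives of `exists_scal_of_koszulD_eq_zero` for the degree `n(i+1)`; only
the last one requires the extra condition. -/
theorem step_cases (hN : 2 ≤ N) (i : ℕ) :
    step N (i + 1) = 1 ∨ jump N (i + 1) = step N i ∨ N ≤ jump N (i + 1) := by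
  rcases i with _ | i
  · right; left; simp [step]
  · right; right
    have := (jump_mono hN).monotone (show 2 ≤ i + 1 + 1 by omega)
    simpa using this

end step

/-! ### Homogeneous maps -/

section homog

variable {k : Type u} [Field k] {X : Type} [Fintype X] {N : ℕ} {Rel : Set (List X → k)}
  {A : Type u} [Ring A] [Algebra k A] {a : X → A}
  {B : Type u} [Ring B] [Algebra k B] {s : X → B}
  {M : Type u} [AddCommGroup M] [Module k M]
  {M' : Type u} [AddCommGroup M'] [Module k M']

/-- The projection onto the component of degree `z`. -/
def Presents.proj (h : Presents N Rel a) (z : ℤ) : A →ₗ[k] A :=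
  if 0 ≤ z then h.exists_proj.choose z.toNat else 0

theorem Presents.proj_wprod (h : Presents N Rel a) (z : ℤ) (w : List X) :
    h.proj z (wprod a w) = if (w.length : ℤ) = z then wprod a w else 0 := by
  unfold Presents.proj
  by_cases hz : 0 ≤ z
  · rw [if_pos hz, h.exists_proj.choose_spec]
    congr 1
    simp only [eq_iff_iff]
    omega
  · rw [if_neg hz, if_neg (by omega), LinearMap.zero_apply]

theorem Presents.proj_mul_wprod (h : Presents N Rel a) (z : ℤ) (y : A) (w : List X) :
    h.proj (z + w.length) (y * wprod a w) = h.proj z y * wprod a w := by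
  have : h.proj (z + w.length) ∘ₗ LinearMap.mulRight k (wprod a w) =
      LinearMap.mulRight k (wprod a w) ∘ₗ h.proj z := by
    refine h.ext fun v => ?_
    simp only [LinearMap.comp_apply, LinearMap.mulRight_apply, ← wprod_append, h.proj_wprod]
    simp
  exact LinearMap.congr_fun this y

theorem Presents.proj_wprod_mul (h : Presents N Rel a) (z : ℤ) (y : A) (w : List X) :
    h.proj (z + w.length) (wprod a w * y) = wprod a w * h.proj z y := by
  have : h.proj (z + w.length) ∘ₗ LinearMap.mulLeft k (wprod a w) =
      LinearMap.mulLeft k (wprod a w) ∘ₗ h.proj z := by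
    refine h.ext fun v => ?_
    simp only [LinearMap.comp_apply, LinearMap.mulLeft_apply, ← wprod_append, h.proj_wprod]
    simp [add_comm z]
  exact LinearMap.congr_fun this y

/-- The component of degree `z`. -/
def grZ (k : Type u) [Field k] [Algebra k A] (a : X → A) (z : ℤ) : Submodule k A :=
  if 0 ≤ z then gr k a z.toNat else ⊥

theorem grZ_natCast (n : ℕ) : grZ k a n = gr k a n := by simp [grZ]

theorem eq_zero_of_mem_grZ {z : ℤ} (hz : z < 0) {y : A} (hy : y ∈ grZ k a z) : y = 0 := by
  rw [grZ, if_neg (by omega)] at hy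
  simpa using hy

theorem mul_mem_grZ {z z' : ℤ} {y y' : A} (hy : y ∈ grZ k a z) (hy' : y' ∈ grZ k a z') :
    y * y' ∈ grZ k a (z + z') := by
  by_cases hz : 0 ≤ z
  · by_cases hz' : 0 ≤ z'
    · lift z to ℕ using hz
      lift z' to ℕ using hz'
      rw [grZ_natCast] at hy hy'
      rw [← Nat.cast_add, grZ_natCast]
      exact mul_mem_gr hy hy'
    · rw [eq_zero_of_mem_grZ (by omega) hy', mul_zero]; exact zero_mem _
  · rw [eq_zero_of_mem_grZ (by omega) hy, zero_mul]; exact zero_mem _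

theorem wprod_mem_grZ (w : List X) : wprod a w ∈ grZ k a w.length := by
  rw [grZ_natCast]; exact wprod_mem_gr w

theorem Presents.proj_mem (h : Presents N Rel a) (z : ℤ) (y : A) : h.proj z y ∈ grZ k a z := by
  refine h.apply_mem (fun w => ?_) y
  rw [h.proj_wprod]
  split_ifs with hw
  · rw [← hw]; exact wprod_mem_grZ w
  · exact zero_mem _

theorem Presents.proj_of_mem (h : Presents N Rel a) {z : ℤ} {y : A} (hy : y ∈ grZ k a z) :
    h.proj z y = y := by
  by_cases hz : 0 ≤ z
  · lift z to ℕ using hz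
    rw [grZ_natCast] at hy
    induction hy using Submodule.span_induction with
    | mem y hy =>
      obtain ⟨w, hw, rfl⟩ := hy
      rw [h.proj_wprod, if_pos (by simpa using hw)]
    | zero => simp
    | add y z _ _ hy hz => rw [map_add, hy, hz]
    | smul t y _ hy => rw [map_smul, hy]
  · rw [eq_zero_of_mem_grZ (by omega) hy, map_zero]

/-- The linear maps supported in degree `p`, and of total degree `m`. -/
def homog (s : X → B) (p : ℕ) (G : ℤ → Submodule k M) (m : ℤ) : Submodule k (B →ₗ[k] M) where
  carrier := {φ | ∀ w : List X, (w.length = p → φ (wprod s w) ∈ G (m - p)) ∧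
    (w.length ≠ p → φ (wprod s w) = 0)}
  zero_mem' := by simp
  add_mem' := by
    intro φ ψ hφ hψ w
    refine ⟨fun h => add_mem ((hφ w).1 h) ((hψ w).1 h), fun h => ?_⟩
    simp [(hφ w).2 h, (hψ w).2 h]
  smul_mem' := by
    intro c φ hφ w
    refine ⟨fun h => Submodule.smul_mem _ _ ((hφ w).1 h), fun h => ?_⟩
    simp [(hφ w).2 h]

theorem homog_le_supp {p : ℕ} {m : ℤ} {φ : B →ₗ[k] A} (h : φ ∈ homog s p (grZ k a) m) :
    φ ∈ supp (A := A) k s p := fun w hw => (h w).2 hw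

theorem proj_comp_mem_homog (hA : Presents N Rel a) {p : ℕ} {φ : B →ₗ[k] A}
    (h : φ ∈ supp (A := A) k s p) (m : ℤ) :
    hA.proj (m - p) ∘ₗ φ ∈ homog s p (grZ k a) m := by
  intro w
  refine ⟨fun _ => hA.proj_mem _ _, fun hw => ?_⟩
  rw [LinearMap.comp_apply, h w hw, map_zero]

theorem proj_comp_of_mem_homog (hA : Presents N Rel a) {Q : Set (List X → k)}
    (hB : Presents N Q s) {p : ℕ} {m : ℤ} {φ : B →ₗ[k] A}
    (h : φ ∈ homog s p (grZ k a) m) : hA.proj (m - p) ∘ₗ φ = φ := by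
  refine hB.ext fun w => ?_
  by_cases hw : w.length = p
  · exact hA.proj_of_mem ((h w).1 hw)
  · rw [LinearMap.comp_apply, (h w).2 hw, map_zero]

theorem koszulD_proj_comp (hA : Presents N Rel a) (n : ℕ) (z : ℤ) (φ : B →ₗ[k] A) :
    koszulD a s n (hA.proj z ∘ₗ φ) = hA.proj (z + n) ∘ₗ koszulD a s n φ := by
  ext f
  rw [koszulD_apply, LinearMap.comp_apply, koszulD_apply, map_sum]
  refine Finset.sum_congr rfl fun w hw => ?_
  rw [← mem_words.1 hw, hA.proj_mul_wprod, LinearMap.comp_apply]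

theorem rightD_proj_comp (hA : Presents N Rel a) (n : ℕ) (z : ℤ) (φ : B →ₗ[k] A) :
    rightD a s n (hA.proj z ∘ₗ φ) = hA.proj (z + n) ∘ₗ rightD a s n φ := by
  ext f
  rw [rightD_apply, LinearMap.comp_apply, rightD_apply, map_sum]
  refine Finset.sum_congr rfl fun w hw => ?_
  rw [← mem_words.1 hw, smul_eq_mul, smul_eq_mul, hA.proj_wprod_mul, LinearMap.comp_apply]

theorem koszulD_mem_homog {n p : ℕ} {m : ℤ} {φ : B →ₗ[k] A}
    (h : φ ∈ homog s (p + n) (grZ k a) m) : koszulD a s n φ ∈ homog s p (grZ k a) m := by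
  intro w
  refine ⟨fun hw => ?_, fun hw => koszulD_mem_supp (m := p)
    (by rw [add_comm]; exact homog_le_supp h) w hw⟩
  rw [koszulD_apply]
  refine Submodule.sum_mem _ fun v hv => ?_
  rw [← wprod_append]
  have h1 := (h (v ++ w)).1 (by simp [mem_words.1 hv, hw, add_comm])
  have := mul_mem_grZ h1 (wprod_mem_grZ (k := k) v)
  rw [mem_words.1 hv] at this
  convert this using 2
  push_cast
  ring

/-- A family of submodules on which the words act with their degree. -/
def IsGradedFamily [Module A M] (a : X → A) (G : ℤ → Submodule k M) : Prop :=
  ∀ w z y, y ∈ G z → wprod a w • y ∈ G (z + w.length)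

theorem isGradedFamily_grZ : IsGradedFamily a (grZ k a) := fun w z y hy => by
  rw [add_comm]
  exact mul_mem_grZ (wprod_mem_grZ w) hy

theorem isGradedFamily_homog (p : ℕ) :
    IsGradedFamily a (homog s p (grZ k a)) := by
  intro w z φ hφ v
  refine ⟨fun hv => ?_, fun hv => by simp [(hφ v).2 hv]⟩
  have := isGradedFamily_grZ (k := k) w _ _ ((hφ v).1 hv)
  rw [LinearMap.smul_apply]
  convert this using 2
  ring

theorem rightD_mem_homog [Module A M] [IsScalarTower k A M] {G : ℤ → Submodule k M}
    (hG : IsGradedFamily a G) {n p : ℕ} {m : ℤ}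
    {x : B →ₗ[k] M} (h : x ∈ homog s (p + n) G m) : rightD a s n x ∈ homog s p G m := by
  intro w
  constructor
  · intro hw
    rw [rightD_apply]
    refine Submodule.sum_mem _ fun v hv => ?_
    rw [← wprod_append]
    have := hG v _ _ ((h (w ++ v)).1 (by simp [mem_words.1 hv, hw]))
    rw [mem_words.1 hv] at this
    convert this using 2
    push_cast
    ring
  · intro hw
    rw [rightD_apply]
    refine Finset.sum_eq_zero fun v hv => ?_
    rw [← wprod_append, (h (w ++ v)).2 (by simp [mem_words.1 hv, hw]), smul_zero]

/-- Over a field, `L` has a linear section from the image of `S` to `S`, so liftability at each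
element gives a lift depending linearly on it. -/
theorem exists_lift_mem (L : M →ₗ[k] M') (S : Submodule k M) (Y : B →ₗ[k] M')
    (h : ∀ f, Y f ∈ S.map L) : ∃ Y' : B →ₗ[k] M, (∀ f, Y' f ∈ S) ∧ L ∘ₗ Y' = Y := by
  obtain ⟨σ, hσ⟩ := (L.submoduleMap S).exists_rightInverse_of_surjective
    (LinearMap.range_eq_top.2 (L.submoduleMap_surjective S))
  refine ⟨S.subtype ∘ₗ σ ∘ₗ Y.codRestrict _ h, fun f => Subtype.property _, ?_⟩
  ext f
  have := congrArg Subtype.val (LinearMap.congr_fun hσ (Y.codRestrict _ h f))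
  simpa using this

theorem exists_lift_homog {Q : Set (List X → k)} (hB : Presents N Q s) {G : ℤ → Submodule k M}
    {G' : ℤ → Submodule k M'} (L : M →ₗ[k] M') {p : ℕ} {m : ℤ} {Y : B →ₗ[k] M'}
    (hY : Y ∈ homog s p G' m)
    (h : ∀ f, Y f ∈ G' (m - p) → ∃ y ∈ G (m - p), L y = Y f) :
    ∃ Y' ∈ homog s p G m, L ∘ₗ Y' = Y := by
  obtain ⟨Y', h1, h2⟩ := exists_lift_mem L (G (m - p)) Y (by
    refine hB.apply_mem fun w => ?_
    by_cases hw : w.length = p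
    · exact h _ ((hY w).1 hw)
    · rw [(hY w).2 hw]; exact zero_mem _)
  refine ⟨Y' ∘ₗ hB.proj p, fun w => ⟨fun _ => h1 _, fun hw => ?_⟩, hB.ext fun w => ?_⟩
  · rw [LinearMap.comp_apply, hB.proj_wprod, if_neg (by exact_mod_cast hw), map_zero]
  · simp only [LinearMap.comp_apply, hB.proj_wprod, Nat.cast_inj]
    by_cases hw : w.length = p
    · rw [if_pos hw]; exact LinearMap.congr_fun h2 _
    · rw [if_neg hw, (hY w).2 hw, map_zero, map_zero]

theorem flip_mem_homog {p q : ℕ} {m : ℤ} {Q : Set (List X → k)} (hB : Presents N Q s)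
    {Y : B →ₗ[k] B →ₗ[k] A}
    (h : Y ∈ homog s p (homog s q (grZ k a)) m) : Y.flip ∈ homog s q (homog s p (grZ k a)) m := by
  intro w
  constructor
  · intro hw v
    rw [LinearMap.flip_apply]
    refine ⟨fun hv => ?_, fun hv => by rw [(h v).2 hv]; rfl⟩
    have := ((h v).1 hv w).1 hw
    rwa [sub_right_comm]
  · intro hw
    refine hB.ext fun v => ?_
    rw [LinearMap.flip_apply]
    by_cases hv : v.length = p
    · exact ((h v).1 hv w).2 hw
    · rw [(h v).2 hv]; rfl

theorem exists_scal (hN : 0 < N) (hA : Presents N Rel a) {Q : Set (List X → k)}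
    (hB : Presents N Q s) {φ : B →ₗ[k] A} (h : ∀ w, φ (wprod s w) ∈ gr k a 0) :
    φ = scal A (hA.coord [] ∘ₗ φ) := by
  refine hB.ext fun w => ?_
  have := hA.sum_coord hN (h w)
  rw [sum_words_zero] at this
  rw [scal_apply, LinearMap.comp_apply, Algebra.algebraMap_eq_smul_one]
  exact this.symm

end homog

/-! ### The extra condition -/

section extra

variable {k : Type u} [Field k] {X : Type} [Fintype X] {N : ℕ} {Rel : Set (List X → k)}
  {A : Type u} [Ring A] [Algebra k A] {a : X → A}
  {B : Type u} [Ring B] [Algebra k B] {s : X → B}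

/-- The nontrivial half of biduality: an element of `A` is tested against all linear forms on `A`,
each of which is a dual relation. -/
theorem Presents.sum_eq_zero_of_annRel (hA : Presents N Rel a) {c : List X → k}
    (hc : ∀ q ∈ annRel N Rel, ∑ w ∈ words X N, q w * c w = 0) :
    ∑ w ∈ words X N, c w • wprod a w = 0 := by
  rw [← Module.forall_dual_apply_eq_zero_iff k]
  intro l
  rw [← hc _ (hA.functional_mem_annRel l), map_sum]
  refine Finset.sum_congr rfl fun w _ => ?_
  rw [map_smul, smul_eq_mul, mul_comm]

/-- The relations in the last position make `g` a map `φ` from the component of degree `N` of `B` to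
`A_{m+1}`, and those in the first position make `φ` a cycle. A preimage `ψ` of `φ` is defined on one
more letter, and its compatibility with the relations of `B` shifts the position of the relations in
`g` by one. -/
theorem extraCondition_of_exact (hA : Presents N Rel a)
    (hB : Presents N (annRel N Rel) s)
    (h : ∀ φ ∈ supp (A := A) k s N, koszulD a s (N - 1) φ = 0 →
      ∃ ψ ∈ supp (A := A) k s (N + 1), koszulD a s 1 ψ = φ) :
    ExtraCondition N (annRel N Rel) := by
  classical
  intro m
  induction m with
  | zero =>
    intro _ g h1 _ q hq u v huv
    obtain ⟨rfl, rfl⟩ : u = [] ∧ v = [] :=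
      ⟨List.length_eq_zero_iff.1 (by omega), List.length_eq_zero_iff.1 (by omega)⟩
    simpa using h1 q hq [] rfl
  | succ m ih =>
    intro hm g h1 h2 q hq u v huv
    rcases List.eq_nil_or_concat' v with rfl | ⟨v, x, rfl⟩
    · simpa using h2 q hq u (by simpa using huv)
    have := ih (by omega) (fun l => g (l ++ [x])) ?_ ?_ q hq u v (by simp at huv; omega)
    · simpa only [List.append_assoc] using this
    · intro r hr v hv
      simpa only [List.append_assoc] using h1 r hr (v ++ [x]) (by simp [hv])
    · intro r hr u hu
      have hγ : ∀ p : List X, ∃ γ : B →ₗ[k] k, p.length = m + 1 →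
          ∀ w, γ (wprod s w) = if w.length = N then g (p ++ w) else 0 := by
        intro p
        by_cases hp : p.length = m + 1
        · obtain ⟨γ, hγ⟩ := hB.exists_functional_of_annRel (q := fun w => g (p ++ w))
            (fun q hq => h2 q hq p hp)
          exact ⟨γ, fun _ => hγ⟩
        · exact ⟨0, fun h => absurd h hp⟩
      choose γ hγ using hγ
      let φ : B →ₗ[k] A := ∑ p ∈ words X (m + 1), (γ p).smulRight (wprod a p)
      have hφ : ∀ w, φ (wprod s w) = ∑ p ∈ words X (m + 1),
          (if w.length = N then g (p ++ w) else 0) • wprod a p := by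
        intro w
        simp only [φ, LinearMap.sum_apply, LinearMap.smulRight_apply]
        refine Finset.sum_congr rfl fun p hp => ?_
        rw [hγ p (mem_words.1 hp)]
      have hφs : φ ∈ supp (A := A) k s N := by
        intro w hw
        rw [hφ]
        exact Finset.sum_eq_zero fun p _ => by rw [if_neg hw, zero_smul]
      obtain ⟨ψ, -, hψ⟩ := h φ hφs (by
        refine hB.ext fun v => ?_
        by_cases hv : v.length = 1
        swap
        · exact koszulD_mem_supp (m := 1)
            (by rwa [show N - 1 + 1 = N by omega]) v hv
        rw [koszulD_apply]
        have e1 : ∀ w ∈ words X (N - 1), φ (wprod s w * wprod s v) * wprod a w =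
            ∑ p ∈ words X (m + 1), g ((p ++ w) ++ v) • wprod a (p ++ w) := by
          intro w hw
          rw [mem_words] at hw
          rw [← wprod_append, hφ, Finset.sum_mul]
          refine Finset.sum_congr rfl fun p _ => ?_
          rw [if_pos (by rw [List.length_append, hw, hv]; omega), wprod_append,
            smul_mul_assoc, List.append_assoc]
        rw [Finset.sum_congr rfl e1, Finset.sum_comm,
          ← sum_words_append (m + 1) (N - 1) (fun l => g (l ++ v) • wprod a l)]
        -- The words of length `N + m` are now cut after the first `N` letters instead of the first
        -- `m + 1`, so that the relations in the first position apply.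
        have e2 : words X (m + 1 + (N - 1)) = words X (N + m) := by congr 1; omega
        rw [e2, sum_words_append, Finset.sum_comm]
        refine Finset.sum_eq_zero fun l hl => ?_
        rw [mem_words] at hl
        have := hA.sum_eq_zero_of_annRel (c := fun w => g (w ++ (l ++ v)))
          (fun q hq => h1 q hq (l ++ v) (by simp; omega))
        have h3 := congrArg (· * wprod a l) this
        simp only [Finset.sum_mul, zero_mul] at h3
        rw [← h3]
        refine Finset.sum_congr rfl fun w _ => ?_
        rw [wprod_append,
            smul_mul_assoc, List.append_assoc])
      -- Comparing the coefficients of the word `u z` in `d ψ = φ` expresses `g` through `ψ`; these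
      -- words are independent because `m + 1 < N`.
      have hg : ∀ (z : X) (w : List X), w.length = N →
          g (u ++ z :: w) = hA.coord u (ψ (wprod s (z :: w))) := by
        intro z w hw
        have e1 := LinearMap.congr_fun hψ (wprod s w)
        rw [koszulD_apply, hφ, sum_words_one] at e1
        have e2 := congrArg (hA.coord (u ++ [z])) e1
        rw [hA.coord_sum hm (fun p => if w.length = N then g (p ++ w) else 0)
          (by simp [hu]), if_pos hw, map_sum, Finset.sum_eq_single z] at e2
        · rw [List.append_assoc] at e2
          rw [show u ++ z :: w = u ++ ([z] ++ w) from rfl, ← e2, ← wprod_append]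
          have : hA.coord (u ++ [z]) ∘ₗ LinearMap.mulRight k (wprod a [z]) = hA.coord u := by
            refine hA.ext fun l => ?_
            rw [LinearMap.comp_apply, LinearMap.mulRight_apply, ← wprod_append,
              hA.coord_wprod (by simp; omega), hA.coord_wprod (by omega)]
            simp
          exact LinearMap.congr_fun this _
        · intro y _ hy
          have : hA.coord (u ++ [z]) ∘ₗ LinearMap.mulRight k (wprod a [y]) = 0 := by
            refine hA.ext fun l => ?_
            rw [LinearMap.comp_apply, LinearMap.mulRight_apply, ← wprod_append,
              hA.coord_wprod (by simp; omega), if_neg]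
            · rfl
            · intro h
              have := (List.append_inj' h rfl).2
              simp only [List.cons.injEq, and_true] at this
              exact hy this
          exact LinearMap.congr_fun this _
        · simp
      have h4 := congrArg (fun t => hA.coord u (ψ (t * wprod s [x]))) (hB.rel r hr)
      simp only [zero_mul, map_zero, Finset.sum_mul, map_sum, smul_mul_assoc, map_smul] at h4
      rw [← h4]
      refine Finset.sum_congr rfl fun w hw => ?_
      rw [mem_words] at hw
      rw [← wprod_append, smul_eq_mul]
      obtain ⟨z, l, hzl⟩ : ∃ z l, w ++ [x] = z :: l :=
        List.exists_cons_of_ne_nil (by simp)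
      have hl : l.length = N := by
        have := congrArg List.length hzl
        simp at this
        omega
      rw [List.append_assoc, hzl, hg z l hl]

end extra

/-! ### Exactness of the right Koszul complex -/

/-- Exactness of the left Koszul complex in positive homological degrees. -/
def KoszulExact {k : Type u} [Field k] {X : Type} [Fintype X] (N : ℕ)
    {A : Type u} [Ring A] [Algebra k A] (a : X → A)
    {B : Type u} [Ring B] [Algebra k B] (s : X → B) : Prop :=
  ∀ i, ∀ φ ∈ supp (A := A) k s (jump N (i + 1)), koszulD a s (step N i) φ = 0 →
    ∃ ψ ∈ supp (A := A) k s (jump N (i + 2)), koszulD a s (step N (i + 1)) ψ = φ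

/-- The property of being a cycle in degree `i` of the right Koszul complex. -/
def IsRightCycle {k : Type u} [Field k] {X : Type} [Fintype X] (N : ℕ)
    {A : Type u} [Ring A] [Algebra k A] (a : X → A)
    {B : Type u} [Ring B] [Algebra k B] (s : X → B)
    {M : Type u} [AddCommGroup M] [Module k M] [Module A M] [IsScalarTower k A M]
    (i : ℕ) (x : B →ₗ[k] M) : Prop :=
  ∀ j, i = j + 1 → rightD a s (step N j) x = 0

/-- Exactness of the right Koszul complex in homological degree `i` and total degree `m`, where
the augmentation is disregarded. -/
def RightExactAt {k : Type u} [Field k] {X : Type} [Fintype X] (N : ℕ)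
    {A : Type u} [Ring A] [Algebra k A] (a : X → A)
    {B : Type u} [Ring B] [Algebra k B] (s : X → B) (i : ℕ) (m : ℤ) : Prop :=
  ∀ x ∈ homog s (jump N i) (grZ k a) m, IsRightCycle N a s i x →
    ∃ y ∈ homog s (jump N (i + 1)) (grZ k a) m, rightD a s (step N i) y = x

section right

variable {k : Type u} [Field k] {X : Type} [Fintype X] {N : ℕ} {Rel : Set (List X → k)}
  {A : Type u} [Ring A] [Algebra k A] {a : X → A}
  {B : Type u} [Ring B] [Algebra k B] {s : X → B}

theorem KoszulExact.homog (h : KoszulExact (k := k) N a s) (hN : 2 ≤ N) (hA : Presents N Rel a)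
    (hB : Presents N (annRel N Rel) s) (i : ℕ) {m : ℤ} {φ : B →ₗ[k] A}
    (hφ : φ ∈ homog s (jump N (i + 1)) (grZ k a) m) (hD : koszulD a s (step N i) φ = 0) :
    ∃ ψ ∈ homog s (jump N (i + 2)) (grZ k a) m, koszulD a s (step N (i + 1)) ψ = φ := by
  obtain ⟨ψ, h1, h2⟩ := h i φ (homog_le_supp hφ) hD
  refine ⟨_, proj_comp_mem_homog hA h1 m, ?_⟩
  rw [koszulD_proj_comp, h2, jump_succ hN (i + 1)]
  convert proj_comp_of_mem_homog hA hB hφ using 3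
  push_cast
  ring

theorem mem_span_of_mem_grZ {z : ℤ} (hz : 0 < z) {y : A} (hy : y ∈ grZ k a z) :
    y ∈ Submodule.span k (wprod a '' {w : List X | w ≠ []}) := by
  lift z to ℕ using hz.le
  rw [grZ_natCast] at hy
  refine Submodule.span_mono (Set.image_mono ?_) hy
  rintro w hw rfl
  simp only [Set.mem_ofPred_eq, List.length_nil] at hw
  omega

/-- Elements of the double complex are maps `B → B → A`: the left differential acts through the
inner variable, the right one through the outer variable. Rows inherit exactness from the left
Koszul complex. -/
theorem exists_row (h : KoszulExact (k := k) N a s) (hN : 2 ≤ N) (hA : Presents N Rel a)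
    (hB : Presents N (annRel N Rel) s) {p j : ℕ} {m : ℤ} {Y : B →ₗ[k] B →ₗ[k] A}
    (hY : Y ∈ homog s p (NHomogeneous.homog s (jump N (j + 1)) (grZ k a)) m)
    (hD : ∀ f, koszulD a s (step N j) (Y f) = 0) :
    ∃ Y' ∈ homog s p (NHomogeneous.homog s (jump N (j + 2)) (grZ k a)) m,
      ∀ f, koszulD a s (step N (j + 1)) (Y' f) = Y f := by
  obtain ⟨Y', h1, h2⟩ := exists_lift_homog hB
    ((koszulD a s (step N (j + 1))).restrictScalars k) hY
    (G := NHomogeneous.homog s (jump N (j + 2)) (grZ k a))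
    (fun f hf => h.homog hN hA hB j hf (hD f))
  exact ⟨Y', h1, fun f => LinearMap.congr_fun h2 f⟩

theorem rightD_flip (n : ℕ) (Y : B →ₗ[k] B →ₗ[k] A) (h : B) :
    rightD a s n (Y.flip h) = (rightD a s n Y).flip h := by
  ext f
  simp [rightD_apply, LinearMap.sum_apply]

theorem exists_column (hB : Presents N (annRel N Rel) s)
    {i q : ℕ} {m : ℤ} (h : RightExactAt (k := k) N a s i (m - q)) {Y : B →ₗ[k] B →ₗ[k] A}
    (hY : Y ∈ homog s (jump N i) (homog s q (grZ k a)) m) (hD : IsRightCycle N a s i Y) :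
    ∃ Y' ∈ homog s (jump N (i + 1)) (homog s q (grZ k a)) m, rightD a s (step N i) Y' = Y := by
  obtain ⟨Y', h1, h2⟩ := exists_lift_homog hB (rightD a s (step N i)) (flip_mem_homog hB hY)
    (G := homog s (jump N (i + 1)) (grZ k a))
    (fun f hf => h _ hf (fun j hj => by rw [rightD_flip, hD j hj]; ext; rfl))
  refine ⟨Y'.flip, flip_mem_homog hB h1, ?_⟩
  ext f g
  have := LinearMap.congr_fun (LinearMap.congr_fun h2 g) f
  rw [LinearMap.comp_apply, LinearMap.flip_apply] at this
  rw [← this, ← LinearMap.flip_apply, ← rightD_flip]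
  rfl

/-- The two differentials commute: they act on different variables, and they multiply the values in
`A` on opposite sides. -/
theorem rightD_koszulD_comp (m n : ℕ) (Y : B →ₗ[k] B →ₗ[k] A) (f : B) :
    rightD a s m ((koszulD a s n).restrictScalars k ∘ₗ Y) f =
      koszulD a s n (rightD a s m Y f) := by
  simp only [rightD_apply, map_sum, map_smul]
  rfl

/-- A staircase in the double complex. The right differential of `Y` is lifted along a row, the lift
is corrected by induction to a column cycle, and a column preimage `t` of that cycle gives the
correction `Y - d t`. -/
theorem exists_cycle_add (h : KoszulExact (k := k) N a s) (hN : 2 ≤ N) (hA : Presents N Rel a)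
    (hB : Presents N (annRel N Rel) s) {i : ℕ} {m : ℤ}
    (hcol : ∀ b < i, ∀ z : ℤ, (b = 0 → z ≠ 0) → RightExactAt (k := k) N a s b z)
    (hm : m ≠ jump N (i + 1)) : ∀ b j, b + j = i → ∀ Y : B →ₗ[k] B →ₗ[k] A,
      Y ∈ homog s (jump N b) (NHomogeneous.homog s (jump N (j + 1)) (grZ k a)) m →
      (∀ b', b = b' + 1 → ∀ f, koszulD a s (step N j) (rightD a s (step N b') Y f) = 0) →
      ∃ c ∈ homog s (jump N b) (NHomogeneous.homog s (jump N (j + 1)) (grZ k a)) m,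
        IsRightCycle N a s b c ∧ ∃ z : B →ₗ[k] B →ₗ[k] A,
          ∀ f, Y f = c f + koszulD a s (step N (j + 1)) (z f) := by
  intro b
  induction b with
  | zero => exact fun j _ Y hY _ => ⟨Y, hY, fun _ h => by omega, 0, by simp⟩
  | succ b ih =>
    intro j hbj Y hY hD
    rw [jump_succ hN] at hY
    have hY1 := rightD_mem_homog (a := a) (isGradedFamily_homog _) hY
    obtain ⟨Y', hY', e⟩ := exists_row h hN hA hB hY1 (hD b rfl)
    have eY : (koszulD a s (step N (j + 1))).restrictScalars k ∘ₗ Y' =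
      rightD a s (step N b) Y := LinearMap.ext e
    obtain ⟨c', hc', hcyc, z', hz'⟩ := ih (j + 1) (by omega) Y' hY' (by
      rintro b' rfl f
      rw [← rightD_koszulD_comp, eY, rightD_rightD, step_add_step hN, rightD_eq_zero hA hB]
      rfl)
    -- The column of index `0` fails to be exact only in total degree `0`; at this corner the inner
    -- degree is `n(i+1)`, so `hm` excludes that case.
    obtain ⟨t, ht, et⟩ := exists_column hB (hcol b (by omega) _ (by
      rintro rfl
      rw [show j + 1 + 1 = i + 1 by omega]
      omega)) hc' hcyc
    have ht' : (koszulD a s (step N (j + 1))).restrictScalars k ∘ₗ t ∈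
        homog s (jump N (b + 1)) (NHomogeneous.homog s (jump N (j + 1)) (grZ k a)) m := by
      intro w
      refine ⟨fun hw => ?_, fun hw => ?_⟩
      · have h3 := (ht w).1 hw
        rw [jump_succ hN (j + 1)] at h3
        exact koszulD_mem_homog h3
      · rw [LinearMap.comp_apply, (ht w).2 hw, map_zero]
    rw [← jump_succ hN] at hY
    refine ⟨Y + (-1 : k) • ((koszulD a s (step N (j + 1))).restrictScalars k ∘ₗ t),
      Submodule.add_mem _ hY (Submodule.smul_mem _ _ ht'), ?_, t, ?_⟩
    · intro b' hb'
      obtain rfl : b = b' := by omega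
      refine LinearMap.ext fun f => ?_
      rw [map_add, map_smul, LinearMap.add_apply, LinearMap.smul_apply, rightD_koszulD_comp, et,
        ← e f, hz' f, map_add, koszulD_koszulD, add_comm (step N _),
        step_add_step hN, koszulD_eq_zero hA hB, add_zero, neg_smul, one_smul]
      exact add_neg_cancel _
    · intro f
      rw [LinearMap.add_apply, LinearMap.smul_apply, neg_smul, one_smul]
      exact (neg_add_cancel_right _ _).symm

theorem exists_homog_of_rightD (hN : 2 ≤ N) (hA : Presents N Rel a)
    (hB : Presents N (annRel N Rel) s) {i : ℕ} {m : ℤ} {x y : B →ₗ[k] A}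
    (hx : x ∈ homog s (jump N i) (grZ k a) m) (hy : y ∈ supp (A := A) k s (jump N (i + 1)))
    (h : rightD a s (step N i) y = x) :
    ∃ y ∈ homog s (jump N (i + 1)) (grZ k a) m, rightD a s (step N i) y = x := by
  refine ⟨_, proj_comp_mem_homog hA hy m, ?_⟩
  rw [rightD_proj_comp, h, jump_succ hN i]
  convert proj_comp_of_mem_homog hA hB hx using 3
  push_cast
  ring

theorem rightExactAt_zero (hN : 2 ≤ N) (hA : Presents N Rel a)
    (hB : Presents N (annRel N Rel) s) {z : ℤ} (hz : z ≠ 0) :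
    RightExactAt (k := k) N a s 0 z := by
  intro x hx _
  by_cases h : z < 0
  · refine ⟨0, zero_mem _, ?_⟩
    rw [map_zero]
    refine hB.ext fun w => ?_
    by_cases hw : w.length = jump N 0
    · exact (eq_zero_of_mem_grZ (by simpa using h) ((hx w).1 hw)).symm
    · exact ((hx w).2 hw).symm
  · obtain ⟨y, h1, h2⟩ := exists_rightD_one (a := a) hN hB (x := x)
      (by simpa using homog_le_supp hx)
      (mem_span_of_mem_grZ (z := z) (by omega) (by simpa using (hx []).1))
    exact exists_homog_of_rightD hN hA hB hx (y := y) (by simpa using h1) (by simpa [step] using h2)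

theorem homog_natCast_eq (p e : ℕ) {φ : B →ₗ[k] A} (h : φ ∈ homog s p (grZ k a) (p + e : ℕ))
    (w : List X) : φ (wprod s w) ∈ gr k a e := by
  by_cases hw : w.length = p
  · have := (h w).1 hw
    rwa [Nat.cast_add, add_sub_cancel_left, grZ_natCast] at this
  · rw [(h w).2 hw]; exact zero_mem _

/-- The cycles of degree different from `n(i + 1)` are generated by cycles of lower degree. -/
theorem exists_sum_of_cycle (h : KoszulExact (k := k) N a s) (hN : 2 ≤ N) (hA : Presents N Rel a)
    (hB : Presents N (annRel N Rel) s) {i : ℕ} {m : ℤ}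
    (hcol : ∀ b < i + 1, ∀ z : ℤ, (b = 0 → z ≠ 0) → RightExactAt (k := k) N a s b z)
    (hm : m ≠ jump N (i + 2)) (hm' : m ≠ jump N (i + 1)) {x : B →ₗ[k] A}
    (hx : x ∈ homog s (jump N (i + 1)) (grZ k a) m) (hD : rightD a s (step N i) x = 0) :
    ∃ c : X → (B →ₗ[k] A), (∀ y, c y ∈ homog s (jump N (i + 1)) (grZ k a) (m - 1) ∧
      rightD a s (step N i) (c y) = 0) ∧
      x = ∑ y, LinearMap.mulRight k (a y) ∘ₗ c y := by
  classical
  let ε := hB.coord []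
  have hε : ∀ w, ε (wprod s w) = if w = [] then 1 else 0 := hB.coord_wprod (by simp; omega)
  -- Since `m ≠ n(i+1)`, the values of `x` lie in the augmentation ideal when they are nonzero, so
  -- `x` can be written as `∑ Y(·)(s_y) a_y`.
  have hlift : ∃ Y ∈ homog s (jump N (i + 1))
      (NHomogeneous.homog s (jump N 1) (grZ k a)) m, ∀ f, koszulD a s 1 (Y f) 1 = x f := by
    let L : (B →ₗ[k] A) →ₗ[k] A :=
      LinearMap.applyₗ (1 : B) ∘ₗ (koszulD a s 1).restrictScalars k
    obtain ⟨Y, h1, h2⟩ := exists_lift_homog hB L hx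
      (G := NHomogeneous.homog s (jump N 1) (grZ k a)) (by
        intro f hf
        let φ : B →ₗ[k] A := ε.smulRight (x f)
        have hφ : φ ∈ homog s (jump N 0) (grZ k a) (m - jump N (i + 1)) := by
          intro w
          simp only [φ, LinearMap.smulRight_apply, hε]
          refine ⟨fun _ => ?_, fun hw => ?_⟩
          · rw [jump_zero, Nat.cast_zero, sub_zero]
            exact Submodule.smul_mem _ _ hf
          · rw [if_neg, zero_smul]
            rintro rfl
            simp at hw
        have hφ1 : φ 1 = x f := by
          rw [← wprod_nil s, LinearMap.smulRight_apply, hε, if_pos rfl, one_smul]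
        by_cases hneg : m - jump N (i + 1) < 0
        · refine ⟨0, zero_mem _, ?_⟩
          rw [map_zero, eq_zero_of_mem_grZ hneg hf]
        · obtain ⟨ψ, h3, h4⟩ := exists_koszulD_one (a := a) hN hB (φ := φ)
            (by simpa using homog_le_supp hφ) (by
              rw [hφ1]
              exact mem_span_of_mem_grZ (by omega) hf)
          refine ⟨_, proj_comp_mem_homog hA (p := jump N 1) (by simpa using h3) _, ?_⟩
          change koszulD a s 1 _ 1 = x f
          rw [koszulD_proj_comp, h4, LinearMap.comp_apply, hφ1]
          convert hA.proj_of_mem hf using 2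
          simp)
    exact ⟨Y, h1, fun f => LinearMap.congr_fun h2 f⟩
  obtain ⟨Y, hY, hYx⟩ := hlift
  obtain ⟨c, hc, hcyc, z, hz⟩ := exists_cycle_add h hN hA hB (i := i + 1) hcol hm (i + 1) 0
    (by omega) Y hY (by
      intro b' hb' f
      obtain rfl : i = b' := by omega
      have hY1 := rightD_mem_homog (a := a) (n := step N i) (p := jump N i)
        (isGradedFamily_homog (jump N 1)) (by rwa [← jump_succ hN])
      have hs : rightD a s (step N i) Y f ∈ supp (A := A) k s 1 := by
        have : rightD a s (step N i) Y f ∈ (supp (A := A) k s 1).restrictScalars k := by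
          refine hB.apply_mem (fun w => ?_) f
          by_cases hw : w.length = jump N i
          · simpa using homog_le_supp ((hY1 w).1 hw)
          · rw [(hY1 w).2 hw]; exact zero_mem _
        exact this
      refine hB.ext fun w => ?_
      by_cases hw : w.length = 0
      swap
      · exact koszulD_mem_supp (m := 0) (by simpa [step] using hs) w hw
      rw [List.length_eq_zero_iff.1 hw, wprod_nil, ← rightD_koszulD_comp]
      have := LinearMap.congr_fun hD f
      rw [rightD_apply] at this ⊢
      rw [LinearMap.sum_apply]
      simp only [← hYx] at this
      simpa [step] using this)
  have hxc : ∀ f, x f = koszulD a s 1 (c f) 1 := by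
    intro f
    rw [← hYx, hz f, map_add]
    have : koszulD a s 1 (koszulD a s (step N (0 + 1)) (z f)) = 0 := by
      have h1 : koszulD a s 1 (koszulD a s (step N (0 + 1)) (z f)) =
        koszulD a s (step N 0) (koszulD a s (step N (0 + 1)) (z f)) := by simp [step]
      rw [h1, koszulD_koszulD, add_comm, step_add_step hN, koszulD_eq_zero hA hB]
    rw [this, add_zero]
  -- Replacing `Y` by the column cycle `c` does not change `x`, because `Y - c` is a left boundary;
  -- each component of `c` along a generator is then a right cycle of degree `m - 1`.
  refine ⟨fun y => c.flip (s y), fun y => ⟨?_, ?_⟩, ?_⟩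
  · have := (flip_mem_homog hB hc [y]).1 (by simp)
    simpa using this
  · rw [rightD_flip, hcyc i rfl]
    ext; rfl
  · ext f
    rw [hxc, koszulD_apply, sum_words_one, LinearMap.sum_apply]
    simp

/-- An outer induction on the homological degree supplies exact columns to the left; an inner one on
the total degree uses that a cycle is zero in degree `n(i+1)`, comes from a linear form in degree
`n(i+2)`, and otherwise is a combination of cycles of smaller degree. -/
theorem rightExactAt (h : KoszulExact (k := k) N a s) (hN : 2 ≤ N) (hA : Presents N Rel a)
    (hB : Presents N (annRel N Rel) s) (hEC : ExtraCondition N (annRel N Rel)) (i : ℕ) :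
    ∀ m : ℤ, (i = 0 → m ≠ 0) → RightExactAt (k := k) N a s i m := by
  induction i using Nat.strong_induction_on with
  | _ i ih =>
  rcases i with _ | i
  · intro m hm
    exact rightExactAt_zero hN hA hB (hm rfl)
  suffices ∀ n : ℕ, ∀ m : ℤ, m < n → RightExactAt (k := k) N a s (i + 1) m from
    fun m _ => this (m.toNat + 1) m (by omega)
  intro n
  induction n with
  | zero =>
    intro m hm x hx _
    refine ⟨0, zero_mem _, ?_⟩
    rw [map_zero]
    refine hB.ext fun w => ?_
    by_cases hw : w.length = jump N (i + 1)
    · exact (eq_zero_of_mem_grZ (by push_cast at hm; omega) ((hx w).1 hw)).symm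
    · exact ((hx w).2 hw).symm
  | succ n ihn =>
    intro m hm x hx hcyc
    have hD := hcyc i rfl
    by_cases h1 : m = jump N (i + 1)
    · have hv : ∀ w, x (wprod s w) ∈ gr k a 0 := homog_natCast_eq (jump N (i + 1)) 0 (by
        rwa [h1] at hx)
      have hx0 : x = 0 := by
        have e := exists_scal (by omega) hA hB hv
        have := eq_zero_of_rightD_scal hA hB (step_lt hN i) (χ := hA.coord [] ∘ₗ x) (by
          intro w hw
          rw [LinearMap.comp_apply, (hx w).2, map_zero]
          rw [jump_succ hN]
          omega) (by rwa [← e])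
        rw [e, this]
        ext; simp
      exact ⟨0, zero_mem _, by rw [hx0, map_zero]⟩
    by_cases h2 : m = jump N (i + 2)
    · have hv : ∀ w, x (wprod s w) ∈ gr k a (step N (i + 1)) :=
        homog_natCast_eq (jump N (i + 1)) _ (by rwa [h2, jump_succ hN (i + 1)] at hx)
      obtain ⟨χ, h3, h4⟩ := exists_scal_of_rightD_eq_zero hA hB (step_add_step hN i)
        (step_pos hN i)
        ((step_cases hN i).imp_right (Or.imp_right fun h => ⟨h, hEC⟩)) (homog_le_supp hx) hv hD
      refine exists_homog_of_rightD hN hA hB hx (y := scal A χ) ?_ h4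
      intro w hw
      rw [scal_apply, h3 w (by rwa [← jump_succ hN]), map_zero]
    obtain ⟨c, hc, rfl⟩ := exists_sum_of_cycle h hN hA hB (fun b hb => ih b hb) h2 h1 hx hD
    choose t ht ht' using fun y => ihn (m - 1) (by push_cast at hm; omega) (c y) (hc y).1
      (fun j hj => by obtain rfl : i = j := by omega
                      exact (hc y).2)
    refine ⟨∑ y, LinearMap.mulRight k (a y) ∘ₗ t y, Submodule.sum_mem _ fun y _ w => ?_, ?_⟩
    · refine ⟨fun hw => ?_, fun hw => by
        rw [LinearMap.comp_apply, (ht y w).2 hw, map_zero]⟩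
      have := mul_mem_grZ ((ht y w).1 hw) (wprod_mem_grZ (k := k) [y])
      rw [LinearMap.comp_apply, LinearMap.mulRight_apply]
      convert this using 1
      · congr 1
        simp
        ring
      · simp
    · rw [map_sum]
      refine Finset.sum_congr rfl fun y _ => ?_
      rw [← ht' y]
      ext f
      simp [rightD_apply, mul_assoc]

theorem Presents.exists_sum_proj (hA : Presents N Rel a) (y : A) :
    ∃ n : ℕ, ∀ n' ≥ n, ∑ c ∈ Finset.range n', hA.proj c y = y := by
  have : y ∈ Submodule.span k (Set.range (wprod a)) := by rw [hA.span]; trivial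
  induction this using Submodule.span_induction with
  | mem y hy =>
    obtain ⟨w, rfl⟩ := hy
    refine ⟨w.length + 1, fun n hn => ?_⟩
    simp only [hA.proj_wprod, Nat.cast_inj]
    rw [Finset.sum_ite_eq, if_pos (by simp; omega)]
  | zero => exact ⟨0, by simp⟩
  | add y z _ _ hy hz =>
    obtain ⟨n, hn⟩ := hy
    obtain ⟨n', hn'⟩ := hz
    refine ⟨max n n', fun l hl => ?_⟩
    simp only [map_add, Finset.sum_add_distrib]
    rw [hn l (le_of_max_le_left hl), hn' l (le_of_max_le_right hl)]
  | smul t y _ hy =>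
    obtain ⟨n, hn⟩ := hy
    refine ⟨n, fun l hl => ?_⟩
    simp only [map_smul, ← Finset.smul_sum]
    rw [hn l hl]

theorem exists_sum_proj_comp (hA : Presents N Rel a) (hB : Presents N (annRel N Rel) s)
    {p : ℕ} {φ : B →ₗ[k] A}
    (h : φ ∈ supp (A := A) k s p) :
    ∃ n : ℕ, φ = ∑ c ∈ Finset.range n, hA.proj c ∘ₗ φ := by
  choose n hn using fun w => hA.exists_sum_proj (φ (wprod s w))
  -- Only finitely many words have length `p`, so one bound serves for all values of `φ`.
  refine ⟨(words X p).sup n, hB.ext fun w => ?_⟩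
  by_cases hw : w.length = p
  · rw [LinearMap.sum_apply]
    exact (hn w _ (Finset.le_sup (f := n) (mem_words.2 hw))).symm
  · rw [LinearMap.sum_apply, h w hw]
    exact (Finset.sum_eq_zero fun c _ => by rw [LinearMap.comp_apply, h w hw, map_zero]).symm

/-- Exactness of the right Koszul complex. -/
theorem exists_rightD_of_cycle (h : KoszulExact (k := k) N a s) (hN : 2 ≤ N)
    (hA : Presents N Rel a) (hB : Presents N (annRel N Rel) s) (i : ℕ) {x : B →ₗ[k] A}
    (hx : x ∈ supp (A := A) k s (jump N (i + 1))) (hD : rightD a s (step N i) x = 0) :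
    ∃ y ∈ supp (A := A) k s (jump N (i + 2)), rightD a s (step N (i + 1)) y = x := by
  have hEC : ExtraCondition N (annRel N Rel) := extraCondition_of_exact hA hB (by
    intro φ hφ hD
    obtain ⟨ψ, h1, h2⟩ := h 1 φ (by simpa using hφ) (by simpa [step] using hD)
    refine ⟨ψ, ?_, by simpa [step] using h2⟩
    have : jump N (1 + 2) = N + 1 := by simp [jump]
    rwa [this] at h1)
  obtain ⟨n, hn⟩ := exists_sum_proj_comp hA hB hx
  have key : ∀ c : ℕ, ∃ y ∈ supp (A := A) k s (jump N (i + 2)),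
      rightD a s (step N (i + 1)) y = hA.proj c ∘ₗ x := by
    intro c
    have h1 := proj_comp_mem_homog hA hx (c + jump N (i + 1))
    rw [add_sub_cancel_right] at h1
    obtain ⟨y, h2, h3⟩ := rightExactAt h hN hA hB hEC (i + 1) _ (by simp) _ h1 (by
      intro j hj
      obtain rfl : i = j := by omega
      rw [rightD_proj_comp, hD, LinearMap.comp_zero])
    exact ⟨y, homog_le_supp h2, h3⟩
  choose y hy hy' using key
  refine ⟨∑ c ∈ Finset.range n, y c, Submodule.sum_mem _ fun c _ => hy c, ?_⟩
  rw [map_sum]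
  conv_rhs => rw [hn]
  exact Finset.sum_congr rfl fun c _ => hy' c

end right

/-! ### The presentation of an `N`-homogeneous algebra in coordinates -/

section pow

variable {k : Type u} [Field k] {X : Type} [Fintype X]
  {A : Type u} [Ring A] [Algebra k A] {a : X → A}

theorem gr_zero : gr k a 0 = 1 := by
  have : {w : List X | w.length = 0} = {[]} := by ext w; simp
  rw [gr, this, Set.image_singleton, wprod_nil, Submodule.one_eq_span]

theorem gr_succ (n : ℕ) : gr k a (n + 1) = Submodule.span k (Set.range a) * gr k a n := by
  rw [gr, gr, Submodule.span_mul_span]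
  congr 1
  ext y
  constructor
  · rintro ⟨w, hw, rfl⟩
    obtain ⟨x, l, rfl⟩ := List.exists_cons_of_length_eq_add_one hw
    exact ⟨a x, ⟨x, rfl⟩, wprod a l, ⟨l, by simpa using hw, rfl⟩, by simp⟩
  · rintro ⟨_, ⟨x, rfl⟩, _, ⟨l, hl, rfl⟩, rfl⟩
    exact ⟨x :: l, by simpa using hl, by simp⟩

theorem gr_eq_pow (n : ℕ) : gr k a n = Submodule.span k (Set.range a) ^ n := by
  induction n with
  | zero => rw [gr_zero, pow_zero]
  | succ n ih => rw [gr_succ, ih, pow_succ']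

variable {V : Type u} [AddCommGroup V] [Module k V]

theorem gr_basis (b : Module.Basis X k V) (f : V →ₗ[k] A) (n : ℕ) :
    gr k (f ∘ b) n = LinearMap.range f ^ n := by
  rw [gr_eq_pow, Set.range_comp, ← Submodule.map_span, b.span_eq, Submodule.map_top]

end pow

section presentation

variable {k V : Type u} [Field k] [AddCommGroup V] [Module k V] {N : ℕ} {X : Type} [Fintype X]
  (b : Module.Basis X k V)

theorem presents_tensorAlgebra (N : ℕ) :
    Presents N (∅ : Set (List X → k)) (TensorAlgebra.ι k ∘ b) where
  rel := by simp
  span := by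
    have h : Algebra.adjoin k (Set.range (TensorAlgebra.ι k ∘ b)) = ⊤ := by
      rw [← top_le_iff, ← TensorAlgebra.adjoin_range_ι, Algebra.adjoin_le_iff]
      rintro _ ⟨v, rfl⟩
      have : v ∈ Submodule.span k (Set.range b) := by rw [b.span_eq]; trivial
      have h2 := Submodule.mem_map_of_mem (f := TensorAlgebra.ι k) this
      rw [Submodule.map_span, ← Set.range_comp] at h2
      exact Algebra.span_le_adjoin k _ h2
    have h2 : Set.range (wprod (TensorAlgebra.ι k ∘ b)) =
        (Submonoid.closure (Set.range (TensorAlgebra.ι k ∘ b)) : Set (TensorAlgebra k V)) := by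
      ext y
      constructor
      · rintro ⟨w, rfl⟩
        refine Submonoid.list_prod_mem _ fun z hz => ?_
        obtain ⟨x, _, rfl⟩ := List.mem_map.1 hz
        exact Submonoid.subset_closure ⟨x, rfl⟩
      · intro hy
        induction hy using Submonoid.closure_induction with
        | mem y hy =>
          obtain ⟨x, rfl⟩ := hy
          exact ⟨[x], by simp⟩
        | one => exact ⟨[], rfl⟩
        | mul y z _ _ hy hz =>
          obtain ⟨p, rfl⟩ := hy
          obtain ⟨q, rfl⟩ := hz
          exact ⟨p ++ q, by simp⟩
    rw [h2, ← Algebra.adjoin_eq_span, h, Algebra.top_toSubmodule]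
  lift y _ := ⟨TensorAlgebra.lift k (b.constr k y), fun x => by
    rw [Function.comp_apply, TensorAlgebra.lift_ι_apply, b.constr_basis]⟩

open Classical in
/-- The coefficient of the word `w` in an element of the tensor algebra. -/
def coeff (w : List X) : TensorAlgebra k V →ₗ[k] k :=
  ((presents_tensorAlgebra b 1).exists_functional (fun v => if v = w then 1 else 0)
    (by simp)).choose

open Classical in
theorem coeff_wprod (w v : List X) :
    coeff b w (wprod (TensorAlgebra.ι k ∘ b) v) = if v = w then 1 else 0 :=
  ((presents_tensorAlgebra b 1).exists_functional (fun v => if v = w then 1 else 0)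
    (by simp)).choose_spec v

theorem sum_coeff {n : ℕ} {y : TensorAlgebra k V}
    (hy : y ∈ LinearMap.range (TensorAlgebra.ι k : V →ₗ[k] TensorAlgebra k V) ^ n) :
    ∑ w ∈ words X n, coeff b w y • wprod (TensorAlgebra.ι k ∘ b) w = y := by
  rw [← gr_basis b] at hy
  obtain ⟨c, rfl⟩ := exists_sum_of_mem_gr hy
  refine Finset.sum_congr rfl fun w hw => ?_
  rw [map_sum, Finset.sum_eq_single w]
  · rw [map_smul, coeff_wprod, if_pos rfl, smul_eq_mul, mul_one]
  · intro v _ hv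
    rw [map_smul, coeff_wprod, if_neg hv, smul_zero]
  · exact fun h => absurd hw h

/-- The relations in coordinates. -/
def coordRel (R : Submodule k (⨂[k]^N V)) : Set (List X → k) :=
  {r | ∃ ρ ∈ R, ∀ w : List X, w.length = N → r w = coeff b w (TensorPower.toTensorAlgebra ρ)}

theorem presents_alg (R : Submodule k (⨂[k]^N V)) :
    Presents N (coordRel b R) (Alg.ι R ∘ b) where
  rel := by
    rintro r ⟨ρ, hρ, hr⟩
    have h1 := congrArg (Alg.mk R) (sum_coeff b (toTensorAlgebra_mem N ρ))
    rw [Alg.mk_toTensorAlgebra hρ, map_sum] at h1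
    rw [← h1]
    refine Finset.sum_congr rfl fun w hw => ?_
    rw [hr w (mem_words.1 hw), map_smul, map_wprod]
    rfl
  span := by
    have h1 : Set.range (wprod (Alg.ι R ∘ b)) =
        (Alg.mk R).toLinearMap '' Set.range (wprod (TensorAlgebra.ι k ∘ b)) := by
      rw [← Set.range_comp]
      congr 1
      ext1 w
      exact (map_wprod _ (Alg.mk R) w).symm
    rw [h1, Submodule.span_image, (presents_tensorAlgebra b N).span, Submodule.map_top,
      LinearMap.range_eq_top]
    exact RingQuot.mkAlgHom_surjective k (Rel R)
  lift {C} _ _ y hy := by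
    refine ⟨Alg.lift R (TensorAlgebra.lift k (b.constr k y)) fun ρ hρ => ?_, fun x => ?_⟩
    · rw [← sum_coeff b (toTensorAlgebra_mem N ρ), map_sum,
        ← hy (fun w => coeff b w (TensorPower.toTensorAlgebra ρ)) ⟨ρ, hρ, fun _ _ => rfl⟩]
      refine Finset.sum_congr rfl fun w hw => ?_
      rw [map_smul, map_wprod]
      congr 2
      ext1 x
      rw [Function.comp_apply, Function.comp_apply, TensorAlgebra.lift_ι_apply, b.constr_basis]
    · have : (Alg.ι R ∘ b) x = Alg.mk R (TensorAlgebra.ι k (b x)) := rfl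
      rw [this, Alg.lift_mk, TensorAlgebra.lift_ι_apply, b.constr_basis]

theorem grade_eq_gr (R : Submodule k (⨂[k]^N V)) (n : ℕ) :
    Alg.grade R n = gr k (Alg.ι R ∘ b) n :=
  (gr_basis b _ n).symm

theorem toTensorAlgebra_tprod_basis {n : ℕ} (p : Fin n → X) :
    TensorPower.toTensorAlgebra (PiTensorProduct.tprod k fun i => b (p i)) =
      wprod (TensorAlgebra.ι k ∘ b) (List.ofFn p) := by
  rw [TensorPower.toTensorAlgebra_tprod, TensorAlgebra.tprod_apply, wprod, List.map_ofFn]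
  rfl

theorem pairingDual_eq_sum [DecidableEq X] (n : ℕ) (t : ⨂[k]^n (Module.Dual k V))
    (ρ : ⨂[k]^n V) :
    TensorPower.pairingDual k V n t ρ = ∑ w ∈ words X n,
      coeff b w (TensorPower.toTensorAlgebra ρ) *
        coeff b.dualBasis w (TensorPower.toTensorAlgebra t) := by
  let F : ⨂[k]^n (Module.Dual k V) →ₗ[k] ⨂[k]^n V →ₗ[k] k := ∑ w ∈ words X n,
    (LinearMap.lsmul k _).flip (coeff b w ∘ₗ TensorPower.toTensorAlgebra) ∘ₗ
      (coeff b.dualBasis w ∘ₗ TensorPower.toTensorAlgebra)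
  have hF : ∀ t ρ, F t ρ = ∑ w ∈ words X n, coeff b w (TensorPower.toTensorAlgebra ρ) *
      coeff b.dualBasis w (TensorPower.toTensorAlgebra t) := by
    intro t ρ
    simp [F, LinearMap.sum_apply, mul_comm]
  rw [← hF]
  have : TensorPower.pairingDual k V n = F := by
    refine PiTensorProduct.ext (Module.Basis.ext_multilinear (fun _ => b.dualBasis) fun p => ?_)
    refine PiTensorProduct.ext (Module.Basis.ext_multilinear (fun _ => b) fun q => ?_)
    simp only [LinearMap.compMultilinearMap_apply]
    rw [hF, TensorPower.pairingDual_tprod_tprod, toTensorAlgebra_tprod_basis,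
      toTensorAlgebra_tprod_basis, Finset.sum_eq_single (List.ofFn q)]
    · rw [coeff_wprod, coeff_wprod, if_pos rfl, one_mul]
      by_cases hpq : p = q
      · subst hpq
        simp
      · rw [if_neg (fun h => hpq (List.ofFn_injective h))]
        obtain ⟨i, hi⟩ := Function.ne_iff.1 hpq
        refine Finset.prod_eq_zero (Finset.mem_univ i) ?_
        rw [Module.Basis.dualBasis_apply_self, if_neg (Ne.symm hi)]
    · intro w _ hw
      rw [coeff_wprod, if_neg hw.symm, zero_mul]
    · intro h; simp at h
  rw [this]

/-- In dual bases the pairing of tensors is the sum over words of the products of coefficients; this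
is the only place where the chosen pairing on tensor powers enters the presentation of the dual
algebra. -/
theorem coordRel_perp [DecidableEq X] (R : Submodule k (⨂[k]^N V)) :
    coordRel b.dualBasis (perp R) = annRel N (coordRel b R) := by
  ext q
  constructor
  · rintro ⟨t, ht, hq⟩ r ⟨ρ, hρ, hr⟩
    have h1 : TensorPower.pairingDual k V N t ρ = 0 := by
      rw [perp, Submodule.mem_comap, Submodule.mem_dualAnnihilator] at ht
      exact ht ρ hρ
    rw [pairingDual_eq_sum b] at h1
    rw [← h1]
    refine Finset.sum_congr rfl fun w hw => ?_
    rw [hq w (mem_words.1 hw), hr w (mem_words.1 hw)]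
  · intro hq
    have key : ∀ w : List X, ∃ t : ⨂[k]^N (Module.Dual k V), w.length = N →
        TensorPower.toTensorAlgebra t = wprod (TensorAlgebra.ι k ∘ b.dualBasis) w := by
      intro w
      by_cases hw : w.length = N
      · subst hw
        exact ⟨_, fun _ => (toTensorAlgebra_tprod_basis b.dualBasis fun i => w[i]).trans
          (congrArg _ List.ofFn_getElem)⟩
      · exact ⟨0, fun h => absurd h hw⟩
    choose T hT using key
    have hc : ∀ w : List X, w.length = N → q w = coeff b.dualBasis w
        (TensorPower.toTensorAlgebra (∑ v ∈ words X N, q v • T v)) := by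
      intro w hw
      rw [map_sum, map_sum, Finset.sum_eq_single w]
      · rw [map_smul, map_smul, hT w hw, coeff_wprod, if_pos rfl, smul_eq_mul, mul_one]
      · intro v hv hvw
        rw [map_smul, map_smul, hT v (mem_words.1 hv), coeff_wprod, if_neg hvw, smul_zero]
      · intro h; simp [hw] at h
    refine ⟨∑ w ∈ words X N, q w • T w, ?_, hc⟩
    rw [perp, Submodule.mem_comap, Submodule.mem_dualAnnihilator]
    intro ρ hρ
    rw [pairingDual_eq_sum b,
      ← hq (fun w => coeff b w (TensorPower.toTensorAlgebra ρ)) ⟨ρ, hρ, fun _ _ => rfl⟩]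
    refine Finset.sum_congr rfl fun w hw => ?_
    rw [hc w (mem_words.1 hw)]

theorem presents_dualAlg [DecidableEq X] (R : Submodule k (⨂[k]^N V)) :
    Presents N (annRel N (coordRel b R)) (Alg.ι (perp R) ∘ b.dualBasis) := by
  rw [← coordRel_perp]
  exact presents_alg b.dualBasis (perp R)

theorem aug_wprod [Fact (2 ≤ N)] (R : Submodule k (⨂[k]^N V)) {w : List X} (hw : w ≠ []) :
    Alg.aug R (wprod (Alg.ι R ∘ b) w) = 0 := by
  obtain ⟨x, l, rfl⟩ := List.exists_cons_of_ne_nil hw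
  have : (Alg.ι R ∘ b) x = Alg.mk R (TensorAlgebra.ι k (b x)) := rfl
  rw [wprod_cons, map_mul, this, Alg.aug, Alg.lift_mk]
  simp [TensorAlgebra.algebraMapInv]

end presentation

/-! ### Graded free resolutions of graded submodules -/

section graded

variable {k V : Type u} [Field k] [AddCommGroup V] [Module k V] {N : ℕ} {X : Type} [Fintype X]
  (b : Module.Basis X k V) (R : Submodule k (⨂[k]^N V))

theorem mem_grade_iff {n : ℕ} {y : Alg R} :
    y ∈ Alg.grade R n ↔ y ∈ grZ k (Alg.ι R ∘ b) n := by
  rw [grade_eq_gr b, grZ_natCast]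

theorem isHomogeneousOfDegree_iff {β : Type u} {deg : β → ℕ} {m : ℕ} {x : β →₀ Alg R} :
    IsHomogeneousOfDegree R deg m x ↔ ∀ c, x c ∈ grZ k (Alg.ι R ∘ b) ((m : ℤ) - deg c) := by
  refine forall_congr' fun c => ?_
  by_cases h : deg c ≤ m
  · rw [← Nat.cast_sub h, ← mem_grade_iff]
    exact ⟨fun h1 => h1.1 h, fun h1 => ⟨fun _ => h1, fun h2 => by omega⟩⟩
  · constructor
    · intro h1
      rw [h1.2 (by omega)]
      exact zero_mem _
    · intro h1
      exact ⟨fun h2 => absurd h2 h, fun _ => eq_zero_of_mem_grZ (by omega) h1⟩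

theorem Presents.proj_of_mem_ne {Rel : Set (List X → k)} {A : Type u} [Ring A] [Algebra k A]
    {a : X → A} (hA : Presents N Rel a) {z z' : ℤ} (h : z ≠ z') {y : A}
    (hy : y ∈ grZ k a z) : hA.proj z' y = 0 := by
  by_cases hz : 0 ≤ z
  · lift z to ℕ using hz
    rw [grZ_natCast] at hy
    induction hy using Submodule.span_induction with
    | mem y hy =>
      obtain ⟨w, hw, rfl⟩ := hy
      simp only [Set.mem_ofPred_eq] at hw
      rw [hA.proj_wprod, if_neg (by rw [hw]; exact h)]
    | zero => simp
    | add y z _ _ hy hz => rw [map_add, hy, hz, add_zero]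
    | smul t y _ hy => rw [map_smul, hy, smul_zero]
  · rw [eq_zero_of_mem_grZ (by omega) hy, map_zero]

/-- The projection of a graded free module onto its component of degree `m`. -/
def freeProj {β : Type u} (deg : β → ℕ) (m : ℤ) : (β →₀ Alg R) →ₗ[k] (β →₀ Alg R) :=
  Finsupp.lsum k fun c => Finsupp.lsingle c ∘ₗ (presents_alg b R).proj (m - deg c)

variable {R}
variable {β β' : Type u} {deg : β → ℕ} {deg' : β' → ℕ}

@[simp]
theorem freeProj_single (m : ℤ) (c : β) (y : Alg R) :
    freeProj b R deg m (Finsupp.single c y) =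
      Finsupp.single c ((presents_alg b R).proj (m - deg c) y) := by
  simp [freeProj]

theorem freeProj_apply (m : ℤ) (x : β →₀ Alg R) (c : β) :
    freeProj b R deg m x c = (presents_alg b R).proj (m - deg c) (x c) := by
  classical
  induction x using Finsupp.induction_linear with
  | zero => simp
  | add x y hx hy => simp [hx, hy]
  | single d y =>
    rw [freeProj_single]
    by_cases h : d = c
    · subst h; simp
    · simp [h]

theorem freeProj_homogeneous (m : ℕ) (x : β →₀ Alg R) :
    IsHomogeneousOfDegree R deg m (freeProj b R deg m x) := by
  rw [isHomogeneousOfDegree_iff b]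
  intro c
  rw [freeProj_apply]
  exact (presents_alg b R).proj_mem _ _

theorem freeProj_of_homogeneous {m : ℕ} {x : β →₀ Alg R} (h : IsHomogeneousOfDegree R deg m x) :
    freeProj b R deg m x = x := by
  rw [isHomogeneousOfDegree_iff b] at h
  ext c
  rw [freeProj_apply]
  exact (presents_alg b R).proj_of_mem (h c)

theorem freeProj_of_homogeneous_ne {m : ℕ} {m' : ℤ} (hm : (m : ℤ) ≠ m') {x : β →₀ Alg R}
    (h : IsHomogeneousOfDegree R deg m x) : freeProj b R deg m' x = 0 := by
  rw [isHomogeneousOfDegree_iff b] at h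
  ext c
  rw [freeProj_apply]
  exact (presents_alg b R).proj_of_mem_ne (by omega) (h c)

theorem freeProj_wprod_smul (m : ℤ) (w : List X) (x : β →₀ Alg R) :
    freeProj b R deg m (wprod (Alg.ι R ∘ b) w • x) =
      wprod (Alg.ι R ∘ b) w • freeProj b R deg (m - w.length) x := by
  ext c
  rw [freeProj_apply, Finsupp.smul_apply, Finsupp.smul_apply, freeProj_apply, smul_eq_mul,
    smul_eq_mul, ← (presents_alg b R).proj_wprod_mul]
  congr 2
  ring

theorem exists_sum_freeProj (x : β →₀ Alg R) :
    ∃ n : ℕ, x = ∑ m ∈ Finset.range n, freeProj b R deg m x := by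
  choose n hn using fun c => (presents_alg b R).exists_sum_proj (x c)
  -- The coefficient at `c` has components of degree less than `n c`, which contribute to total
  -- degrees less than `deg c + n c`.
  refine ⟨x.support.sup fun c => deg c + n c, ?_⟩
  ext c
  rw [Finsupp.finsetSum_apply]
  simp only [freeProj_apply]
  by_cases hc : c ∈ x.support
  · obtain ⟨l, hl⟩ := Nat.exists_eq_add_of_le (Finset.le_sup (f := fun c => deg c + n c) hc)
    rw [hl, add_assoc, Finset.sum_range_add, Finset.sum_eq_zero, zero_add]
    · simp only [Nat.cast_add, add_sub_cancel_left]
      exact (hn c _ (by omega)).symm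
    · intro m hm
      rw [Finset.mem_range] at hm
      exact eq_zero_of_mem_grZ (k := k) (a := Alg.ι R ∘ b) (by omega)
        ((presents_alg b R).proj_mem _ _)
  · rw [Finsupp.notMem_support_iff.1 hc]
    simp

/-- Maps of degree `0` commute with the projections. -/
theorem map_freeProj {d : (β →₀ Alg R) →ₗ[Alg R] (β' →₀ Alg R)}
    (hd : ∀ c, IsHomogeneousOfDegree R deg' (deg c) (d (Finsupp.single c 1))) (m : ℤ)
    (x : β →₀ Alg R) : d (freeProj b R deg m x) = freeProj b R deg' m (d x) := by
  have : d.restrictScalars k ∘ₗ freeProj b R deg m =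
      freeProj b R deg' m ∘ₗ d.restrictScalars k := by
    refine Finsupp.lhom_ext' fun c => (presents_alg b R).ext fun w => ?_
    have hs : ∀ y : Alg R, (Finsupp.single c y : β →₀ Alg R) = y • Finsupp.single c 1 := by simp
    simp only [LinearMap.comp_apply, LinearMap.coe_restrictScalars, Finsupp.lsingle_apply,
      freeProj_single]
    rw [(presents_alg b R).proj_wprod, hs (wprod _ w), map_smul, freeProj_wprod_smul]
    split_ifs with h
    · rw [hs, map_smul]
      rw [show m - w.length = (deg c : ℤ) by omega, freeProj_of_homogeneous b (hd c)]
    · rw [Finsupp.single_zero, map_zero, freeProj_of_homogeneous_ne b (by omega) (hd c), smul_zero]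
  exact LinearMap.congr_fun this x

/-- A submodule which is generated by homogeneous elements. -/
def IsGradedSubmodule (deg : β → ℕ) (Z : Submodule (Alg R) (β →₀ Alg R)) : Prop :=
  ∀ x ∈ Z, ∀ m : ℕ, freeProj b R deg m x ∈ Z

/-- The homogeneous elements of a submodule. -/
def HomElt (deg : β → ℕ) (Z : Submodule (Alg R) (β →₀ Alg R)) : Type u :=
  Σ m : ULift.{u} ℕ, {z : β →₀ Alg R // z ∈ Z ∧ IsHomogeneousOfDegree R deg m.down z}

/-- The free module on the homogeneous elements of `Z` maps to `Z`. -/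
def cover (deg : β → ℕ) (Z : Submodule (Alg R) (β →₀ Alg R)) :
    (HomElt deg Z →₀ Alg R) →ₗ[Alg R] (β →₀ Alg R) :=
  Finsupp.linearCombination (Alg R) fun c => c.2.1

theorem cover_single (deg : β → ℕ) (Z : Submodule (Alg R) (β →₀ Alg R)) (c : HomElt deg Z) :
    cover deg Z (Finsupp.single c 1) = c.2.1 := by
  simp [cover]

theorem cover_homogeneous (deg : β → ℕ) (Z : Submodule (Alg R) (β →₀ Alg R)) (c : HomElt deg Z) :
    IsHomogeneousOfDegree R deg c.1.down (cover deg Z (Finsupp.single c 1)) := by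
  rw [cover_single]; exact c.2.2.2

theorem range_cover {Z : Submodule (Alg R) (β →₀ Alg R)} (hZ : IsGradedSubmodule b deg Z) :
    LinearMap.range (cover deg Z) = Z := by
  apply le_antisymm
  · rw [cover, Finsupp.range_linearCombination, Submodule.span_le]
    rintro _ ⟨c, rfl⟩
    exact c.2.2.1
  · intro x hx
    obtain ⟨n, hn⟩ := exists_sum_freeProj b (deg := deg) x
    rw [hn]
    refine Submodule.sum_mem _ fun m _ => ?_
    exact ⟨Finsupp.single ⟨⟨m⟩, _, hZ x hx m, freeProj_homogeneous b m x⟩ 1, cover_single _ _ _⟩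

theorem isGradedSubmodule_ker {d : (β →₀ Alg R) →ₗ[Alg R] (β' →₀ Alg R)}
    (hd : ∀ c, IsHomogeneousOfDegree R deg' (deg c) (d (Finsupp.single c 1))) :
    IsGradedSubmodule b deg (LinearMap.ker d) := by
  intro x hx m
  rw [LinearMap.mem_ker] at hx ⊢
  rw [map_freeProj b hd, hx, map_zero]

/-- A resolution of a graded submodule of a graded free module by graded free modules. -/
structure Tail (deg₀ : β → ℕ) (Z : Submodule (Alg R) (β →₀ Alg R)) where
  ι : ℕ → Type u
  deg : ∀ i, ι i → ℕ
  d : ∀ i, (ι (i + 1) →₀ Alg R) →ₗ[Alg R] (ι i →₀ Alg R)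
  π : (ι 0 →₀ Alg R) →ₗ[Alg R] (β →₀ Alg R)
  d_homogeneous : ∀ i b,
    IsHomogeneousOfDegree R (deg i) (deg (i + 1) b) (d i (Finsupp.single b 1))
  π_homogeneous : ∀ b, IsHomogeneousOfDegree R deg₀ (deg 0 b) (π (Finsupp.single b 1))
  range_π : LinearMap.range π = Z
  exact_zero : Function.Exact (d 0) π
  exact_succ : ∀ i, Function.Exact (d (i + 1)) (d i)

/-- A graded free module with a graded submodule. -/
structure GradedSub (R : Submodule k (⨂[k]^N V)) where
  β : Type u
  deg : β → ℕ
  Z : Submodule (Alg R) (β →₀ Alg R)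
  graded : IsGradedSubmodule b deg Z

/-- The kernel of the covering of a graded submodule. -/
def GradedSub.next (S : GradedSub b R) : GradedSub b R where
  β := HomElt S.deg S.Z
  deg c := c.1.down
  Z := LinearMap.ker (cover S.deg S.Z)
  graded := isGradedSubmodule_ker b (cover_homogeneous _ _)

/-- The iterated syzygies. -/
def GradedSub.iter (S : GradedSub b R) : ℕ → GradedSub b R
  | 0 => S
  | n + 1 => (S.iter n).next

theorem exact_cover (S : GradedSub b R) :
    Function.Exact (cover (fun c : HomElt S.deg S.Z => c.1.down) (LinearMap.ker (cover S.deg S.Z)))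
      (cover S.deg S.Z) :=
  LinearMap.exact_iff.2
    (range_cover b (isGradedSubmodule_ker b (cover_homogeneous S.deg S.Z))).symm

/-- The resolution of a graded submodule by iterated coverings. -/
def GradedSub.tail (S : GradedSub b R) : Tail S.deg S.Z where
  ι i := (S.iter b (i + 1)).β
  deg i := (S.iter b (i + 1)).deg
  d i := cover (S.iter b (i + 1)).deg (S.iter b (i + 1)).Z
  π := cover S.deg S.Z
  d_homogeneous _ := cover_homogeneous _ _
  π_homogeneous := cover_homogeneous _ _
  range_π := range_cover b S.graded
  exact_zero := exact_cover b S
  exact_succ i := exact_cover b (S.iter b (i + 1))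

end graded

/-! ### Concentration of `Tor` for the successive syzygies -/

section koszulFrom

variable {k V : Type u} [Field k] [AddCommGroup V] [Module k V] {N : ℕ} {X : Type} [Fintype X]
  {R : Submodule k (⨂[k]^N V)} [Fact (2 ≤ N)] {β β' : Type u} {deg : β → ℕ} {deg' : β' → ℕ}

namespace Tail

variable {Z : Submodule (Alg R) (β →₀ Alg R)} (T : Tail deg Z)

/-- The differential of `k ⊗_A T`. -/
def torD (i : ℕ) : (T.ι (i + 1) →₀ k) →ₗ[k] (T.ι i →₀ k) :=
  Finsupp.linearCombination k fun b =>
    Finsupp.mapRange (Alg.aug R) (map_zero _) (T.d i (Finsupp.single b 1))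

/-- The cycles of `k ⊗_A T`. -/
def cycles : (i : ℕ) → Submodule k (T.ι i →₀ k)
  | 0 => ⊤
  | i + 1 => LinearMap.ker (T.torD i)

end Tail

/-- The `Tor` spaces of `Z`, computed by any resolution, are concentrated in one degree, as if `Z`
was the `s`-th syzygy of `k` over a Koszul algebra. -/
def KoszulFrom (s : ℕ) (deg : β → ℕ) (Z : Submodule (Alg R) (β →₀ Alg R)) : Prop :=
  ∀ T : Tail deg Z, ∀ i m, 3 ≤ i + s → m ≠ jump N (i + s) →
    T.cycles i ⊓ Finsupp.supported k k {c | T.deg i c = m} ≤ LinearMap.range (T.torD i)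

/-- The free modules of a resolution with one more term. -/
def consι (β : Type u) (ι : ℕ → Type u) : ℕ → Type u
  | 0 => β
  | i + 1 => ι i

theorem torD_eq_zero_of_aug {ι : Type u} (f : ι → (β →₀ Alg R))
    (h : ∀ c j, Alg.aug R (f c j) = 0) :
    (Finsupp.linearCombination k fun c => Finsupp.mapRange (Alg.aug R) (map_zero _) (f c)) = 0 := by
  ext c j
  simp [h]

/-- A resolution of the kernel of `φ` gives a resolution of its image. -/
def Tail.cons {Z : Submodule (Alg R) (β →₀ Alg R)} (T : Tail deg Z)
    {Z' : Submodule (Alg R) (β' →₀ Alg R)} (φ : (β →₀ Alg R) →ₗ[Alg R] (β' →₀ Alg R))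
    (hφ : ∀ c, IsHomogeneousOfDegree R deg' (deg c) (φ (Finsupp.single c 1)))
    (hker : LinearMap.ker φ = Z) (hrange : LinearMap.range φ = Z') : Tail deg' Z' where
  ι := consι β T.ι
  deg
    | 0 => deg
    | i + 1 => T.deg i
  d
    | 0 => T.π
    | i + 1 => T.d i
  π := φ
  d_homogeneous
    | 0 => T.π_homogeneous
    | i + 1 => T.d_homogeneous i
  π_homogeneous := hφ
  range_π := hrange
  exact_zero := LinearMap.exact_iff.2 (hker.trans T.range_π.symm)
  exact_succ
    | 0 => T.exact_zero
    | i + 1 => T.exact_succ i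

/-- Dimension shifting. Splicing a resolution of `Z = ker φ` with `φ` resolves the image of `φ`. The
new differential vanishes after tensoring with `k`, because `hZ` puts `Z` in the multiple of the
free module by the augmentation ideal, so nothing is lost in the lowest homological degree. -/
theorem KoszulFrom.succ {s : ℕ} {Z : Submodule (Alg R) (β →₀ Alg R)}
    {Z' : Submodule (Alg R) (β' →₀ Alg R)} (h : KoszulFrom s deg' Z')
    (φ : (β →₀ Alg R) →ₗ[Alg R] (β' →₀ Alg R))
    (hφ : ∀ c, IsHomogeneousOfDegree R deg' (deg c) (φ (Finsupp.single c 1)))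
    (hker : LinearMap.ker φ = Z) (hrange : LinearMap.range φ = Z')
    (hZ : ∀ z ∈ Z, ∀ j, Alg.aug R (z j) = 0) : KoszulFrom (s + 1) deg Z := by
  intro T i m hi hm
  have h1 := h (T.cons φ hφ hker hrange) (i + 1) m (by omega)
    (by rwa [show i + 1 + s = i + (s + 1) by omega])
  rintro x ⟨hx, hx'⟩
  refine h1 ⟨?_, hx'⟩
  rcases i with _ | i
  · have : (T.cons φ hφ hker hrange).torD 0 = 0 :=
      torD_eq_zero_of_aug (fun c => T.π (Finsupp.single c 1)) fun c j =>
        hZ _ (T.range_π.le ⟨_, rfl⟩) j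
    change x ∈ LinearMap.ker ((T.cons φ hφ hker hrange).torD 0)
    rw [this, LinearMap.ker_zero]
    trivial
  · exact hx

/-- A resolution of the kernel of the augmentation gives a resolution of `k`. -/
def Tail.toResolution {Z : Submodule (Alg R) (β →₀ Alg R)} (T : Tail deg Z)
    (φ : (β →₀ Alg R) →ₗ[Alg R] TrivialModule R)
    (hφ : ∀ c, deg c ≠ 0 → φ (Finsupp.single c 1) = 0)
    (hker : LinearMap.ker φ = Z) (hsurj : Function.Surjective φ) : GradedFreeResolution R where
  ι := consι β T.ι
  deg
    | 0 => deg
    | i + 1 => T.deg i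
  d
    | 0 => T.π
    | i + 1 => T.d i
  augmentation := φ
  d_homogeneous
    | 0 => T.π_homogeneous
    | i + 1 => T.d_homogeneous i
  augmentation_homogeneous := hφ
  augmentation_surjective := hsurj
  exact_zero := LinearMap.exact_iff.2 (hker.trans T.range_π.symm)
  exact_succ
    | 0 => T.exact_zero
    | i + 1 => T.exact_succ i

theorem IsKoszul.koszulFrom_one (h : IsKoszul R) {Z : Submodule (Alg R) (β →₀ Alg R)}
    (φ : (β →₀ Alg R) →ₗ[Alg R] TrivialModule R)
    (hφ : ∀ c, deg c ≠ 0 → φ (Finsupp.single c 1) = 0)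
    (hker : LinearMap.ker φ = Z) (hsurj : Function.Surjective φ) : KoszulFrom 1 deg Z := by
  intro T i m hi hm
  have h1 := h (T.toResolution φ hφ hker hsurj) (i + 1) (by omega) m hm
  rintro x ⟨hx, hx'⟩
  rcases i with _ | i
  · omega
  · exact (Submodule.Quotient.mk_eq_zero _).1 ((Submodule.mem_bot k).1
      (h1.le (Submodule.mem_map_of_mem ⟨hx, hx'⟩)))

end koszulFrom

/-! ### Nakayama's lemma for syzygies -/

section generated

variable {k V : Type u} [Field k] [AddCommGroup V] [Module k V] {N : ℕ} {X : Type} [Fintype X]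
  (b : Module.Basis X k V) {R : Submodule k (⨂[k]^N V)} [Fact (2 ≤ N)] {β : Type u} {deg : β → ℕ}

theorem mem_span_of_aug_eq_zero {y : Alg R} (h : Alg.aug R y = 0) :
    y ∈ Submodule.span k (wprod (Alg.ι R ∘ b) '' {w : List X | w ≠ []}) := by
  have key : ∀ y : Alg R, y - algebraMap k _ (Alg.aug R y) ∈
      Submodule.span k (wprod (Alg.ι R ∘ b) '' {w : List X | w ≠ []}) := by
    refine (presents_alg b R).apply_mem (S := Submodule.span k _) (φ := LinearMap.id -
      Algebra.linearMap k _ ∘ₗ (Alg.aug R).toLinearMap) fun w => ?_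
    simp only [LinearMap.sub_apply, LinearMap.id_apply, LinearMap.comp_apply,
      AlgHom.toLinearMap_apply, Algebra.linearMap_apply]
    by_cases hw : w = []
    · subst hw; simp
    · rw [aug_wprod b R hw, map_zero, sub_zero]
      exact Submodule.subset_span ⟨w, hw, rfl⟩
  have := key y
  rwa [h, map_zero, sub_zero] at this

theorem Tail.exists_smul {Z : Submodule (Alg R) (β →₀ Alg R)} (T : Tail deg Z) (c : T.ι 0)
    (h : Finsupp.single c 1 ∈ LinearMap.range (T.torD 0)) :
    ∃ y : T.ι 0 →₀ Alg R, (∀ j, Alg.aug R (y j) = 0) ∧ T.π y = T.π (Finsupp.single c 1) := by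
  classical
  obtain ⟨v, hv⟩ := h
  let v' : T.ι 1 →₀ Alg R := Finsupp.mapRange (algebraMap k (Alg R)) (map_zero _) v
  have haug : ∀ (v : T.ι 1 →₀ k) (j : T.ι 0), Alg.aug R (T.d 0 (Finsupp.mapRange
      (algebraMap k (Alg R)) (map_zero _) v) j) = T.torD 0 v j := by
    intro v j
    induction v using Finsupp.induction_linear with
    | zero => simp
    | add x y hx hy =>
      rw [Finsupp.mapRange_add (by simp), map_add, map_add, Finsupp.add_apply, map_add, hx, hy,
        Finsupp.add_apply]
    | single i t =>
      rw [Finsupp.mapRange_single, ← mul_one (algebraMap k (Alg R) t), ← smul_eq_mul,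
        ← Finsupp.smul_single, map_smul, Finsupp.smul_apply, smul_eq_mul, map_mul,
        AlgHom.commutes]
      simp [Tail.torD]
  -- Subtracting a boundary does not affect the image under `T.π`, and `v'` lifts `v`, so the
  -- constant terms of the difference cancel.
  refine ⟨Finsupp.single c 1 - T.d 0 v', fun j => ?_, ?_⟩
  · rw [Finsupp.sub_apply, map_sub, haug, hv, Finsupp.single_apply, Finsupp.single_apply]
    split_ifs <;> simp
  · have h1 : T.π (T.d 0 v') = 0 := T.exact_zero.apply_apply_eq_zero _
    rw [map_sub, h1, sub_zero]

theorem KoszulFrom.exists_smul {s : ℕ} (hs : 3 ≤ s) {Z : Submodule (Alg R) (β →₀ Alg R)}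
    (h : KoszulFrom s deg Z) (hZ : IsGradedSubmodule b deg Z) (c : HomElt deg Z)
    (hm : c.1.down ≠ jump N s) :
    ∃ y : HomElt deg Z →₀ Alg R, (∀ j, Alg.aug R (y j) = 0) ∧ cover deg Z y = c.2.1 := by
  -- In this tautological resolution every homogeneous element of `Z` is the image of a basis
  -- vector, so the `Tor` condition can be applied to it directly.
  let T : Tail deg Z := GradedSub.tail b ⟨β, deg, Z, hZ⟩
  obtain ⟨y, h1, h2⟩ := T.exists_smul c (h T 0 c.1.down (by omega) (by rwa [zero_add])
    ⟨trivial, Finsupp.single_mem_supported k _ rfl⟩)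
  exact ⟨y, h1, h2.trans (cover_single _ _ _)⟩

/-- Nakayama's lemma: over a Koszul algebra, the syzygies are generated in one degree. -/
theorem KoszulFrom.le_of_homogeneous {s : ℕ} (hs : 3 ≤ s) {Z I : Submodule (Alg R) (β →₀ Alg R)}
    (h : KoszulFrom s deg Z) (hZ : IsGradedSubmodule b deg Z)
    (hI : ∀ z ∈ Z, IsHomogeneousOfDegree R deg (jump N s) z → z ∈ I) : Z ≤ I := by
  have key : ∀ m : ℕ, ∀ z ∈ Z, IsHomogeneousOfDegree R deg m z → z ∈ I := by
    intro m
    induction m using Nat.strong_induction_on with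
    | _ m ih =>
    intro z hz hzm
    by_cases hm : m = jump N s
    · exact hI z hz (hm ▸ hzm)
    obtain ⟨y, hy, e⟩ := h.exists_smul b hs hZ ⟨⟨m⟩, z, hz, hzm⟩ hm
    change cover deg Z y = z at e
    -- After projection to degree `m`, each surviving term is a nonempty word times a homogeneous
    -- element of `Z` of degree less than `m`.
    rw [← freeProj_of_homogeneous b hzm, ← e, cover, Finsupp.linearCombination_apply,
      Finsupp.sum, map_sum]
    refine Submodule.sum_mem _ fun c _ => ?_
    have h1 := mem_span_of_aug_eq_zero b (hy c)
    generalize y c = t at h1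
    induction h1 using Submodule.span_induction with
    | mem t ht =>
      obtain ⟨w, hw, rfl⟩ := ht
      rw [freeProj_wprod_smul]
      by_cases hc : (c.1.down : ℤ) = m - w.length
      · have hw' : 0 < w.length := List.length_pos_iff.2 hw
        rw [← hc, freeProj_of_homogeneous b c.2.2.2]
        exact Submodule.smul_mem _ _ (ih _ (by omega) _ c.2.2.1 c.2.2.2)
      · rw [freeProj_of_homogeneous_ne b hc c.2.2.2, smul_zero]
        exact zero_mem _
    | zero => rw [zero_smul, map_zero]; exact zero_mem _
    | add t t' _ _ ht ht' => rw [add_smul, map_add]; exact add_mem ht ht'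
    | smul r t _ ht =>
      rw [smul_assoc, map_smul, ← algebraMap_smul (Alg R) r]
      exact Submodule.smul_mem _ _ ht
  intro x hx
  obtain ⟨n, hn⟩ := exists_sum_freeProj b (deg := deg) x
  rw [hn]
  exact Submodule.sum_mem _ fun m _ => key m _ (hZ x hx m) (freeProj_homogeneous b m x)

end generated

/-! ### The Koszul complex as a complex of graded free modules -/

section coordinates

variable {k : Type u} [Field k] {X : Type} [Fintype X] {N : ℕ} {Rel : Set (List X → k)}
  {A : Type u} [Ring A] [Algebra k A]
  {B : Type u} [Ring B] [Algebra k B] {s : X → B}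

/-- The index set of a basis of the component of degree `n`. -/
abbrev GrIndex (k : Type u) [Field k] {B : Type u} [Ring B] [Algebra k B] (s : X → B) (n : ℕ) :
    Type u :=
  Module.Basis.ofVectorSpaceIndex k (gr k s n)

/-- A basis of the component of degree `n`. -/
def grBasis (k : Type u) [Field k] {B : Type u} [Ring B] [Algebra k B] (s : X → B) (n : ℕ) :
    Module.Basis (GrIndex k s n) k (gr k s n) :=
  Module.Basis.ofVectorSpace k (gr k s n)

instance (n : ℕ) : Finite (GrIndex k s n) :=
  have := gr_finite (k := k) (a := s) n
  Module.Finite.finite_basis (grBasis k s n)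

/-- The coordinates of a map supported in degree `n`. -/
def suppCoord (k : Type u) [Field k] (A : Type u) [Ring A] [Algebra k A] {B : Type u} [Ring B]
    [Algebra k B] (s : X → B) (n : ℕ) : supp (A := A) k s n →ₗ[A] (GrIndex k s n →₀ A) :=
  (Finsupp.linearEquivFunOnFinite A A (GrIndex k s n)).symm.toLinearMap ∘ₗ
    { toFun φ j := φ.1 (grBasis k s n j)
      map_add' φ ψ := by ext; simp
      map_smul' c φ := by ext; simp }

theorem suppCoord_apply (n : ℕ) (φ : supp (A := A) k s n) (j : GrIndex k s n) :
    suppCoord k A s n φ j = φ.1 (grBasis k s n j) := rfl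

theorem apply_mem_of_suppCoord (n : ℕ) {φ : supp (A := A) k s n} {S : Submodule k A}
    (h : ∀ j, suppCoord k A s n φ j ∈ S) (w : List X) : φ.1 (wprod s w) ∈ S := by
  by_cases hw : w.length = n
  · have := Fintype.ofFinite (GrIndex k s n)
    have h1 := (grBasis k s n).sum_repr ⟨_, wprod_mem_gr' (a := s) (k := k) hw⟩
    rw [← show _ = wprod s w from congrArg Subtype.val h1, AddSubmonoidClass.coe_finsetSum, map_sum]
    refine Submodule.sum_mem _ fun j _ => ?_
    rw [Submodule.coe_smul, map_smul]
    exact S.smul_mem _ (h j)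
  · rw [φ.2 w hw]; exact S.zero_mem

theorem suppCoord_bijective (hB : Presents N Rel s) (n : ℕ) :
    Function.Bijective (suppCoord k A s n) := by
  constructor
  · rw [injective_iff_map_eq_zero]
    intro φ hφ
    refine Subtype.ext (hB.ext fun w => ?_)
    simpa using apply_mem_of_suppCoord n (S := ⊥) (fun j => by simp [hφ]) w
  · intro x
    have := Fintype.ofFinite (GrIndex k s n)
    let P : B →ₗ[k] gr k s n := (hB.proj n).codRestrict _ fun f => by
      rw [← grZ_natCast]; exact hB.proj_mem _ _
    have hP : ∀ y : gr k s n, P y = y := fun y =>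
      Subtype.ext (hB.proj_of_mem (z := n) (by rw [grZ_natCast]; exact y.2))
    refine ⟨⟨∑ j, ((grBasis k s n).coord j ∘ₗ P).smulRight (x j), fun w hw => ?_⟩, ?_⟩
    · have : P (wprod s w) = 0 := Subtype.ext (by
        change hB.proj n _ = 0
        rw [hB.proj_wprod, if_neg (by exact_mod_cast hw)])
      simp [LinearMap.sum_apply, this]
    · classical
      ext j
      rw [suppCoord_apply]
      simp [LinearMap.sum_apply, hP, Finsupp.single_apply]

/-- The module of maps supported in degree `n` is free. -/
def suppEquiv (hB : Presents N Rel s) (A : Type u) [Ring A] [Algebra k A] (n : ℕ) :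
    supp (A := A) k s n ≃ₗ[A] (GrIndex k s n →₀ A) :=
  LinearEquiv.ofBijective (suppCoord k A s n) (suppCoord_bijective hB n)

theorem suppEquiv_apply (hB : Presents N Rel s) (n : ℕ) (φ : supp (A := A) k s n)
    (j : GrIndex k s n) : suppEquiv hB A n φ j = φ.1 (grBasis k s n j) := rfl

variable {a : X → A}

theorem mem_homog_iff (hB : Presents N Rel s) {n : ℕ} {m : ℤ} {φ : supp (A := A) k s n} :
    φ.1 ∈ homog s n (grZ k a) m ↔ ∀ j, suppEquiv hB A n φ j ∈ grZ k a (m - n) := by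
  constructor
  · intro h j
    rw [suppEquiv_apply]
    refine hB.apply_mem (φ := φ.1) (S := grZ k a (m - n)) (fun w => ?_) _
    by_cases hw : w.length = n
    · exact (h w).1 hw
    · rw [(h w).2 hw]; exact zero_mem _
  · intro h w
    exact ⟨fun _ => apply_mem_of_suppCoord n h w, fun hw => φ.2 w hw⟩

/-- The differential of the Koszul complex. -/
def koszulMap (hN : 2 ≤ N) (a : X → A) (s : X → B) (i : ℕ) :
    supp (A := A) k s (jump N (i + 1)) →ₗ[A] supp (A := A) k s (jump N i) :=
  (koszulD a s (step N i)).restrict fun φ hφ => koszulD_mem_supp (by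
    rwa [add_comm, ← jump_succ hN])

theorem koszulMap_coe (hN : 2 ≤ N) (i : ℕ) (φ : supp (A := A) k s (jump N (i + 1))) :
    (koszulMap hN a s i φ).1 = koszulD a s (step N i) φ.1 := rfl

/-- The differential of the Koszul complex, in coordinates. -/
def koszulMatrix (hN : 2 ≤ N) (hB : Presents N Rel s) (a : X → A) (i : ℕ) :
    (GrIndex k s (jump N (i + 1)) →₀ A) →ₗ[A] (GrIndex k s (jump N i) →₀ A) :=
  (suppEquiv hB A _).toLinearMap ∘ₗ koszulMap hN a s i ∘ₗ (suppEquiv hB A _).symm.toLinearMap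

theorem koszulMatrix_apply (hN : 2 ≤ N) (hB : Presents N Rel s) (i : ℕ)
    (φ : supp (A := A) k s (jump N (i + 1))) :
    koszulMatrix hN hB a i (suppEquiv hB A _ φ) = suppEquiv hB A _ (koszulMap hN a s i φ) := by
  simp [koszulMatrix]

/-- The cycles of positive degree have coefficients of positive degree. -/
theorem proj_zero_comp_eq_zero (hN : 2 ≤ N) (hA : Presents N Rel a)
    (hB : Presents N (annRel N Rel) s) {i : ℕ} {φ : B →ₗ[k] A}
    (hφ : φ ∈ supp (A := A) k s (jump N (i + 1))) (hD : koszulD a s (step N i) φ = 0) :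
    hA.proj 0 ∘ₗ φ = 0 := by
  have h1 := exists_scal (by omega) hA hB (φ := hA.proj 0 ∘ₗ φ) fun w => by
    have := hA.proj_mem 0 (φ (wprod s w))
    rwa [← Nat.cast_zero, grZ_natCast] at this
  rw [h1, eq_zero_of_koszulD_scal (a := a) (χ := hA.coord [] ∘ₗ hA.proj 0 ∘ₗ φ) hA hB
    (step_lt hN i)]
  · ext; simp
  · intro w hw
    rw [LinearMap.comp_apply, LinearMap.comp_apply, hφ w, map_zero, map_zero]
    rw [jump_succ hN]
    omega
  · rw [← h1, koszulD_proj_comp, hD, LinearMap.comp_zero]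

end coordinates

/-! ### The Koszul complex of a Koszul algebra is exact -/

section koszul

variable {k V : Type u} [Field k] [AddCommGroup V] [Module k V] {N : ℕ} {X : Type} [Fintype X]
  [DecidableEq X] (b : Module.Basis X k V) {R : Submodule k (⨂[k]^N V)} [hN : Fact (2 ≤ N)]

theorem aug_proj_zero (y : Alg R) : Alg.aug R ((presents_alg b R).proj 0 y) = Alg.aug R y := by
  refine LinearMap.congr_fun ((presents_alg b R).ext (φ := (Alg.aug R).toLinearMap ∘ₗ
    (presents_alg b R).proj 0) (ψ := (Alg.aug R).toLinearMap) fun w => ?_) y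
  rw [LinearMap.comp_apply, (presents_alg b R).proj_wprod]
  split_ifs with h
  · rfl
  · rw [map_zero, AlgHom.toLinearMap_apply, aug_wprod b R]
    rintro rfl
    simp at h

variable (R) in
/-- The augmentation of the Koszul complex. -/
def koszulAug {s : X → DualAlg R} : supp (A := Alg R) k s (jump N 0) →ₗ[Alg R] TrivialModule R where
  toFun φ := Alg.aug R (φ.1 1)
  map_add' _ _ := map_add (Alg.aug R) _ _
  map_smul' _ _ := map_mul (Alg.aug R) _ _

theorem koszulAug_eq_zero_iff {s : X → DualAlg R} {φ : supp (A := Alg R) k s (jump N 0)} :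
    koszulAug R φ = 0 ↔ Alg.aug R (φ.1 1) = 0 := Iff.rfl

theorem koszulAug_surjective :
    Function.Surjective (koszulAug R (s := Alg.ι (perp R) ∘ b.dualBasis)) := by
  intro (t : k)
  have h0 : (0 : ℕ) < N := by have := hN.out; omega
  refine ⟨⟨scal (Alg R) (t • (presents_dualAlg b R).coord []), fun w hw => ?_⟩, ?_⟩
  · rw [scal_apply, LinearMap.smul_apply, (presents_dualAlg b R).coord_wprod (by simpa using h0),
      if_neg, smul_zero, map_zero]
    rintro rfl
    simp at hw
  · change Alg.aug R (scal (Alg R) (t • (presents_dualAlg b R).coord []) 1) = t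
    rw [← wprod_nil (Alg.ι (perp R) ∘ b.dualBasis), scal_apply, LinearMap.smul_apply,
      (presents_dualAlg b R).coord_wprod (by simpa using h0), if_pos rfl, AlgHom.commutes]
    exact mul_one t

theorem range_koszulMap_zero : LinearMap.range
    (koszulMap hN.out (Alg.ι R ∘ b) (Alg.ι (perp R) ∘ b.dualBasis) 0) =
      LinearMap.ker (koszulAug R) := by
  ext φ
  rw [LinearMap.mem_ker, koszulAug_eq_zero_iff]
  constructor
  · rintro ⟨ψ, rfl⟩
    rw [koszulMap_coe, koszulD_apply, map_sum]
    refine Finset.sum_eq_zero fun w hw => ?_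
    rw [map_mul, aug_wprod b R, mul_zero]
    rintro rfl
    simp [mem_words, step] at hw
  · intro h
    obtain ⟨φ, hφ⟩ := φ
    have h0 : jump N 0 = 0 := by simp [jump]
    rw [h0] at hφ
    have h1 : jump N 1 = 1 := by simp [jump]
    obtain ⟨ψ, h2, h3⟩ := exists_koszulD_one hN.out (presents_dualAlg b R) hφ
      (mem_span_of_aug_eq_zero b h)
    exact ⟨⟨ψ, by rwa [zero_add, h1]⟩, Subtype.ext (by simpa [koszulMap_coe, step] using h3)⟩

theorem koszulMatrix_homogeneous (i : ℕ) (c) :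
    IsHomogeneousOfDegree R (fun _ => jump N i) (jump N (i + 1))
      (koszulMatrix hN.out (presents_dualAlg b R) (Alg.ι R ∘ b) i (Finsupp.single c 1)) := by
  rw [isHomogeneousOfDegree_iff b]
  obtain ⟨φ, hφ⟩ := (suppEquiv (presents_dualAlg b R) (Alg R) (jump N (i + 1))).surjective
    (Finsupp.single c 1)
  rw [← hφ, koszulMatrix_apply, ← mem_homog_iff (presents_dualAlg b R), koszulMap_coe]
  refine koszulD_mem_homog ?_
  rw [← jump_succ hN.out, mem_homog_iff (presents_dualAlg b R), hφ]
  intro j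
  classical
  rw [Finsupp.single_apply, sub_self]
  split_ifs
  · exact wprod_mem_grZ (k := k) (a := Alg.ι R ∘ b) []
  · exact zero_mem _

variable (R) in
/-- Exactness of the Koszul complex in one degree. -/
def ExactAt (i : ℕ) : Prop :=
  ∀ φ ∈ supp (A := Alg R) k (Alg.ι (perp R) ∘ b.dualBasis) (jump N (i + 1)),
    koszulD (Alg.ι R ∘ b) (Alg.ι (perp R) ∘ b.dualBasis) (step N i) φ = 0 →
    ∃ ψ ∈ supp (A := Alg R) k (Alg.ι (perp R) ∘ b.dualBasis) (jump N (i + 2)),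
      koszulD (Alg.ι R ∘ b) (Alg.ι (perp R) ∘ b.dualBasis) (step N (i + 1)) ψ = φ

theorem koszulMatrix_eq_zero_iff {i : ℕ}
    {φ : supp (A := Alg R) k (Alg.ι (perp R) ∘ b.dualBasis) (jump N (i + 1))} :
    koszulMatrix hN.out (presents_dualAlg b R) (Alg.ι R ∘ b) i
      (suppEquiv (presents_dualAlg b R) _ _ φ) = 0 ↔
      koszulD (Alg.ι R ∘ b) (Alg.ι (perp R) ∘ b.dualBasis) (step N i) φ.1 = 0 := by
  rw [koszulMatrix_apply, LinearEquiv.map_eq_zero_iff, ← koszulMap_coe hN.out]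
  exact Subtype.ext_iff

/-- Minimality of the Koszul complex, in the form required by `KoszulFrom.succ`. -/
theorem aug_eq_zero_of_koszulMatrix {i : ℕ} (z) (hz : z ∈ LinearMap.ker
    (koszulMatrix hN.out (presents_dualAlg b R) (Alg.ι R ∘ b) i)) (j) :
    Alg.aug R (z j) = 0 := by
  obtain ⟨φ, rfl⟩ := (suppEquiv (presents_dualAlg b R) (Alg R) (jump N (i + 1))).surjective z
  rw [LinearMap.mem_ker, koszulMatrix_eq_zero_iff] at hz
  have := proj_zero_comp_eq_zero hN.out (presents_alg b R) (presents_dualAlg b R) φ.2 hz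
  rw [suppEquiv_apply, ← aug_proj_zero b]
  have h1 := LinearMap.congr_fun this (grBasis k (Alg.ι (perp R) ∘ b.dualBasis) _ j : DualAlg R)
  rw [LinearMap.comp_apply] at h1
  rw [h1]
  exact map_zero _

/-- As long as the Koszul complex is exact below, its kernel is the syzygy of order `i + 2` of `k`:
each dimension shift uses exactness one step earlier, and the two initial shifts come from the
augmentation and from exactness at `K_0`. -/
theorem IsKoszul.koszulFrom (hK : IsKoszul R) (i : ℕ) (h : ∀ j < i, ExactAt b R j) :
    KoszulFrom (i + 2) (fun _ => jump N (i + 1)) (LinearMap.ker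
      (koszulMatrix hN.out (presents_dualAlg b R) (Alg.ι R ∘ b) i)) := by
  induction i with
  | zero =>
    have h1 := hK.koszulFrom_one (β := GrIndex k (Alg.ι (perp R) ∘ b.dualBasis) (jump N 0))
      (deg := fun _ => jump N 0)
      (koszulAug R ∘ₗ (suppEquiv (presents_dualAlg b R) (Alg R) _).symm.toLinearMap)
      (fun c hc => absurd (by simp [jump]) hc) rfl
      ((koszulAug_surjective b).comp (LinearEquiv.surjective _))
    refine h1.succ _ (koszulMatrix_homogeneous b 0) rfl ?_ (aug_eq_zero_of_koszulMatrix b)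
    rw [koszulMatrix, LinearMap.range_comp, LinearMap.range_comp, LinearEquiv.range,
      Submodule.map_top, range_koszulMap_zero, LinearMap.ker_comp]
    exact Submodule.map_equiv_eq_comap_symm _ _
  | succ i ih =>
    refine (ih fun j hj => h j (by omega)).succ _ (koszulMatrix_homogeneous b (i + 1)) rfl ?_
      (aug_eq_zero_of_koszulMatrix b)
    ext z
    obtain ⟨φ, rfl⟩ := (suppEquiv (presents_dualAlg b R) (Alg R) (jump N (i + 1))).surjective z
    rw [LinearMap.mem_ker, koszulMatrix_eq_zero_iff]
    constructor
    · rintro ⟨y, hy⟩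
      obtain ⟨ψ, rfl⟩ :=
        (suppEquiv (presents_dualAlg b R) (Alg R) (jump N (i + 1 + 1))).surjective y
      rw [koszulMatrix_apply] at hy
      rw [← (LinearEquiv.injective _ hy), koszulMap_coe, koszulD_koszulD, add_comm,
        step_add_step hN.out]
      exact koszulD_eq_zero (presents_alg b R) (presents_dualAlg b R) _
    · intro hφ
      obtain ⟨ψ, h1, h2⟩ := h i (by omega) φ.1 φ.2 hφ
      exact ⟨suppEquiv (presents_dualAlg b R) _ _ ⟨ψ, h1⟩, by
        rw [koszulMatrix_apply]
        exact congrArg _ (Subtype.ext h2)⟩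

/-- By Nakayama it suffices to treat cycles of degree `n(i+2)`, which come from linear forms. The
assumption `i ≠ 0` makes the order `i + 2` of the syzygy at least `3`, where the `Tor` condition
begins. -/
theorem IsKoszul.exactAt_of (hK : IsKoszul R) {i : ℕ} (hi : i ≠ 0) (h : ∀ j < i, ExactAt b R j)
    (hEC : step N (i + 1) = 1 ∨ ExtraCondition N (annRel N (coordRel b R))) :
    ExactAt b R i := by
  intro φ hφ hD
  have key := (hK.koszulFrom b i h).le_of_homogeneous b (by omega)
    (I := LinearMap.range (koszulMatrix hN.out (presents_dualAlg b R) (Alg.ι R ∘ b) (i + 1)))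
    (isGradedSubmodule_ker b (koszulMatrix_homogeneous b i)) (fun z hz hm => by
      obtain ⟨φ, rfl⟩ := (suppEquiv (presents_dualAlg b R) (Alg R) (jump N (i + 1))).surjective z
      rw [LinearMap.mem_ker, koszulMatrix_eq_zero_iff] at hz
      rw [isHomogeneousOfDegree_iff b, ← mem_homog_iff, jump_succ hN.out (i + 1)] at hm
      obtain ⟨χ, h1, h2⟩ := exists_scal_of_koszulD_eq_zero (presents_alg b R)
        (presents_dualAlg b R) (step_add_step hN.out i) (step_pos hN.out i) (by
          rcases hEC with h | h
          · exact Or.inl h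
          · rcases step_cases hN.out i with h' | h' | h'
            exacts [Or.inl h', Or.inr (Or.inl h'), Or.inr (Or.inr ⟨h', h⟩)])
        φ.2 (homog_natCast_eq _ _ hm) hz
      refine ⟨suppEquiv (presents_dualAlg b R) _ _ ⟨scal (Alg R) χ, fun w hw => ?_⟩, ?_⟩
      · rw [scal_apply, h1 w (by rwa [← jump_succ hN.out (i + 1)]), map_zero]
      · rw [koszulMatrix_apply]
        exact congrArg _ (Subtype.ext h2))
  obtain ⟨y, hy⟩ := key (x := suppEquiv (presents_dualAlg b R) (Alg R) _ ⟨φ, hφ⟩) (by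
    rwa [LinearMap.mem_ker, koszulMatrix_eq_zero_iff])
  obtain ⟨ψ, rfl⟩ := (suppEquiv (presents_dualAlg b R) (Alg R) (jump N (i + 1 + 1))).surjective y
  rw [koszulMatrix_apply] at hy
  exact ⟨ψ.1, ψ.2, congrArg Subtype.val (LinearEquiv.injective _ hy)⟩

/-- The Koszul complex of a Koszul algebra is exact. -/
theorem IsKoszul.koszulExact (hK : IsKoszul R) :
    KoszulExact (k := k) N (Alg.ι R ∘ b) (Alg.ι (perp R) ∘ b.dualBasis) := by
  -- Exactness at `K_1` uses only the presentation of `A`. Exactness at `K_2` needs no extra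
  -- condition because the incoming step has length `1`, and it yields the extra condition for all
  -- later degrees.
  have e0 : ExactAt b R 0 := by
    intro φ hφ hD
    obtain ⟨ψ, h1, h2⟩ := exists_koszulD_pred hN.out (presents_alg b R) (presents_dualAlg b R)
      (by simpa [jump] using hφ) (by simpa [step] using hD)
    exact ⟨ψ, by simpa [jump] using h1, by simpa [step] using h2⟩
  have e1 : ExactAt b R 1 :=
    hK.exactAt_of b one_ne_zero (fun j hj => by rwa [Nat.lt_one_iff.1 hj]) (Or.inl (by simp [step]))
  have hEC := extraCondition_of_exact (presents_alg b R) (presents_dualAlg b R) (by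
    intro φ hφ hD
    obtain ⟨ψ, h1, h2⟩ := e1 φ (by simpa [jump] using hφ) (by simpa [step] using hD)
    refine ⟨ψ, ?_, by simpa [step] using h2⟩
    have : jump N (1 + 2) = N + 1 := by simp [jump]
    rwa [this] at h1)
  intro i
  induction i using Nat.strong_induction_on with
  | _ i ih =>
  rcases Nat.eq_zero_or_pos i with rfl | hi
  · exact e0
  · exact hK.exactAt_of b hi.ne' ih (Or.inr hEC)

end koszul

/-! ### `Ext` and free resolutions -/

section ext

open CategoryTheory CategoryTheory.Limits

variable {C : Type*} [Category C] [Abelian C] [HasExt.{u} C] {Z Y : C}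

theorem extMk_eq_zero_iff_of_zero (P : ProjectiveResolution Z) (f : P.complex.X 0 ⟶ Y)
    (hf : P.complex.d 1 0 ≫ f = 0) : P.extMk f 1 rfl hf = 0 ↔ f = 0 := by
  constructor
  · intro h
    simp only [← P.extEquivCohomologyClass.apply_eq_iff_eq,
      ProjectiveResolution.extEquivCohomologyClass_extMk,
      ProjectiveResolution.extEquivCohomologyClass_zero,
      CochainComplex.HomComplex.CohomologyClass.mk_eq_zero_iff] at h
    rw [CochainComplex.HomComplex.Cocycle.toSingleMk_mem_coboundaries_iff _ _ _ _ _ 1 (by simp)]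
      at h
    obtain ⟨g, hg⟩ := h
    have hz : IsZero (P.cochainComplex.X 1) := P.cochainComplex.isZero_of_isStrictlyLE 0 1 (by simp)
    rw [hz.eq_of_src g 0, comp_zero] at hg
    exact ((cancel_epi _).1 (hg.symm.trans comp_zero.symm))
  · rintro rfl
    simp

end ext

/-! ### `Ext` from a resolution by modules and linear maps -/

section resolution

open CategoryTheory

variable {A : Type u} [Ring A] {F : ℕ → Type u} [∀ i, AddCommGroup (F i)] [∀ i, Module A (F i)]
  [∀ i, Module.Projective A (F i)] {M : Type u} [AddCommGroup M] [Module A M]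
  {d : ∀ i, F (i + 1) →ₗ[A] F i} {ε : F 0 →ₗ[A] M}

/-- The complex of modules with differential `d`. -/
abbrev moduleComplex (d : ∀ i, F (i + 1) →ₗ[A] F i) (hd : ∀ i, d i ∘ₗ d (i + 1) = 0) :
    ChainComplex (ModuleCat.{u} A) ℕ :=
  ChainComplex.of (fun i => ModuleCat.of A (F i)) (fun i => ModuleCat.ofHom (d i)) fun i => by
    rw [← ModuleCat.ofHom_comp, hd]; rfl

theorem moduleComplex_d (hd : ∀ i, d i ∘ₗ d (i + 1) = 0) (i : ℕ) :
    (moduleComplex d hd).d (i + 1) i = ModuleCat.ofHom (d i) :=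
  ChainComplex.of_d (fun i => ModuleCat.of A (F i)) (fun i => ModuleCat.ofHom (d i)) i

/-- A projective resolution of `M`, given by modules and linear maps. -/
def moduleResolution (hs : ∀ i, Function.Exact (d (i + 1)) (d i)) (h0 : Function.Exact (d 0) ε)
    (hε : Function.Surjective ε) : ProjectiveResolution (ModuleCat.of A M) where
  complex := moduleComplex d fun i => (hs i).linearMap_comp_eq_zero
  projective i := inferInstanceAs (Projective (ModuleCat.of A (F i)))
  π := (ChainComplex.toSingle₀Equiv _ _).symm ⟨ModuleCat.ofHom ε,
    (congrArg (· ≫ ModuleCat.ofHom ε) (moduleComplex_d _ 0)).trans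
      (congrArg ModuleCat.ofHom h0.linearMap_comp_eq_zero)⟩
  quasiIso := ⟨fun n => by
    rcases n with _ | n
    · rw [ChainComplex.quasiIsoAt₀_iff, ShortComplex.quasiIso_iff_of_zeros']
      · dsimp
        refine (ShortComplex.exact_and_epi_g_iff_of_iso (S₂ := ShortComplex.mk
          (ModuleCat.ofHom (d 0)) (ModuleCat.ofHom ε)
          (congrArg ModuleCat.ofHom h0.linearMap_comp_eq_zero)) ?_).2 ⟨?_, ?_⟩
        · refine ShortComplex.isoMk (Iso.refl _) (Iso.refl _) (Iso.refl _) ?_ ?_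
          · exact (Category.id_comp _).trans ((moduleComplex_d
              (fun i => (hs i).linearMap_comp_eq_zero) 0).symm.trans
              (Category.comp_id _).symm)
          · exact (Category.id_comp _).trans
              ((ChainComplex.toSingle₀Equiv_symm_apply_f_zero
                (C := moduleComplex d fun i => (hs i).linearMap_comp_eq_zero)
                (X := ModuleCat.of A M) (ModuleCat.ofHom ε) _).symm.trans
                (Category.comp_id _).symm)
        · exact (ShortComplex.ShortExact.moduleCat_exact_iff_function_exact _).2 h0
        · exact (ModuleCat.epi_iff_surjective _).2 hε
      all_goals rfl
    · rw [quasiIsoAt_iff_exactAt']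
      · rw [HomologicalComplex.exactAt_iff' _ (n + 1 + 1) (n + 1) n (by simp) (by simp)]
        refine (ShortComplex.exact_iff_of_iso (S₁ := ShortComplex.mk
          (ModuleCat.ofHom (d (n + 1))) (ModuleCat.ofHom (d n))
          (congrArg ModuleCat.ofHom (hs n).linearMap_comp_eq_zero)) ?_).1
          ((ShortComplex.ShortExact.moduleCat_exact_iff_function_exact _).2 (hs n))
        refine ShortComplex.isoMk (Iso.refl _) (Iso.refl _) (Iso.refl _) ?_ ?_
        · exact (Category.id_comp _).trans ((moduleComplex_d
            (fun i => (hs i).linearMap_comp_eq_zero) (n + 1)).trans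
            (Category.comp_id _).symm)
        · exact (Category.id_comp _).trans ((moduleComplex_d
            (fun i => (hs i).linearMap_comp_eq_zero) n).trans
            (Category.comp_id _).symm)
      · apply ChainComplex.exactAt_succ_single_obj⟩

/-- The coboundaries with values in `M'`. -/
def IsCoboundary (d : ∀ i, F (i + 1) →ₗ[A] F i) {M' : Type u} [AddCommGroup M'] [Module A M'] :
    (i : ℕ) → (F i →ₗ[A] M') → Prop
  | 0, θ => θ = 0
  | i + 1, θ => ∃ θ' : F i →ₗ[A] M', θ' ∘ₗ d i = θ

section extMk

variable {M' : Type u} [AddCommGroup M'] [Module A M'] {i : ℕ}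

theorem moduleResolution_d (hs : ∀ i, Function.Exact (d (i + 1)) (d i))
    (h0 : Function.Exact (d 0) ε) (hε : Function.Surjective ε) (i : ℕ) :
    (moduleResolution hs h0 hε).complex.d (i + 1) i = ModuleCat.ofHom (d i) :=
  moduleComplex_d (fun i => (hs i).linearMap_comp_eq_zero) i

theorem moduleResolution_d_comp (hs : ∀ i, Function.Exact (d (i + 1)) (d i))
    (h0 : Function.Exact (d 0) ε) (hε : Function.Surjective ε)
    (θ : F i →ₗ[A] M') (h : θ ∘ₗ d i = 0) :
    (moduleResolution hs h0 hε).complex.d (i + 1) i ≫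
      (ModuleCat.ofHom θ : ModuleCat.of A (F i) ⟶ ModuleCat.of A M') = 0 :=
  (congrArg (· ≫ _) (moduleResolution_d hs h0 hε i)).trans (congrArg ModuleCat.ofHom h)

/-- The class of a cocycle. -/
def moduleExtMk (hs : ∀ i, Function.Exact (d (i + 1)) (d i))
    (h0 : Function.Exact (d 0) ε) (hε : Function.Surjective ε)
    (θ : F i →ₗ[A] M') (h : θ ∘ₗ d i = 0) :
    Abelian.Ext (ModuleCat.of A M) (ModuleCat.of A M') i :=
  (moduleResolution hs h0 hε).extMk
    (ModuleCat.ofHom θ : ModuleCat.of A (F i) ⟶ ModuleCat.of A M') (i + 1) rfl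
    (moduleResolution_d_comp hs h0 hε θ h)

theorem moduleExtMk_surjective (hs : ∀ i, Function.Exact (d (i + 1)) (d i))
    (h0 : Function.Exact (d 0) ε) (hε : Function.Surjective ε)
    (α : Abelian.Ext (ModuleCat.of A M) (ModuleCat.of A M') i) :
    ∃ (θ : F i →ₗ[A] M') (h : θ ∘ₗ d i = 0), moduleExtMk hs h0 hε θ h = α := by
  obtain ⟨f, hf, rfl⟩ := (moduleResolution hs h0 hε).extMk_surjective α (i + 1) rfl
  refine ⟨ModuleCat.Hom.hom f, ?_, rfl⟩
  exact congrArg ModuleCat.Hom.hom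
    ((congrArg (· ≫ f) (moduleResolution_d hs h0 hε i)).symm.trans hf)

theorem moduleExtMk_eq_zero_iff (hs : ∀ i, Function.Exact (d (i + 1)) (d i))
    (h0 : Function.Exact (d 0) ε) (hε : Function.Surjective ε)
    (θ : F i →ₗ[A] M') (h : θ ∘ₗ d i = 0) :
    moduleExtMk hs h0 hε θ h = 0 ↔ IsCoboundary d i θ := by
  rcases i with _ | i
  · refine (extMk_eq_zero_iff_of_zero _ _ _).trans ?_
    exact ⟨fun h => congrArg ModuleCat.Hom.hom h, fun h => congrArg ModuleCat.ofHom h⟩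
  · refine ((moduleResolution hs h0 hε).extMk_eq_zero_iff _ _ _ _ i rfl).trans ?_
    constructor
    · rintro ⟨g, hg⟩
      exact ⟨ModuleCat.Hom.hom g, congrArg ModuleCat.Hom.hom
        ((congrArg (· ≫ g) (moduleResolution_d hs h0 hε i)).symm.trans hg)⟩
    · rintro ⟨θ', rfl⟩
      exact ⟨ModuleCat.ofHom θ', congrArg (· ≫ _) (moduleResolution_d hs h0 hε i)⟩

theorem moduleExtMk_add (hs : ∀ i, Function.Exact (d (i + 1)) (d i))
    (h0 : Function.Exact (d 0) ε) (hε : Function.Surjective ε)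
    (θ θ' : F i →ₗ[A] M') (h : θ ∘ₗ d i = 0) (h' : θ' ∘ₗ d i = 0) :
    moduleExtMk hs h0 hε θ h + moduleExtMk hs h0 hε θ' h' =
      moduleExtMk hs h0 hε (θ + θ') (by rw [LinearMap.add_comp, h, h', add_zero]) :=
  (moduleResolution hs h0 hε).add_extMk _ _ _ _ _ _

/-- `Ext` vanishes if and only if all cocycles are coboundaries. -/
theorem subsingleton_ext_iff (hs : ∀ i, Function.Exact (d (i + 1)) (d i))
    (h0 : Function.Exact (d 0) ε) (hε : Function.Surjective ε)
    :
    Subsingleton (Abelian.Ext (ModuleCat.of A M) (ModuleCat.of A M') i) ↔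
      ∀ θ : F i →ₗ[A] M', θ ∘ₗ d i = 0 → IsCoboundary d i θ := by
  constructor
  · intro h θ hθ
    rw [← moduleExtMk_eq_zero_iff hs h0 hε θ hθ]
    exact Subsingleton.elim _ _
  · intro h
    refine subsingleton_of_forall_eq 0 fun α => ?_
    obtain ⟨θ, hθ, rfl⟩ := moduleExtMk_surjective hs h0 hε α
    exact (moduleExtMk_eq_zero_iff hs h0 hε θ hθ).2 (h θ hθ)

variable {k : Type u} [Field k] [Algebra k A]

theorem smul_moduleExtMk (hs : ∀ i, Function.Exact (d (i + 1)) (d i))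
    (h0 : Function.Exact (d 0) ε) (hε : Function.Surjective ε)
    (c : k) (θ : F i →ₗ[A] A) (h : θ ∘ₗ d i = 0) :
    c • moduleExtMk hs h0 hε θ h =
      moduleExtMk hs h0 hε (c • θ) (by rw [LinearMap.smul_comp, h, smul_zero]) := by
  rw [Abelian.Ext.smul_eq_comp_mk₀]
  refine ((moduleResolution hs h0 hε).extMk_comp_mk₀ _ _ _ _ _).trans ?_
  unfold moduleExtMk
  congr 1
  refine ModuleCat.hom_ext (LinearMap.ext fun x => ?_)
  exact (Algebra.smul_def c (θ x)).symm

/-- If `Ext` is one-dimensional, then a linear form which vanishes on the coboundaries, and not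
on all the cocycles, vanishes only on the coboundaries. -/
theorem isCoboundary_of_apply_eq_zero (hs : ∀ i, Function.Exact (d (i + 1)) (d i))
    (h0 : Function.Exact (d 0) ε) (hε : Function.Surjective ε)
    (e : Abelian.Ext (ModuleCat.of A M) (ModuleCat.of A A) i ≃ₗ[k] k)
    (ℓ : (F i →ₗ[A] A) →ₗ[k] k) (hℓ : ∀ θ, IsCoboundary d i θ → ℓ θ = 0) {θ₀ θ : F i →ₗ[A] A}
    (h₀ : θ₀ ∘ₗ d i = 0) (h₁ : ℓ θ₀ ≠ 0) (h : θ ∘ₗ d i = 0) (hθ : ℓ θ = 0) :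
    IsCoboundary d i θ := by
  have hne : e (moduleExtMk hs h0 hε θ₀ h₀) ≠ 0 := by
    rw [Ne, LinearEquiv.map_eq_zero_iff, moduleExtMk_eq_zero_iff]
    exact fun h => h₁ (hℓ _ h)
  -- With this `c`, the cochain `θ - c θ₀` is a coboundary; applying `ℓ` then forces `c = 0`.
  set c : k := e (moduleExtMk hs h0 hε θ h) / e (moduleExtMk hs h0 hε θ₀ h₀) with hc
  have key : moduleExtMk hs h0 hε θ h + (-c) • moduleExtMk hs h0 hε θ₀ h₀ = 0 := by
    rw [← LinearEquiv.map_eq_zero_iff e, map_add, map_smul, hc, smul_eq_mul]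
    field_simp
    ring
  rw [smul_moduleExtMk, moduleExtMk_add, moduleExtMk_eq_zero_iff] at key
  have h2 := hℓ _ key
  rw [map_add, hθ, map_smul, zero_add, smul_eq_mul, mul_eq_zero, or_iff_left h₁] at h2
  rwa [h2, zero_smul, add_zero] at key

end extMk

theorem subsingleton_ext_of_globalDimension {D i : ℕ} (h : globalDimension A = D) (hi : D < i)
    (M' : Type u) [AddCommGroup M'] [Module A M'] :
    Subsingleton (Abelian.Ext (ModuleCat.of A M) (ModuleCat.of A M') i) := by
  have h1 : projectiveDimension (ModuleCat.of A M) ≤ D :=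
    (le_iSup (fun M : ModuleCat.{u} A => projectiveDimension M) _).trans h.le
  have := (projectiveDimension_le_iff _ _).1 h1
  exact HasProjectiveDimensionLT.subsingleton _ (D + 1) i hi _

end resolution

/-! ### Cochains on the Koszul complex -/

section cochains

variable {k : Type u} [Field k] {X : Type} [Fintype X] {N : ℕ} {Rel : Set (List X → k)}
  {A : Type u} [Ring A] [Algebra k A] {a : X → A}
  {B : Type u} [Ring B] [Algebra k B] {s : X → B}

theorem koszulMap_comp (hN : 2 ≤ N) (hA : Presents N Rel a) (hB : Presents N (annRel N Rel) s)
    (i : ℕ) : koszulMap (k := k) hN a s i ∘ₗ koszulMap hN a s (i + 1) = 0 := by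
  refine LinearMap.ext fun φ => Subtype.ext ?_
  change koszulD a s (step N i) (koszulD a s (step N (i + 1)) φ.1) = 0
  rw [koszulD_koszulD, add_comm, step_add_step hN, koszulD_eq_zero hA hB]

/-- The part of degree `n` of a linear form. -/
def Presents.form (hB : Presents N Rel s) (A : Type u) [Ring A] [Algebra k A] (n : ℕ) :
    (B →ₗ[k] k) →ₗ[k] supp (A := A) k s n where
  toFun χ := ⟨scal A (χ ∘ₗ hB.proj n), fun w hw => by
    rw [scal_apply, LinearMap.comp_apply, hB.proj_wprod, if_neg (by exact_mod_cast hw), map_zero,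
      map_zero]⟩
  map_add' χ χ' := by
    refine Subtype.ext (LinearMap.ext fun f => ?_)
    simp
  map_smul' c χ := by
    refine Subtype.ext (LinearMap.ext fun f => ?_)
    exact (map_mul (algebraMap k A) _ _).trans (Algebra.smul_def _ _).symm

theorem Presents.form_apply (hB : Presents N Rel s) (n : ℕ) (χ : B →ₗ[k] k) (f : B) :
    (hB.form A n χ).1 f = algebraMap k A (χ (hB.proj n f)) := rfl

theorem Presents.form_apply_of_mem (hB : Presents N Rel s) {n : ℕ} (χ : B →ₗ[k] k) {f : B}
    (hf : f ∈ gr k s n) : (hB.form A n χ).1 f = algebraMap k A (χ f) := by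
  rw [hB.form_apply, hB.proj_of_mem (by rwa [grZ_natCast])]

theorem eq_of_forall_mem_gr (hB : Presents N Rel s) {n : ℕ} {φ ψ : supp (A := A) k s n}
    (h : ∀ f ∈ gr k s n, φ.1 f = ψ.1 f) : φ = ψ := by
  refine Subtype.ext (hB.ext fun w => ?_)
  by_cases hw : w.length = n
  · exact h _ (wprod_mem_gr' hw)
  · rw [φ.2 w hw, ψ.2 w hw]

theorem sum_smul_apply {n : ℕ} {ι : Type*} (t : Finset ι) (y : ι → A)
    (φ : ι → supp (A := A) k s n) (f : B) :
    (∑ j ∈ t, y j • φ j).1 f = ∑ j ∈ t, y j * (φ j).1 f := by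
  rw [AddSubmonoidClass.coe_finsetSum, LinearMap.sum_apply]
  rfl

/-- Expansion along dual bases of the component of degree `n`. The dual forms are extended
arbitrarily to `B`, since `Presents.form` only sees their part of degree `n`. -/
theorem exists_eq_sum_smul_form (hB : Presents N Rel s) (A : Type u) [Ring A] [Algebra k A]
    (n : ℕ) : ∃ (m : ℕ) (f : Fin m → B) (χ : Fin m → B →ₗ[k] k), (∀ j, f j ∈ gr k s n) ∧
      ∀ φ : supp (A := A) k s n, φ = ∑ j, φ.1 (f j) • hB.form A n (χ j) := by
  have := gr_finite (k := k) (a := s) n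
  let c := Module.finBasis k (gr k s n)
  choose χ hχ using fun j => (c.coord j).exists_extend
  refine ⟨_, fun j => c j, χ, fun j => (c j).2, fun φ => eq_of_forall_mem_gr hB fun f hf => ?_⟩
  rw [sum_smul_apply]
  have h1 := congrArg Subtype.val (c.sum_repr ⟨f, hf⟩)
  rw [AddSubmonoidClass.coe_finsetSum] at h1
  conv_lhs => rw [← show _ = f from h1, map_sum]
  refine Finset.sum_congr rfl fun j _ => ?_
  rw [hB.form_apply_of_mem _ hf, ← Algebra.commutes, ← Algebra.smul_def, Submodule.coe_smul,
    map_smul]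
  congr 1
  exact (LinearMap.congr_fun (hχ j) ⟨f, hf⟩).symm

variable {ε : A →ₐ[k] k}

theorem aug_apply_eq_zero (hB : Presents N Rel s) {n : ℕ} (θ : supp (A := A) k s n →ₗ[A] A)
    {φ : supp (A := A) k s n} (h : ∀ f, ε (φ.1 f) = 0) : ε (θ φ) = 0 := by
  obtain ⟨m, f, χ, -, e⟩ := exists_eq_sum_smul_form hB A n
  rw [e φ, map_sum, map_sum]
  refine Finset.sum_eq_zero fun j _ => ?_
  rw [map_smul, smul_eq_mul, map_mul, h, zero_mul]

theorem aug_koszulMap (hε : ∀ w : List X, w ≠ [] → ε (wprod a w) = 0) (hN : 2 ≤ N) (i : ℕ)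
    (φ : supp (A := A) k s (jump N (i + 1))) (f : B) : ε ((koszulMap hN a s i φ).1 f) = 0 := by
  rw [koszulMap_coe, koszulD_apply, map_sum]
  refine Finset.sum_eq_zero fun w hw => ?_
  rw [map_mul, hε w, mul_zero]
  rintro rfl
  have := step_pos hN i
  simp [mem_words] at hw
  omega

/-- The coboundaries take values in the augmentation ideal. -/
theorem aug_isCoboundary (hε : ∀ w : List X, w ≠ [] → ε (wprod a w) = 0) (hN : 2 ≤ N)
    (hB : Presents N Rel s) {i : ℕ} {θ : supp (A := A) k s (jump N i) →ₗ[A] A}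
    (h : IsCoboundary (F := fun i => supp (A := A) k s (jump N i)) (koszulMap hN a s) i θ)
    (φ : supp (A := A) k s (jump N i)) : ε (θ φ) = 0 := by
  rcases i with _ | i
  · rw [show θ = 0 from h, LinearMap.zero_apply, map_zero]
  · obtain ⟨θ', rfl⟩ := h
    exact aug_apply_eq_zero hB θ' fun f => aug_koszulMap hε hN i φ f

open Classical in
-- As `w` is at least as long as `p`, only the constant term of `y` can contribute to the
-- coefficient of `p`. This is how constant parts of cochains are extracted below.
theorem Presents.coord_wprod_mul (hA : Presents N Rel a)
    (hε : ∀ w : List X, w ≠ [] → ε (wprod a w) = 0) {p w : List X} (hp : p.length < N)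
    (h : p.length ≤ w.length) (y : A) :
    hA.coord p (wprod a w * y) = if w = p then ε y else 0 := by
  have : hA.coord p ∘ₗ LinearMap.mulLeft k (wprod a w) =
      (if w = p then (1 : k) else 0) • ε.toLinearMap := by
    refine hA.ext fun v => ?_
    rw [LinearMap.comp_apply, LinearMap.mulLeft_apply, ← wprod_append, hA.coord_wprod hp]
    by_cases hv : v = []
    · subst hv
      split_ifs with h1 h2 h2 <;> simp_all
    · rw [if_neg, LinearMap.smul_apply, AlgHom.toLinearMap_apply, hε v hv, smul_zero]
      rintro rfl
      have := List.length_pos_iff.2 hv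
      rw [List.length_append] at h
      omega
  have h2 := LinearMap.congr_fun this y
  rw [LinearMap.comp_apply, LinearMap.mulLeft_apply] at h2
  rw [h2]
  split_ifs <;> simp

/-- The evaluation at an element of `B`. -/
def evalAt (A : Type u) [Ring A] [Algebra k A] (s : X → B) (n : ℕ) (f : B) :
    supp (A := A) k s n →ₗ[A] A where
  toFun φ := φ.1 f
  map_add' _ _ := rfl
  map_smul' _ _ := rfl

@[simp]
theorem evalAt_apply (n : ℕ) (f : B) (φ : supp (A := A) k s n) : evalAt A s n f φ = φ.1 f := rfl

/-- The form `f ↦ ν(h f)` of degree `n`, as a function of `h`. -/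
def Presents.leftForm (hB : Presents N Rel s) (A : Type u) [Ring A] [Algebra k A]
    (ν : B →ₗ[k] k) (n : ℕ) : B →ₗ[k] supp (A := A) k s n :=
  hB.form A n ∘ₗ (LinearMap.mul k B).compr₂ ν

theorem Presents.leftForm_apply (hB : Presents N Rel s) (ν : B →ₗ[k] k) (n : ℕ) (h f : B) :
    (hB.leftForm A ν n h).1 f = algebraMap k A (ν (h * hB.proj n f)) := rfl

theorem Presents.proj_wprod_mul_add (hB : Presents N Rel s) {m n l : ℕ} (w : List X)
    (hw : w.length = n) (hl : l = m + n) (y : B) :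
    hB.proj l (wprod s w * y) = wprod s w * hB.proj m y := by
  rw [← hB.proj_wprod_mul, hw, hl]
  push_cast
  rfl

/-- On the forms `f ↦ ν(h f)`, left translation of `f` becomes right translation of `h`; this turns
the dual of the left Koszul complex into the right Koszul complex. -/
theorem koszulMap_leftForm (hN : 2 ≤ N) (hB : Presents N Rel s) (ν : B →ₗ[k] k) (i : ℕ) (h : B) :
    koszulMap hN a s i (hB.leftForm A ν (jump N (i + 1)) h) =
      ∑ w ∈ words X (step N i), wprod a w • hB.leftForm A ν (jump N i) (h * wprod s w) := by
  refine Subtype.ext (LinearMap.ext fun f => ?_)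
  rw [koszulMap_coe, koszulD_apply, sum_smul_apply]
  refine Finset.sum_congr rfl fun w hw => ?_
  rw [hB.leftForm_apply, hB.leftForm_apply, Algebra.commutes,
    hB.proj_wprod_mul_add w (mem_words.1 hw) (jump_succ hN i), mul_assoc]

/-- The pairing `(f, h) ↦ ν(h f)` between the components of degrees `p` and `q` is perfect. -/
structure PerfectAt (s : X → B) (ν : B →ₗ[k] k) (p q : ℕ) : Prop where
  eq_zero : ∀ f ∈ gr k s p, (∀ h ∈ gr k s q, ν (h * f) = 0) → f = 0
  exists_eq : ∀ α : B →ₗ[k] k, ∃ f ∈ gr k s p, ∀ h ∈ gr k s q, ν (h * f) = α h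

/-- Dual bases for the pairing: surjectivity represents the coordinate forms in degree `q` by the `f
j`, and injectivity gives the expansion in degree `p`. -/
theorem PerfectAt.exists_dual {ν : B →ₗ[k] k} {p q : ℕ} (hP : PerfectAt s ν p q) :
    ∃ (m : ℕ) (f g : Fin m → B), (∀ j, f j ∈ gr k s p) ∧ (∀ j, g j ∈ gr k s q) ∧
      (∀ h ∈ gr k s q, ∑ j, ν (h * f j) • g j = h) ∧
      ∀ y ∈ gr k s p, ∑ j, ν (g j * y) • f j = y := by
  have := gr_finite (k := k) (a := s) q
  let c := Module.finBasis k (gr k s q)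
  choose χ hχ using fun j => (c.coord j).exists_extend
  choose f hf hνf using fun j => hP.exists_eq (χ j)
  have h1 : ∀ h : gr k s q, ∀ j, ν (h * f j) = c.coord j h := fun h j => by
    rw [hνf j h h.2, ← hχ]; rfl
  refine ⟨_, f, fun j => c j, hf, fun j => (c j).2, fun h hh => ?_, fun y hy => ?_⟩
  · have h2 := congrArg Subtype.val (c.sum_repr ⟨h, hh⟩)
    rw [AddSubmonoidClass.coe_finsetSum] at h2
    conv_rhs => rw [← show _ = h from h2]
    refine Finset.sum_congr rfl fun j _ => ?_
    rw [h1 ⟨h, hh⟩ j]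
    rfl
  · rw [← sub_eq_zero]
    refine hP.eq_zero _ (sub_mem (Submodule.sum_mem _ fun j _ => Submodule.smul_mem _ _ (hf j)) hy)
      fun h hh => ?_
    have h2 := congrArg Subtype.val (c.sum_repr ⟨h, hh⟩)
    rw [AddSubmonoidClass.coe_finsetSum] at h2
    rw [mul_sub, map_sub, sub_eq_zero, Finset.mul_sum, map_sum]
    conv_rhs => rw [← show _ = h from h2, Finset.sum_mul, map_sum]
    refine Finset.sum_congr rfl fun j _ => ?_
    rw [mul_smul_comm, map_smul, h1 ⟨h, hh⟩ j, Submodule.coe_smul, smul_mul_assoc, map_smul,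
      smul_eq_mul, smul_eq_mul, mul_comm]
    rfl

theorem eq_sum_smul_leftForm (hB : Presents N Rel s) {ν : B →ₗ[k] k} {p m : ℕ} {f g : Fin m → B}
    (hf : ∀ y ∈ gr k s p, ∑ j, ν (g j * y) • f j = y) (φ : supp (A := A) k s p) :
    φ = ∑ j, φ.1 (f j) • hB.leftForm A ν p (g j) := by
  refine eq_of_forall_mem_gr hB fun y hy => ?_
  rw [sum_smul_apply]
  conv_lhs => rw [← hf y hy, map_sum]
  refine Finset.sum_congr rfl fun j _ => ?_
  rw [map_smul, Algebra.smul_def, hB.leftForm_apply, Algebra.commutes,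
    hB.proj_of_mem (by rwa [grZ_natCast])]

end cochains

/-! ### Duality for the Koszul complex -/

/-- For `N > 2` and `D > 0` the condition means that `D` is odd, so exactly one of `i` and `j` is
odd and no carry occurs; for `N = 2` the jumps are the identity. -/
theorem jump_add_jump {N D : ℕ} (hN : 2 ≤ N) (h : 0 < D → step N (D - 1) = 1) {i j : ℕ}
    (hij : i + j = D) : jump N i + jump N j = jump N D := by
  rcases Nat.eq_zero_or_pos D with h0 | h0
  · obtain ⟨rfl, rfl⟩ : i = 0 ∧ j = 0 := by omega
    subst h0
    simp [jump]
  have h1 := h h0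
  unfold step at h1
  by_cases h2 : N = 2
  · subst h2
    unfold jump
    omega
  · have h3 : D % 2 = 1 := by
      split_ifs at h1 with h3
      · omega
      · omega
    have h4 : D / 2 = i / 2 + j / 2 ∧ D % 2 = i % 2 + j % 2 := by omega
    unfold jump
    rw [h4.1, h4.2]
    ring

section duality

variable {k : Type u} [Field k] {X : Type} [Fintype X] {N : ℕ} {Rel : Set (List X → k)}
  {A : Type u} [Ring A] [Algebra k A] {a : X → A}
  {B : Type u} [Ring B] [Algebra k B] {s : X → B} {ε : A →ₐ[k] k} {ν : B →ₗ[k] k} {D : ℕ}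

theorem eq_zero_of_mem_gr {M : Type*} [AddCommGroup M] [Module k M] {n : ℕ} {φ : B →ₗ[k] M}
    (h : ∀ w : List X, w.length = n → φ (wprod s w) = 0) {y : B} (hy : y ∈ gr k s n) :
    φ y = 0 := by
  obtain ⟨c, rfl⟩ := exists_sum_of_mem_gr hy
  rw [map_sum]
  exact Finset.sum_eq_zero fun w hw => by rw [map_smul, h w (mem_words.1 hw), smul_zero]

theorem nonempty_of_mem_gr {n : ℕ} (hn : 0 < n) {y : B} (hy : y ∈ gr k s n) (h : y ≠ 0) :
    Nonempty X := by
  by_contra hX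
  rw [not_nonempty_iff] at hX
  refine h (eq_zero_of_mem_gr (φ := LinearMap.id) (fun w hw => ?_) hy)
  rcases w with _ | ⟨x, w⟩
  · simp at hw
    omega
  · exact hX.elim x

theorem eq_on_gr_add {m n : ℕ} {α β : B →ₗ[k] k}
    (h : ∀ y ∈ gr k s m, ∀ w : List X, w.length = n → α (y * wprod s w) = β (y * wprod s w))
    {y : B} (hy : y ∈ gr k s (m + n)) : α y = β y := by
  rw [← sub_eq_zero, ← LinearMap.sub_apply]
  refine eq_zero_of_mem_gr (fun w hw => ?_) hy
  rw [LinearMap.sub_apply, sub_eq_zero, ← List.take_append_drop m w, wprod_append]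
  exact h _ (wprod_mem_gr' (by simp; omega)) _ (by simp; omega)

theorem eq_of_forall_dual {f g : B} (h : ∀ χ : B →ₗ[k] k, χ f = χ g) : f = g := by
  rw [← sub_eq_zero, ← Module.forall_dual_apply_eq_zero_iff k]
  intro χ
  rw [map_sub, h, sub_self]

/-- A perfect pairing exists only for special values of `D`. -/
theorem step_eq_one_of_perfectAt (hN : 2 ≤ N) (hB : Presents N Rel s)
    (hν : ∀ w : List X, w.length ≠ jump N D → ν (wprod s w) = 0)
    (h : ∀ i ≤ D, PerfectAt s ν (jump N (D - i)) (jump N i)) (hD : 0 < D) :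
    step N (D - 1) = 1 := by
  have hj : ∀ j, 0 < j → 0 < jump N j := fun j hj => by
    have := jump_mono hN hj
    omega
  obtain ⟨f, hf, h0⟩ := (h 0 (by omega)).exists_eq (hB.coord [])
  have h1 := h0 1 (by
    rw [jump_zero]
    exact wprod_mem_gr' (a := s) (w := []) rfl)
  rw [one_mul, ← wprod_nil s, hB.coord_wprod (by simp; omega), if_pos rfl] at h1
  obtain ⟨x⟩ := nonempty_of_mem_gr (hj _ (by omega)) hf (by rintro rfl; simp at h1)
  -- Here `ν(s_x f) = 1` with `s_x f` of degree `n(D-1) + 1`. As `ν` lives in degree `n(D)`, the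
  -- last step must be `1`.
  obtain ⟨f, hf, h0⟩ := (h 1 (by omega)).exists_eq (hB.coord [x])
  have h1 := h0 (wprod s [x]) (by
    rw [jump_one]
    exact wprod_mem_gr' rfl)
  rw [hB.coord_wprod (by simp; omega), if_pos rfl] at h1
  by_contra hne
  have h2 := mul_mem_gr (wprod_mem_gr (k := k) (a := s) [x]) hf
  rw [eq_zero_of_mem_gr (φ := ν) (fun w hw => hν w ?_) h2] at h1
  · exact zero_ne_one h1
  · have h3 := jump_succ hN (D - 1)
    rw [Nat.sub_add_cancel hD] at h3
    simp at hw
    omega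

/-- If the pairings are perfect, the cocycles of the dual of the Koszul complex are
coboundaries. -/
theorem isCoboundary_of_perfectAt (hE : KoszulExact (k := k) N a s) (hN : 2 ≤ N)
    (hA : Presents N Rel a) (hB : Presents N (annRel N Rel) s)
    (hν : ∀ w : List X, w.length ≠ jump N D → ν (wprod s w) = 0)
    (hz : ∀ f ∈ gr k s (jump N (D + 1)), f = 0)
    (h : ∀ i ≤ D, PerfectAt s ν (jump N (D - i)) (jump N i)) {i : ℕ} (hi : i < D)
    {θ : supp (A := A) k s (jump N i) →ₗ[A] A} (hθ : θ ∘ₗ koszulMap hN a s i = 0) :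
    IsCoboundary (F := fun i => supp (A := A) k s (jump N i)) (koszulMap hN a s) i θ := by
  have hpar := step_eq_one_of_perfectAt hN hB hν h
  have hP : ∀ {i j : ℕ}, i + j = D → PerfectAt s ν (jump N i) (jump N j) := fun {i j} hij => by
    have := h j (by omega)
    rwa [show D - j = i by omega] at this
  obtain ⟨j, rfl⟩ : ∃ j, D = i + (j + 1) := ⟨D - i - 1, by omega⟩
  have e1 := jump_add_jump hN hpar (i := i) (j := j + 1) rfl
  have e2 := jump_add_jump hN hpar (i := i + 1) (j := j) (by omega)
  have e3 : step N i = step N j := by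
    have := jump_succ hN i
    have := jump_succ hN j
    omega
  -- This is `θ` transported along the pairing; by `koszulMap_leftForm`, the cocycle condition says
  -- that `x` is a cycle of the right Koszul complex.
  let x : B →ₗ[k] A := θ.restrictScalars k ∘ₗ hB.leftForm A ν (jump N i)
  have hx : x ∈ supp (A := A) k s (jump N (j + 1)) := fun w hw => by
    have : hB.leftForm A ν (jump N i) (wprod s w) = 0 := eq_of_forall_mem_gr hB fun f hf => by
      rw [hB.leftForm_apply, hB.proj_of_mem (by rwa [grZ_natCast]),
        eq_zero_of_mem_gr (φ := ν) (fun v hv => hν v _) (mul_mem_gr (wprod_mem_gr w) hf)]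
      · exact map_zero _
      · intro v hv
        omega
    change θ (hB.leftForm A ν (jump N i) (wprod s w)) = 0
    rw [this, map_zero]
  obtain ⟨y, hy, hyx⟩ := exists_rightD_of_cycle hE hN hA hB j hx (by
    ext f
    rw [rightD_apply, LinearMap.zero_apply]
    have := LinearMap.congr_fun hθ (hB.leftForm A ν (jump N (i + 1)) f)
    rw [LinearMap.comp_apply, koszulMap_leftForm, map_sum, e3] at this
    simpa [x] using this)
  obtain ⟨m, f, g, -, hg, -, hfg⟩ := (hP (i := i) (j := j + 1) rfl).exists_dual
  rcases i with _ | i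
  -- At the end of the complex the preimage `y` lives in degree `n(D+1)`, where `B` vanishes, so `θ`
  -- itself is zero.
  · have hy0 : y = 0 := hB.ext fun w => by
      by_cases hw : w.length = jump N (j + 2)
      · rw [hz (wprod s w) (wprod_mem_gr' (by rw [hw]; congr 1; omega)), map_zero, map_zero]
      · rw [hy w hw]; rfl
    have hx0 : x = 0 := by rw [← hyx, hy0, map_zero]
    refine LinearMap.ext fun φ => ?_
    rw [eq_sum_smul_leftForm hB hfg φ, map_sum, LinearMap.zero_apply]
    refine Finset.sum_eq_zero fun l _ => ?_
    rw [map_smul, show θ (hB.leftForm A ν (jump N 0) (g l)) = 0 from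
      LinearMap.congr_fun hx0 (g l), smul_zero]
  · obtain ⟨m', f', g', hf', -, hgf', -⟩ := (hP (i := i) (j := j + 2) (by omega)).exists_dual
    -- The cochain which corresponds to `y` under the pairing of the degrees `n(i)` and `n(j+2)`.
    let θ' : supp (A := A) k s (jump N i) →ₗ[A] A :=
      ∑ l, LinearMap.toSpanSingleton A A (y (g' l)) ∘ₗ evalAt A s (jump N i) (f' l)
    have hθ' : ∀ t ∈ gr k s (jump N (j + 2)), θ' (hB.leftForm A ν (jump N i) t) = y t := by
      intro t ht
      conv_rhs => rw [← hgf' t ht, map_sum]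
      simp only [θ', LinearMap.sum_apply, LinearMap.comp_apply, evalAt_apply,
        LinearMap.toSpanSingleton_apply]
      refine Finset.sum_congr rfl fun l _ => ?_
      rw [hB.leftForm_apply, hB.proj_of_mem (by rw [grZ_natCast]; exact hf' l), smul_eq_mul,
        map_smul, Algebra.smul_def]
    refine ⟨θ', LinearMap.ext fun φ => ?_⟩
    rw [eq_sum_smul_leftForm hB hfg φ, map_sum, map_sum]
    refine Finset.sum_congr rfl fun l _ => ?_
    rw [map_smul, map_smul, LinearMap.comp_apply, koszulMap_leftForm, map_sum]
    congr 1
    have e4 : step N i = step N (j + 1) := by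
      have := step_add_step hN i
      have := step_add_step hN j
      omega
    refine Eq.trans ?_ (LinearMap.congr_fun hyx (g l))
    rw [rightD_apply, e4]
    refine Finset.sum_congr rfl fun w hw => ?_
    rw [map_smul, hθ' _ (by
      rw [jump_succ hN (j + 1)]
      exact mul_mem_gr (hg l) (wprod_mem_gr' (mem_words.1 hw)))]

/-- If the cocycles of the dual of the Koszul complex are coboundaries, the pairings are
perfect. -/
theorem perfectAt_of_isCoboundary (hN : 2 ≤ N) (hA : Presents N Rel a)
    (hB : Presents N (annRel N Rel) s) (hε : ∀ w : List X, w ≠ [] → ε (wprod a w) = 0)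
    (hz : ∀ f ∈ gr k s (jump N (D + 1)), f = 0) {u : B} (hu : u ∈ gr k s (jump N D))
    (hν1 : ν u = 1) (hνu : ∀ f ∈ gr k s (jump N D), f = ν f • u)
    (hcob : ∀ i < D, ∀ θ : supp (A := A) k s (jump N i) →ₗ[A] A, θ ∘ₗ koszulMap hN a s i = 0 →
      IsCoboundary (F := fun i => supp (A := A) k s (jump N i)) (koszulMap hN a s) i θ)
    (htop : ∀ θ : supp (A := A) k s (jump N D) →ₗ[A] A,
      ε (θ (hB.leftForm A ν (jump N D) 1)) = 0 →
      IsCoboundary (F := fun i => supp (A := A) k s (jump N i)) (koszulMap hN a s) D θ)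
    {i : ℕ} (hi : i ≤ D) : PerfectAt s ν (jump N (D - i)) (jump N i) := by
  -- Evaluation at `u` followed by multiplication by `a_x` is a coboundary by `htop`. If the last
  -- step were longer than `1`, its value `a_x` would be a combination of words of length at least
  -- `2` times elements of `A`.
  have hpar : 0 < D → step N (D - 1) = 1 := by
    intro hD
    obtain ⟨D, rfl⟩ : ∃ D', D = D' + 1 := ⟨D - 1, by omega⟩
    obtain ⟨x⟩ := nonempty_of_mem_gr (by have := jump_mono hN hD; omega) hu
      (by rintro rfl; simp at hν1)
    obtain ⟨θ', hθ'⟩ := htop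
      (LinearMap.toSpanSingleton A A (wprod a [x]) ∘ₗ evalAt A s (jump N (D + 1)) u)
      (by
        rw [LinearMap.comp_apply, LinearMap.toSpanSingleton_apply, smul_eq_mul, map_mul,
          hε [x] (List.cons_ne_nil _ _), mul_zero])
    have h1 := LinearMap.congr_fun hθ' (hB.leftForm A ν (jump N (D + 1)) 1)
    rw [LinearMap.comp_apply, koszulMap_leftForm, map_sum, LinearMap.comp_apply, evalAt_apply,
      hB.leftForm_apply, hB.proj_of_mem (by rwa [grZ_natCast]), one_mul, hν1, map_one,
      LinearMap.toSpanSingleton_apply, one_smul] at h1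
    have h2 := congrArg (hA.coord [x]) h1
    by_contra hne
    have hs := step_pos hN (D + 1 - 1)
    rw [hA.coord_wprod (by simp; omega), if_pos rfl, map_sum, Finset.sum_eq_zero] at h2
    · exact zero_ne_one h2
    · intro w hw
      rw [Nat.add_sub_cancel] at hne hs
      have hw' := mem_words.1 hw
      rw [map_smul, smul_eq_mul, hA.coord_wprod_mul hε (by simp; omega) (by simp; omega), if_neg]
      rintro rfl
      simp at hw'
      omega
  induction i using Nat.strong_induction_on with
  | _ i ih =>
  rcases i with _ | i
  · rw [jump_zero, Nat.sub_zero]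
    have h1 : (1 : B) ∈ gr k s 0 := wprod_mem_gr' (a := s) (w := []) rfl
    refine ⟨fun f hf h => ?_, fun α => ⟨α 1 • u, Submodule.smul_mem _ _ hu, fun h hh => ?_⟩⟩
    · have := h 1 h1
      rw [one_mul] at this
      rw [hνu f hf, this, zero_smul]
    · obtain ⟨c, rfl⟩ := exists_sum_of_mem_gr hh
      rw [sum_words_zero, wprod_nil, smul_mul_assoc, one_mul, smul_smul, map_smul, map_smul, hν1,
        smul_eq_mul, smul_eq_mul, mul_one]
  obtain ⟨j, hj⟩ : ∃ j, D = j + (i + 1) := ⟨D - (i + 1), by omega⟩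
  have e1 := jump_add_jump hN hpar (i := j) (j := i + 1) hj.symm
  have e2 := jump_add_jump hN hpar (i := j + 1) (j := i) (by omega)
  have e3 : step N i = step N j := by
    have := jump_succ hN i
    have := jump_succ hN j
    omega
  have P1 : PerfectAt s ν (jump N (j + 1)) (jump N i) := by
    have := ih i (by omega) (by omega)
    rwa [show D - i = j + 1 by omega] at this
  have hji : jump N (i + 1) = jump N i + step N j := by rw [jump_succ hN, e3]
  rw [show D - (i + 1) = j by omega]
  constructor
  · intro f hf hνf
    -- The previous pairing shows that `f` is killed by the words of the step, so evaluation at `f`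
    -- is a cocycle; minimality then gives `f = 0`.
    have h1 : ∀ w ∈ words X (step N j), wprod s w * f = 0 := fun w hw =>
      P1.eq_zero _ (by
        rw [jump_succ hN, add_comm]
        exact mul_mem_gr (wprod_mem_gr' (mem_words.1 hw)) hf) fun h hh => by
        rw [← mul_assoc]
        exact hνf _ (by rw [hji]; exact mul_mem_gr hh (wprod_mem_gr' (mem_words.1 hw)))
    have h2 := hcob j (by omega) (evalAt A s (jump N j) f) (LinearMap.ext fun φ => by
      rw [LinearMap.comp_apply, evalAt_apply, koszulMap_coe, koszulD_apply]
      exact Finset.sum_eq_zero fun w hw => by rw [h1 w hw, map_zero, zero_mul])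
    refine eq_of_forall_dual (k := k) fun χ => ?_
    have h3 := aug_isCoboundary hε hN hB h2 (hB.form A (jump N j) χ)
    rwa [evalAt_apply, hB.form_apply_of_mem _ hf, AlgHom.commutes, Algebra.algebraMap_self_apply,
      ← map_zero χ] at h3
  · intro α
    -- `g w` represents `h ↦ α(h s_w)`. The element `y` sought must satisfy `g w = s_w y`, so it is
    -- found by showing that `∑ ev(g w) a_w` is a coboundary.
    choose g hg hgν using fun w : List X => P1.exists_eq (α ∘ₗ LinearMap.mulRight k (wprod s w))
    let θ : supp (A := A) k s (jump N (j + 1)) →ₗ[A] A := ∑ w ∈ words X (step N j),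
      LinearMap.toSpanSingleton A A (wprod a w) ∘ₗ evalAt A s (jump N (j + 1)) (g w)
    have hθ : ∀ φ, θ φ = ∑ w ∈ words X (step N j), φ.1 (g w) * wprod a w := fun φ => by
      simp [θ, LinearMap.sum_apply]
    have hcyc : θ ∘ₗ koszulMap hN a s (j + 1) = 0 := by
      refine LinearMap.ext fun ψ => ?_
      rw [LinearMap.comp_apply, hθ, LinearMap.zero_apply]
      simp only [koszulMap_coe, koszulD_apply]
      have hmem : ∀ w, ∀ v ∈ words X (step N (j + 1)),
          wprod s v * g w ∈ gr k s (jump N (j + 2)) := fun w v hv => by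
        rw [jump_succ hN (j + 1), add_comm]
        exact mul_mem_gr (wprod_mem_gr' (mem_words.1 hv)) (hg w)
      rcases i with _ | i
      · refine Finset.sum_eq_zero fun w _ => ?_
        rw [Finset.sum_eq_zero, zero_mul]
        intro v hv
        have := hmem w v hv
        rw [show j + 2 = D + 1 by omega] at this
        rw [hz _ this, map_zero, zero_mul]
      -- Expanding `s_v g_w` in the dual bases of the pairing two steps back leaves `∑ α(g' s_v s_w)
      -- a_v a_w` over words of total length `N`, which is the vanishing canonical element.
      · have P2 := ih i (by omega) (by omega)
        rw [show D - i = j + 2 by omega] at P2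
        obtain ⟨m, f, g', -, hg', -, hfg⟩ := P2.exists_dual
        have e4 : jump N (i + 1) = jump N i + step N (j + 1) := by
          have := jump_add_jump hN hpar (i := j + 2) (j := i) (by omega)
          have : jump N (j + 2) = _ := jump_succ hN (j + 1)
          omega
        have key : ∀ w, ∀ v ∈ words X (step N (j + 1)), ψ.1 (wprod s v * g w) =
            ∑ l, α (g' l * wprod s (v ++ w)) • ψ.1 (f l) := fun w v hv => by
          conv_lhs => rw [← hfg _ (hmem w v hv), map_sum]
          refine Finset.sum_congr rfl fun l _ => ?_
          rw [map_smul, ← mul_assoc, hgν w _ (by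
            rw [e4]
            exact mul_mem_gr (hg' l) (wprod_mem_gr' (mem_words.1 hv))), wprod_append, ← mul_assoc]
          rfl
        have h0 : ∀ l, ∑ w ∈ words X (step N j), ∑ v ∈ words X (step N (j + 1)),
            α (g' l * wprod s (v ++ w)) • wprod a (v ++ w) = 0 := fun l => by
          have := sum_bilin_eq_zero hA hB
            (LinearMap.lsmul k A ∘ₗ α ∘ₗ LinearMap.mulLeft k (g' l))
          rw [← step_add_step hN j, add_comm, sum_words_append, Finset.sum_comm] at this
          exact this
        have h1 : ∀ w ∈ words X (step N j), (∑ v ∈ words X (step N (j + 1)),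
            ψ.1 (wprod s v * g w) * wprod a v) * wprod a w =
            ∑ l, ψ.1 (f l) * ∑ v ∈ words X (step N (j + 1)),
              α (g' l * wprod s (v ++ w)) • wprod a (v ++ w) := fun w _ => by
          simp only [Finset.mul_sum, Finset.sum_mul]
          rw [Finset.sum_comm]
          refine Finset.sum_congr rfl fun v hv => ?_
          rw [key w v hv, Finset.sum_mul, Finset.sum_mul]
          refine Finset.sum_congr rfl fun l _ => ?_
          rw [smul_mul_assoc, smul_mul_assoc, mul_smul_comm, mul_assoc, wprod_append a]
        rw [Finset.sum_congr rfl h1, Finset.sum_comm]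
        refine Finset.sum_eq_zero fun l _ => ?_
        rw [← Finset.mul_sum, h0, mul_zero]
    have hcob' : IsCoboundary (F := fun i => supp (A := A) k s (jump N i)) (koszulMap hN a s)
        (j + 1) θ := by
      rcases Nat.lt_or_ge (j + 1) D with h | h
      · exact hcob _ h θ hcyc
      -- In the top degree `htop` applies, since `θ` takes values in the augmentation ideal.
      · obtain rfl : D = j + 1 := by omega
        refine htop θ ?_
        rw [hθ, map_sum]
        refine Finset.sum_eq_zero fun w hw => ?_
        rw [map_mul, hε w, mul_zero]
        rintro rfl
        have := step_pos hN j
        simp [mem_words] at hw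
        omega
    obtain ⟨θ', hθ'⟩ := hcob'
    obtain ⟨m, f, χ, hf, hχ⟩ := exists_eq_sum_smul_form hB A (jump N j)
    -- The constant part of `θ'`, as an element of `B`. Comparing coefficients of the words of
    -- length `step N j < N` in the coboundary equation gives `g w = s_w y`.
    let y : B := ∑ l, ε (θ' (hB.form A (jump N j) (χ l))) • f l
    have key : ∀ w ∈ words X (step N j), g w = wprod s w * y := fun p hp => by
      have hp' := mem_words.1 hp
      have hpN : p.length < N := by rw [hp']; exact step_lt hN j
      have hcoord : ∀ (r : List X → k) (t : A), hA.coord p (∑ w ∈ words X (step N j),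
          algebraMap k A (r w) * wprod a w * t) = r p * ε t := fun r t => by
        classical
        rw [map_sum, Finset.sum_eq_single_of_mem p hp]
        · rw [mul_assoc, ← Algebra.smul_def, map_smul, hA.coord_wprod_mul hε hpN le_rfl,
            if_pos rfl, smul_eq_mul]
        · intro w hw hwp
          rw [mul_assoc, ← Algebra.smul_def, map_smul,
            hA.coord_wprod_mul hε hpN (by rw [hp', mem_words.1 hw]), if_neg hwp, smul_zero]
      refine eq_of_forall_dual (k := k) fun χ₀ => ?_
      have h1 := LinearMap.congr_fun hθ' (hB.form A (jump N (j + 1)) χ₀)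
      rw [hθ, LinearMap.comp_apply, hχ (koszulMap hN a s j _), map_sum] at h1
      have h2 := congrArg (hA.coord p) h1
      rw [map_sum] at h2
      have h3 : ∀ l, hA.coord p (θ' ((koszulMap hN a s j
          (hB.form A (jump N (j + 1)) χ₀)).1 (f l) • hB.form A (jump N j) (χ l))) =
          χ₀ (wprod s p * f l) * ε (θ' (hB.form A (jump N j) (χ l))) := fun l => by
        rw [map_smul, smul_eq_mul, koszulMap_coe, koszulD_apply, Finset.sum_mul,
          ← hcoord fun w => χ₀ (wprod s w * f l)]
        congr 1
        refine Finset.sum_congr rfl fun w hw => ?_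
        rw [hB.form_apply_of_mem]
        rw [jump_succ hN, add_comm]
        exact mul_mem_gr (wprod_mem_gr' (mem_words.1 hw)) (hf l)
      have h4 : hA.coord p (∑ w ∈ words X (step N j),
          (hB.form A (jump N (j + 1)) χ₀).1 (g w) * wprod a w) = χ₀ (g p) := by
        have := hcoord (fun w => χ₀ (g w)) 1
        rw [map_one, mul_one] at this
        rw [← this]
        congr 1
        refine Finset.sum_congr rfl fun w _ => ?_
        rw [mul_one, hB.form_apply_of_mem _ (hg w)]
      rw [h4, Finset.sum_congr rfl fun l _ => h3 l] at h2
      rw [← h2, Finset.mul_sum, map_sum]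
      refine Finset.sum_congr rfl fun l _ => ?_
      rw [mul_smul_comm, map_smul, smul_eq_mul, mul_comm]
    refine ⟨y, Submodule.sum_mem _ fun l _ => Submodule.smul_mem _ _ (hf l), fun h hh => ?_⟩
    rw [hji] at hh
    refine eq_on_gr_add (α := ν ∘ₗ LinearMap.mulRight k y) (fun t ht w hw => ?_) hh
    rw [LinearMap.comp_apply, LinearMap.mulRight_apply, mul_assoc, ← key w (mem_words.2 hw),
      hgν w t ht]
    rfl

end duality

/-! ### The Gorenstein property -/

section gorenstein

open CategoryTheory

variable {k V : Type u} [Field k] [AddCommGroup V] [Module k V] {N : ℕ} {X : Type} [Fintype X]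
  [DecidableEq X] (b : Module.Basis X k V) {R : Submodule k (⨂[k]^N V)} [hN : Fact (2 ≤ N)]

variable (R) in
/-- The generators of `A`. -/
abbrev gens : X → Alg R := Alg.ι R ∘ b

variable (R) in
/-- The generators of `A^!`. -/
abbrev dualGens : X → DualAlg R := Alg.ι (perp R) ∘ b.dualBasis

variable (R) in
/-- The terms of the Koszul complex. -/
abbrev KoszulModule (i : ℕ) : Type u :=
  supp (A := Alg R) k (dualGens b R) (jump N i)

variable (R) in
/-- The differential of the Koszul complex of `A`. -/
abbrev koszulDiff (i : ℕ) : KoszulModule b R (i + 1) →ₗ[Alg R] KoszulModule b R i :=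
  koszulMap hN.out (gens b R) (dualGens b R) i

theorem projective_supp (i : ℕ) : Module.Projective (Alg R) (KoszulModule b R i) :=
  Module.Projective.of_equiv (suppEquiv (presents_dualAlg b R) (Alg R) (jump N i)).symm

theorem exact_koszulMap_zero :
    Function.Exact (koszulDiff b R 0) (koszulAug R) :=
  LinearMap.exact_iff.2 (range_koszulMap_zero b).symm

theorem IsKoszul.exact_koszulMap (hK : IsKoszul R) (i : ℕ) :
    Function.Exact (koszulDiff b R (i + 1))
      (koszulDiff b R i) := by
  intro φ
  constructor
  · intro h
    obtain ⟨ψ, h1, h2⟩ := hK.koszulExact b i φ.1 φ.2 (congrArg Subtype.val h)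
    exact ⟨⟨ψ, h1⟩, Subtype.ext h2⟩
  · rintro ⟨ψ, rfl⟩
    exact LinearMap.congr_fun
      (koszulMap_comp hN.out (presents_alg b R) (presents_dualAlg b R) i) ψ

theorem IsKoszul.subsingleton_ext_iff (hK : IsKoszul R) {M : Type u} [AddCommGroup M]
    [Module (Alg R) M] {i : ℕ} :
    Subsingleton (Abelian.Ext (ModuleCat.of (Alg R) (TrivialModule R))
      (ModuleCat.of (Alg R) M) i) ↔
      ∀ θ : KoszulModule b R i →ₗ[Alg R] M, θ ∘ₗ koszulDiff b R i = 0 →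
        IsCoboundary (F := KoszulModule b R) (koszulDiff b R) i θ :=
  have := projective_supp b (R := R)
  NHomogeneous.subsingleton_ext_iff (F := KoszulModule b R) (hK.exact_koszulMap b)
    (exact_koszulMap_zero b) (koszulAug_surjective b)

theorem IsKoszul.isCoboundary_of_apply_eq_zero (hK : IsKoszul R) {i : ℕ} (e : ExtkA R i ≃ₗ[k] k)
    (ℓ : (KoszulModule b R i →ₗ[Alg R] Alg R) →ₗ[k] k)
    (hℓ : ∀ θ, IsCoboundary (F := KoszulModule b R) (koszulDiff b R) i θ → ℓ θ = 0)
    {θ₀ θ : KoszulModule b R i →ₗ[Alg R] Alg R} (h₀ : θ₀ ∘ₗ koszulDiff b R i = 0) (h₁ : ℓ θ₀ ≠ 0)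
    (h : θ ∘ₗ koszulDiff b R i = 0) (hθ : ℓ θ = 0) :
    IsCoboundary (F := KoszulModule b R) (koszulDiff b R) i θ :=
  have := projective_supp b (R := R)
  NHomogeneous.isCoboundary_of_apply_eq_zero (F := KoszulModule b R) (hK.exact_koszulMap b)
    (exact_koszulMap_zero b) (koszulAug_surjective b) e ℓ hℓ h₀ h₁ h hθ

/-- The Koszul complex is not longer than the global dimension. -/
theorem IsKoszul.eq_zero_of_globalDimension (hK : IsKoszul R) {D : ℕ}
    (hD : globalDimension (Alg R) = D) {f : DualAlg R}
    (hf : f ∈ gr k (dualGens b R) (jump N (D + 1))) :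
    f = 0 := by
  let ev : Alg R →ₗ[Alg R] TrivialModule R :=
    { toFun y := Alg.aug R y
      map_add' _ _ := map_add (Alg.aug R) _ _
      map_smul' _ _ := map_mul (Alg.aug R) _ _ }
  -- Evaluation at `f` followed by the augmentation is a cocycle with values in `k`, and
  -- `Ext^{D+1}(k, k) = 0` makes it a coboundary. By minimality, coboundaries with values in `k` are
  -- zero, so every linear form kills `f`.
  obtain ⟨θ', hθ'⟩ := (hK.subsingleton_ext_iff b).1
    (subsingleton_ext_of_globalDimension hD D.lt_succ_self _)
    (ev ∘ₗ evalAt (Alg R) (dualGens b R) (jump N (D + 1)) f)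
    (LinearMap.ext fun φ => aug_koszulMap (fun w hw => aug_wprod b R hw) hN.out (D + 1) φ f)
  obtain ⟨m, g, χ, -, e⟩ := exists_eq_sum_smul_form (presents_dualAlg b R) (Alg R) (jump N D)
  refine eq_of_forall_dual (k := k) fun α => ?_
  have h1 := LinearMap.congr_fun hθ' ((presents_dualAlg b R).form (Alg R) (jump N (D + 1)) α)
  rw [LinearMap.comp_apply, e (koszulMap _ _ _ D _), map_sum, Finset.sum_eq_zero] at h1
  · have h2 : (0 : k) = Alg.aug R (((presents_dualAlg b R).form (Alg R) (jump N (D + 1)) α).1 f) :=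
      h1
    rw [(presents_dualAlg b R).form_apply_of_mem _ hf, AlgHom.commutes] at h2
    rw [map_zero]
    exact h2.symm
  · intro l _
    rw [map_smul]
    refine (congrArg (fun t : k => t * (_ : k)) ?_).trans (zero_mul _)
    exact aug_koszulMap (fun w hw => aug_wprod b R hw) hN.out D _ _

theorem extendByZero_of_mem {n : ℕ} (α : Module.Dual k (dualGrade R n)) {y : DualAlg R}
    (hy : y ∈ dualGrade R n) : extendByZero R n α y = α ⟨y, hy⟩ := by
  have h1 : DirectSum.decompose (dualGrade R) y n = ⟨y, hy⟩ :=
    Subtype.ext (DirectSum.decompose_of_mem_same _ hy)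
  exact congrArg α h1

theorem extendByZero_of_mem_ne {m n : ℕ} (h : m ≠ n) (α : Module.Dual k (dualGrade R n))
    {y : DualAlg R} (hy : y ∈ dualGrade R m) : extendByZero R n α y = 0 := by
  have h1 : DirectSum.decompose (dualGrade R) y n = 0 :=
    Subtype.ext (DirectSum.decompose_of_mem_ne _ hy h)
  exact (congrArg α h1).trans (map_zero α)

/-- Every linear form on a component extends to the whole algebra, so it is harmless that
`PerfectAt` quantifies over forms on all of `A^!`. -/
theorem bijective_Phi_iff {n : ℕ} (u : dualGrade R n) (p q : ℕ) :
    Function.Bijective (Phi R u p q) ↔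
      PerfectAt (dualGens b R) (extendByZero R n (dualVector u)) p q := by
  have hg : ∀ n, dualGrade R n = gr k (dualGens b R) n := grade_eq_gr b.dualBasis (perp R)
  constructor
  · rintro ⟨h1, h2⟩
    rw [injective_iff_map_eq_zero] at h1
    refine ⟨fun f hf h => ?_, fun α => ?_⟩
    · rw [← hg] at hf
      exact congrArg Subtype.val (h1 ⟨f, hf⟩ (LinearMap.ext fun y => h y (by
        rw [← hg]; exact y.2)))
    · obtain ⟨f, hf⟩ := h2 (α ∘ₗ (dualGrade R q).subtype)
      refine ⟨f, by rw [← hg]; exact f.2, fun h hh => ?_⟩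
      rw [← hg] at hh
      exact LinearMap.congr_fun hf ⟨h, hh⟩
  · rintro ⟨h1, h2⟩
    refine ⟨(injective_iff_map_eq_zero _).2 fun f hf => Subtype.ext ?_, fun α => ?_⟩
    · refine h1 f (by rw [← hg]; exact f.2) fun h hh => ?_
      rw [← hg] at hh
      exact LinearMap.congr_fun hf ⟨h, hh⟩
    · obtain ⟨α', rfl⟩ := α.exists_extend
      obtain ⟨f, hf, h⟩ := h2 α'
      exact ⟨⟨f, by rwa [hg]⟩, LinearMap.ext fun y => h y (by rw [← hg]; exact y.2)⟩

theorem isASGorenstein_iff_perfectAt (hK : IsKoszul R) {D : ℕ}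
    (hD : globalDimension (Alg R) = D) (hExt : Nonempty (ExtkA R D ≃ₗ[k] k))
    (u : dualGrade R (jump N D)) (hu : Submodule.span k {u} = ⊤) :
    IsASGorenstein R ↔ ∀ i ≤ D,
      PerfectAt (dualGens b R) (extendByZero R (jump N D) (dualVector u))
        (jump N (D - i)) (jump N i) := by
  have hg : ∀ n, dualGrade R n = gr k (dualGens b R) n := grade_eq_gr b.dualBasis (perp R)
  have hz : ∀ f ∈ gr k (dualGens b R) (jump N (D + 1)), f = 0 := fun f hf =>
    hK.eq_zero_of_globalDimension b hD hf
  constructor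
  · rintro ⟨D', hD', hExt', -⟩ i hi
    obtain rfl : D = D' := by
      rw [hD] at hD'
      exact_mod_cast hD'
    obtain ⟨e⟩ := hExt
    have hcyc : ∀ θ : KoszulModule b R D →ₗ[Alg R] Alg R, θ ∘ₗ koszulDiff b R D = 0 := fun θ =>
      LinearMap.ext fun φ => by
        rw [show φ = 0 from eq_of_forall_mem_gr (presents_dualAlg b R) fun f hf => by
          rw [hz f hf, map_zero, map_zero], map_zero, map_zero]
    -- If `u = 0`, then `K_D = 0` and `Ext^D` vanishes, contradicting its dimension.
    have hu0 : u ≠ 0 := by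
      rintro rfl
      have hsub : Subsingleton (ExtkA R D) := (hK.subsingleton_ext_iff b).2 fun θ _ => by
        have h0 : ∀ φ : KoszulModule b R D, φ = 0 := fun φ =>
          eq_of_forall_mem_gr (presents_dualAlg b R) fun f hf => by
            rw [← hg] at hf
            have h1 : (⟨f, hf⟩ : dualGrade R (jump N D)) ∈ Submodule.span k {0} := by
              rw [hu]; trivial
            rw [Submodule.span_zero_singleton, Submodule.mem_bot] at h1
            rw [show f = 0 from congrArg Subtype.val h1, map_zero, map_zero]
        have hθ : θ = 0 := LinearMap.ext fun φ => by rw [h0 φ, map_zero, map_zero]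
        rw [hθ]
        rcases D with _ | D
        · rfl
        · exact ⟨0, LinearMap.zero_comp _⟩
      have h1 := Subsingleton.elim (e.symm 1) (e.symm 0)
      exact one_ne_zero (e.symm.injective h1)
    have hν1 : extendByZero R (jump N D) (dualVector u) u = 1 :=
      (extendByZero_of_mem _ u.2).trans (dualVector_self hu0)
    have huD : (u : DualAlg R) ∈ gr k (dualGens b R) (jump N D) := by rw [← hg]; exact u.2
    -- The constant term at `u*`. It kills coboundaries by minimality and not the evaluation at `u`,
    -- so by one-dimensionality of `Ext^D` its kernel consists of coboundaries; all top cochains are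
    -- cocycles because `K_{D+1} = 0`.
    let ℓ : (KoszulModule b R D →ₗ[Alg R] Alg R) →ₗ[k] k :=
      { toFun θ := Alg.aug R (θ ((presents_dualAlg b R).leftForm (Alg R)
          (extendByZero R (jump N D) (dualVector u)) (jump N D) 1))
        map_add' θ θ' := by simp
        map_smul' c θ := by simp }
    refine perfectAt_of_isCoboundary hN.out (presents_alg b R) (presents_dualAlg b R)
      (ε := Alg.aug R) (fun w hw => aug_wprod b R hw) hz huD hν1 (fun f hf => ?_)
      (fun i hi => (hK.subsingleton_ext_iff b).1 (hExt' i hi.ne)) (fun θ hθ => ?_) hi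
    · rw [← hg] at hf
      have h1 : (⟨f, hf⟩ : dualGrade R (jump N D)) ∈ Submodule.span k {u} := by
        rw [hu]; trivial
      obtain ⟨c, hc⟩ := Submodule.mem_span_singleton.1 h1
      have hc' : c • (u : DualAlg R) = f := congrArg Subtype.val hc
      rw [← hc', map_smul, hν1, smul_eq_mul, mul_one]
    · refine hK.isCoboundary_of_apply_eq_zero b e ℓ
        (fun θ hθ => aug_isCoboundary (fun w hw => aug_wprod b R hw) hN.out
          (presents_dualAlg b R) hθ _)
        (θ₀ := evalAt (Alg R) (dualGens b R) (jump N D) u) (hcyc _) ?_ (hcyc _) hθ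
      change Alg.aug R _ ≠ 0
      rw [evalAt_apply, (presents_dualAlg b R).leftForm_apply, AlgHom.commutes,
        (presents_dualAlg b R).proj_of_mem (by rwa [grZ_natCast]), one_mul, hν1]
      exact one_ne_zero
  · intro h
    refine ⟨D, hD, fun i hi => ?_, hExt⟩
    rcases Nat.lt_or_gt_of_ne hi with hi | hi
    · refine (hK.subsingleton_ext_iff b).2 fun θ hθ =>
        isCoboundary_of_perfectAt (hK.koszulExact b) hN.out (presents_alg b R)
          (presents_dualAlg b R) (fun w hw => ?_) hz h hi hθ
      exact extendByZero_of_mem_ne hw _ (by rw [hg]; exact wprod_mem_gr w)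
    · exact subsingleton_ext_of_globalDimension hD hi _

end gorenstein

end NHomogeneous

end

open NHomogeneous in
theorem theorem5p4 {k V : Type u} [Field k] [AddCommGroup V] [Module k V] [FiniteDimensional k V]
    {N : ℕ} [Fact (2 ≤ N)] (R : Submodule k (⨂[k]^N V)) (hK : IsKoszul R)
    (D : ℕ) (hD : globalDimension (Alg R) = D) (hExt : Nonempty (ExtkA R D ≃ₗ[k] k))
    (u : dualGrade R (jump N D)) (hu : Submodule.span k {u} = ⊤) :
    IsASGorenstein R ↔
      ∀ i ≤ D, Function.Bijective (Phi R u (jump N (D - i)) (jump N i)) := by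
  rw [isASGorenstein_iff_perfectAt (Module.finBasis k V) hK hD hExt u hu]
  exact forall₂_congr fun i _ => (bijective_Phi_iff (Module.finBasis k V) u _ _).symm
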